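/- Let $K$ be a field, $R=K[X,Y]$. A monomial of $R^m$ is $\nu e_i$ with $\nu$ a monomial of $R$ and $1\le i\le m$; a monomial order on $R^m$ is a total order $\preceq$ on these monomials such that $\mu_1\preceq\mu_2$ implies $\mu_1\preceq\nu\mu_1\preceq\nu\mu_2$ for all monomials $\nu$ of $R$. Write $\mathrm{lm}(p)$ for the largest monomial occurring in $p\in R^m$, with $\mathrm{lm}(0)=0$. A matrix with rows $p_1,\dots,p_k$ in a submodule $M\subseteq R^m$ is a $\preceq$-Gröbner basis of $M$ if $\langle \mathrm{lm}(M)\rangle=\langle \mathrm{lm}(p_1),\dots,\mathrm{lm}(p_k)\rangle$; it is minimal if no $\mathrm{lm}(p_i)$ is divisible by some $\mathrm{lm}(p_j)$ with $j\ne i$. For $N\subseteq R^n$ and $F\in R^{m\times n}$ let $\mathrm{Syz}_N(F)=\{p\in R^m : pF\in N\}$. **Algorithm BaseCase**$(\varphi,G,\preceq,(\mu_1,\dots,\mu_k))$, for a linear functional $\varphi$ on $R^n$, $G\in R^{k\times n}$ with rows $g_i$, and monomials $\mu_i$ of $R^m$. Let $v_i=\varphi(g_i)$. If all $v_i=0$,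 return the identity matrix $I_k$ and $(\mu_i)_i$. Otherwise let $\pi$ be the index with $v_\pi\neq0$ for which $\mu_\pi$ is $\preceq$-smallest (ties broken by the index), $\lambda_i=-v_i/v_\pi$ for $i\ne\pi$, and for each variable $X_j\in\{X,Y\}$ with $X_j\mu_\pi\notin\langle\mu_i,\ i\neq\pi\rangle$ let $\alpha_j=\varphi(X_jg_\pi)/v_\pi$. Return the matrix with rows $e_i+\lambda_ie_\pi$ $(i<\pi)$, $(X_j-\alpha_j)e_\pi$ (for these $j$), $e_i+\lambda_ie_\pi$ $(i>\pi)$, and the list of monomials $\mu_i$ $(i<\pi)$, $X_j\mu_\pi$, $\mu_i$ $(i>\pi)$. **Algorithm Padé**$(d,e,G,\preceq,L)$, for $d,e\ge1$, $G\in R^{k\times n}$ and a list $L$ of $k$ monomials of $R^m$. * If $d=e=1$: start with $P=I_k$ and $H=G \bmod X,Y$. For $i=1,\dots,n$ call BaseCase on $H$, $\preceq$, $L$ and the functional $f\mapsto f_i(0,0)$, obtain $(Q,L)$, and replace $P$ by $QP \bmod X^2,Y^2$ and $H$ by $QH\bmod X,Y$, these products being computed naively. Return $(P,L)$. * If $e>1$: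 let $(P_1,L_1)=\text{Padé}(d,\lfloor e/2\rfloor,G,\preceq,L)$, $G_2=Y^{-\lfloor e/2\rfloor}(P_1G\bmod X^d,Y^e)$, $(P_2,L_2)=\text{Padé}(d,\lceil e/2\rceil,G_2,\preceq,L_1)$; return $(P_2P_1\bmod X^{d+1},Y^{e+1},\ L_2)$. * If $e=1<d$: do the same with the exponent of $X$ split instead, i.e. with calls for $(\lfloor d/2\rfloor,1)$ and $(\lceil d/2\rceil,1)$ and $G_2=X^{-\lfloor d/2\rfloor}(P_1G\bmod X^d,Y^e)$. The products $P_1G$ and $P_2P_1$ are computed by a routine for truncated products of matrices of bivariate polynomials, consisting of one division-free straight-line program over $K$ for each size and each pair of degree bounds. The algorithm is applied to $F\in R^{m\times n}$ by running $\text{Padé}(d,e,F,\preceq,(e_1,\dots,e_m))$, where $F$ is given by its coefficients of degree less than $d$ in $X$ and less than $e$ in $Y$. Additions, subtractions, multiplications, divisions and zero tests in $K$ each count as one operation; constants of $K$, index manipulations and comparisons of monomials are free. Let $\omega\in\mathbb R$ be a feasible exponent of matrix multiplication over $K$: for every $N\ge1$, the product of two $N\times N$ matrices of indeterminates can be computed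 by a division-free straight-line program over $K$ with $O(N^\omega)$ instructions. Here $\tilde O(f)$ stands for a bound $C f\,(\log(2+f))^c$ with constants $C,c$ that may depend only on $K$ and $\omega$ (and on the chosen multiplication routine). **Statement.** 1. (Correctness.) Whatever correct multiplication routine is used, for all $m,n,d,e\ge1$, every monomial order $\preceq$ on $R^m$ and every $F\in R^{m\times n}$ with $\deg_XF<d$ and $\deg_YF<e$, Algorithm Padé computes a minimal $\preceq$-Gröbner basis of $\mathrm{Syz}_N(F)$, where $N=\langle X^d,Y^e\rangle\times\cdots\times\langle X^d,Y^e\rangle\subseteq R^n$. 2. (Complexity.) There is a correct multiplication routine such that, for all such $m,n,d,e,\preceq,F$, Algorithm Padé uses $$\tilde O\big((\rho^{\omega-1}+\rho n)(\rho+n)\,d\,e\big)$$ operations in $K$, where $\rho=m\min(d,e)$. 3. (Hermite–Padé approximants.) With the same routine, for all $m,d\ge1$, every monomial order $\preceq$ on $R^m$ and all $f_1,\dots,f_m\in R$, Algorithm Padé (with $n=1$ and $e=d$, run on the coefficients of $f_1,\dots,f_m$ of degree less than $d$ in each variable) computes a minimal $\preceq$-Gröbner basis of $$\{(p_1,\dots,p_m)\in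 R^m : p_1f_1+\cdots+p_mf_m=0 \bmod \langle X^d,Y^d\rangle\}$$ using $\tilde O(m^\omega d^{\omega+2})$ operations in $K$. -/

import Mathlib

/-! ## Monomials and monomial orders of the free module `K[X,Y]^m` -/

/-- The polynomial ring `K[X, Y]`; the variable `X` has index `0` and `Y` has index `1`. -/
abbrev BiRing (K : Type*) [CommSemiring K] := MvPolynomial (Fin 2) K

/-- The monomials `X^a Y^b e_i` of `K[X,Y]^m`, as pairs (exponent vector, support `i`). -/
abbrev Mon (m : ℕ) := (Fin 2 →₀ ℕ) × Fin m

namespace Mon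

/-- The product `ν μ` of a monomial `ν` of `K[X,Y]` and a monomial `μ` of `K[X,Y]^m`. -/
noncomputable def mul {m : ℕ} (ν : Fin 2 →₀ ℕ) (μ : Mon m) : Mon m := (ν + μ.1, μ.2)

/-- Divisibility of monomials of `K[X,Y]^m`. -/
def Dvd {m : ℕ} (μ₁ μ₂ : Mon m) : Prop := ∃ ν : Fin 2 →₀ ℕ, μ₂ = mul ν μ₁

theorem mul_zero {m : ℕ} (μ : Mon m) : mul 0 μ = μ := by simp [mul]

theorem mul_mul {m : ℕ} (a b : Fin 2 →₀ ℕ) (μ : Mon m) : mul (a + b) μ = mul a (mul b μ) := by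
  simp [mul, add_assoc]

theorem mul_injective {m : ℕ} (a : Fin 2 →₀ ℕ) {μ₁ μ₂ : Mon m} (h : mul a μ₁ = mul a μ₂) :
    μ₁ = μ₂ := by
  simp only [mul, Prod.mk.injEq, add_right_inj] at h
  exact Prod.ext h.1 h.2

end Mon

/-- A monomial order on `K[X,Y]^m`: a total order on the monomials such that `μ₁ ≤ μ₂` implies
`μ₁ ≤ ν μ₁ ≤ ν μ₂` for every monomial `ν` of `K[X,Y]`. -/
structure ModMonOrder (m : ℕ) where
  le : Mon m → Mon m → Prop
  refl : ∀ μ, le μ μ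
  trans : ∀ μ₁ μ₂ μ₃, le μ₁ μ₂ → le μ₂ μ₃ → le μ₁ μ₃
  antisymm : ∀ μ₁ μ₂, le μ₁ μ₂ → le μ₂ μ₁ → μ₁ = μ₂
  total : ∀ μ₁ μ₂, le μ₁ μ₂ ∨ le μ₂ μ₁
  mul : ∀ (ν : Fin 2 →₀ ℕ) (μ₁ μ₂ : Mon m), le μ₁ μ₂ →
    le μ₁ (Mon.mul ν μ₁) ∧ le (Mon.mul ν μ₁) (Mon.mul ν μ₂)

namespace ModMonOrder

/-- The Schreyer order for `ord` and the list `LM = (μ_1, …, μ_k)`: `ν₁ e_i` is smaller than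
`ν₂ e_j` when `ν₁ μ_i` is smaller than `ν₂ μ_j`, ties being broken by the indices. -/
def schreyer {m k : ℕ} (ord : ModMonOrder m) (LM : Fin k → Mon m) : ModMonOrder k where
  le x y := (ord.le (Mon.mul x.1 (LM x.2)) (Mon.mul y.1 (LM y.2)) ∧
      Mon.mul x.1 (LM x.2) ≠ Mon.mul y.1 (LM y.2)) ∨
    (Mon.mul x.1 (LM x.2) = Mon.mul y.1 (LM y.2) ∧ x.2 ≤ y.2)
  refl x := Or.inr ⟨rfl, le_rfl⟩
  trans x y z hxy hyz := by
    rcases hxy with ⟨h1, h2⟩ | ⟨h1, h2⟩ <;> rcases hyz with ⟨h3, h4⟩ | ⟨h3, h4⟩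
    · refine Or.inl ⟨ord.trans _ _ _ h1 h3, fun h => h4 ?_⟩
      rw [h] at h1
      exact ord.antisymm _ _ h3 h1
    · rw [h3] at h1 h2
      exact Or.inl ⟨h1, h2⟩
    · rw [← h1] at h3 h4
      exact Or.inl ⟨h3, h4⟩
    · exact Or.inr ⟨h1.trans h3, h2.trans h4⟩
  antisymm x y hxy hyx := by
    rcases hxy with ⟨h1, h2⟩ | ⟨h1, h2⟩ <;> rcases hyx with ⟨h3, h4⟩ | ⟨h3, h4⟩
    · exact absurd (ord.antisymm _ _ h1 h3) h2
    · exact absurd h3.symm h2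
    · exact absurd h1.symm h4
    · have hi : x.2 = y.2 := le_antisymm h2 h4
      rw [hi] at h1
      simp only [Mon.mul, Prod.mk.injEq, add_left_inj] at h1
      exact Prod.ext h1.1 hi
  total x y := by
    by_cases h : Mon.mul x.1 (LM x.2) = Mon.mul y.1 (LM y.2)
    · rcases le_total x.2 y.2 with hi | hi
      · exact Or.inl (Or.inr ⟨h, hi⟩)
      · exact Or.inr (Or.inr ⟨h.symm, hi⟩)
    · rcases ord.total (Mon.mul x.1 (LM x.2)) (Mon.mul y.1 (LM y.2)) with h' | h'
      · exact Or.inl (Or.inl ⟨h', h⟩)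
      · exact Or.inr (Or.inl ⟨h', Ne.symm h⟩)
  mul ν x y hxy := by
    have key : ∀ z : Mon k, Mon.mul (Mon.mul ν z).1 (LM (Mon.mul ν z).2) =
        Mon.mul ν (Mon.mul z.1 (LM z.2)) := fun z => Mon.mul_mul ν z.1 (LM z.2)
    rw [key, key]
    constructor
    · by_cases h : Mon.mul x.1 (LM x.2) = Mon.mul ν (Mon.mul x.1 (LM x.2))
      · exact Or.inr ⟨h, le_rfl⟩
      · exact Or.inl ⟨(ord.mul ν _ _ (ord.refl _)).1, h⟩
    · rcases hxy with ⟨h1, h2⟩ | ⟨h1, h2⟩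
      · exact Or.inl ⟨(ord.mul ν _ _ h1).2, fun h => h2 (Mon.mul_injective ν h)⟩
      · exact Or.inr ⟨congrArg _ h1, h2⟩

end ModMonOrder

/-! ## Leading monomials, Gröbner bases, syzygy modules -/

section Groebner

variable {K : Type*} [Field K] {m : ℕ}

/-- The monomial `μ` as an element of `K[X,Y]^m`. -/
noncomputable def monVec (K : Type*) [Field K] {m : ℕ} (μ : Mon m) : Fin m → BiRing K :=
  Pi.single μ.2 (MvPolynomial.monomial μ.1 1)

/-- `μ` is the largest of the monomials that occur in `p`. -/
def IsLeading (ord : ModMonOrder m) (p : Fin m → BiRing K) (μ : Mon m) : Prop :=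
  (p μ.2).coeff μ.1 ≠ 0 ∧ ∀ μ' : Mon m, (p μ'.2).coeff μ'.1 ≠ 0 → ord.le μ' μ

open Classical in
/-- The leading monomial of `p`, as an element of `K[X,Y]^m`; it is `0` for `p = 0`. -/
noncomputable def lm (ord : ModMonOrder m) (p : Fin m → BiRing K) : Fin m → BiRing K :=
  if h : ∃ μ, IsLeading ord p μ then monVec K h.choose else 0

/-- The rows of `P` form a Gröbner basis of the submodule `M`. -/
def IsGroebnerBasis (ord : ModMonOrder m) (M : Submodule (BiRing K) (Fin m → BiRing K))
    {k : ℕ} (P : Matrix (Fin k) (Fin m) (BiRing K)) : Prop :=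
  (∀ i, P i ∈ M) ∧
    Submodule.span (BiRing K) (lm ord '' (M : Set (Fin m → BiRing K))) =
      Submodule.span (BiRing K) (Set.range fun i => lm ord (P i))

/-- The rows of `P` form a minimal Gröbner basis of `M`: no leading monomial of a row is
divisible by the leading monomial of another row. -/
def IsMinimalGroebnerBasis (ord : ModMonOrder m)
    (M : Submodule (BiRing K) (Fin m → BiRing K))
    {k : ℕ} (P : Matrix (Fin k) (Fin m) (BiRing K)) : Prop :=
  IsGroebnerBasis ord M P ∧
    ∀ i j, j ≠ i → ¬ ∃ q : BiRing K, lm ord (P i) = q • lm ord (P j)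

/-- The syzygy module `Syz_N(F) = {p ∈ K[X,Y]^m | p F ∈ N}`. -/
noncomputable def syzModule {n : ℕ} (N : Submodule (BiRing K) (Fin n → BiRing K))
    (F : Matrix (Fin m) (Fin n) (BiRing K)) : Submodule (BiRing K) (Fin m → BiRing K) :=
  N.comap F.vecMulLinear

/-- The ideal `⟨X^d, Y^e⟩`. -/
noncomputable def padeIdeal (K : Type*) [Field K] (d e : ℕ) : Ideal (BiRing K) :=
  Ideal.span {MvPolynomial.X 0 ^ d, MvPolynomial.X 1 ^ e}

/-- The module `N = ⟨X^d, Y^e⟩ × ⋯ × ⟨X^d, Y^e⟩ ⊆ K[X,Y]^n`. -/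
noncomputable def padeModule (K : Type*) [Field K] (n d e : ℕ) :
    Submodule (BiRing K) (Fin n → BiRing K) :=
  Submodule.pi Set.univ fun _ => padeIdeal K d e

/-- The module of Hermite-Padé approximants
`{(p_1, …, p_m) | p_1 f_1 + ⋯ + p_m f_m = 0 mod ⟨X^d, Y^d⟩}`. -/
noncomputable def hermitePade (f : Fin m → BiRing K) (d : ℕ) :
    Submodule (BiRing K) (Fin m → BiRing K) :=
  Submodule.comap (Fintype.linearCombination (BiRing K) f) (padeIdeal K d d)

end Groebner

/-! ## Counting field operations

Algorithms are written for an arbitrary type `V` of field elements on which nothing is available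
but the operations of a structure `FieldOps K V`. Running an algorithm with `FieldOps.counted K`
computes in `K` and counts every arithmetic operation and every zero test. -/

/-- A result together with the number of field operations spent on it. -/
structure Counted (α : Type*) where
  val : α
  cost : ℕ

namespace Counted

/-- A result that needs no field operation. -/
def ret {α : Type*} (a : α) : Counted α := ⟨a, 0⟩

/-- Sequential composition. -/
def bind {α β : Type*} (x : Counted α) (f : α → Counted β) : Counted β :=
  ⟨(f x.val).val, x.cost + (f x.val).cost⟩

/-- A finite family of independent computations. -/
def all {ι β : Type*} [Fintype ι] (f : ι → Counted β) : Counted (ι → β) :=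
  ⟨fun i => (f i).val, ∑ i, (f i).cost⟩

/-- A loop over a list. -/
def loop {α β : Type*} (step : β → α → Counted β) : β → List α → Counted β
  | s, [] => ret s
  | s, a :: l => (step s a).bind fun s' => loop step s' l

end Counted

/-- The operations an algorithm may perform on field elements: write a constant of `K` (free),
the four arithmetic operations, and the test for zero. -/
structure FieldOps (K V : Type*) where
  const : K → V
  add : V → V → Counted V
  sub : V → V → Counted V
  mul : V → V → Counted V
  div : V → V → Counted V
  isZero : V → Counted Bool

open Classical in
/-- The operations of the field `K`, each at cost one. -/
noncomputable def FieldOps.counted (K : Type*) [Field K] : FieldOps K K where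
  const c := c
  add x y := ⟨x + y, 1⟩
  sub x y := ⟨x - y, 1⟩
  mul x y := ⟨x * y, 1⟩
  div x y := ⟨x / y, 1⟩
  isZero x := ⟨decide (x = 0), 1⟩

/-! ## Straight-line programs and the exponent of matrix multiplication -/

/-- An operand: a constant of `K`, an input, or the result of the instruction number `t`. -/
inductive Operand (K ι : Type*) where
  | const (c : K)
  | input (i : ι)
  | reg (t : ℕ)

/-- The operations of a straight-line program. -/
inductive ArithOp where
  | add
  | sub
  | mul

/-- One instruction of a straight-line program. -/
structure Instr (K ι : Type*) where
  op : ArithOp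
  lhs : Operand K ι
  rhs : Operand K ι

/-- A division-free straight-line program over `K`, with inputs indexed by `ι` and outputs indexed
by `o`. Its size is the number of its instructions. -/
structure Circuit (K ι o : Type*) where
  code : List (Instr K ι)
  out : o → Operand K ι

/-- The number of instructions. -/
def Circuit.size {K ι o : Type*} (c : Circuit K ι o) : ℕ := c.code.length

section CircuitEval

variable {K ι o A : Type*} [Field K] [CommRing A] [Algebra K A]

/-- The value of an operand in the `K`-algebra `A`; `regs` holds the results so far. -/
def Operand.eval (x : ι → A) (regs : List A) : Operand K ι → A
  | .const c => algebraMap K A c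
  | .input i => x i
  | .reg t => regs.getD t 0

/-- The value of an instruction in the `K`-algebra `A`. -/
def Instr.eval (x : ι → A) (regs : List A) (I : Instr K ι) : A :=
  match I.op with
  | .add => I.lhs.eval x regs + I.rhs.eval x regs
  | .sub => I.lhs.eval x regs - I.rhs.eval x regs
  | .mul => I.lhs.eval x regs * I.rhs.eval x regs

/-- The outputs of a straight-line program in the `K`-algebra `A`. -/
def Circuit.eval (c : Circuit K ι o) (x : ι → A) : o → A :=
  fun j => (c.out j).eval x (c.code.foldl (fun regs I => regs ++ [I.eval x regs]) [])

end CircuitEval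

/-- The straight-line program `c` computes the product of two `N × N` matrices: run on
indeterminates `a_{ij}`, `b_{ij}`, it outputs the polynomials `∑_l a_{il} b_{lj}`. -/
def Circuit.ComputesMatMul {K : Type*} [Field K] {N : ℕ}
    (c : Circuit K ((Fin N × Fin N) ⊕ (Fin N × Fin N)) (Fin N × Fin N)) : Prop :=
  ∀ i j, c.eval (A := MvPolynomial ((Fin N × Fin N) ⊕ (Fin N × Fin N)) K)
      MvPolynomial.X (i, j) =
    ∑ l, MvPolynomial.X (Sum.inl (i, l)) * MvPolynomial.X (Sum.inr (l, j))

/-- `ω` is a feasible exponent of matrix multiplication over `K`: two `N × N` matrices can be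
multiplied in `O(N^ω)` operations. -/
def IsMatMulExponent (K : Type*) [Field K] (ω : ℝ) : Prop :=
  ∃ A : ℝ, ∀ N : ℕ, 1 ≤ N →
    ∃ c : Circuit K ((Fin N × Fin N) ⊕ (Fin N × Fin N)) (Fin N × Fin N),
      c.ComputesMatMul ∧ (c.size : ℝ) ≤ A * (N : ℝ) ^ ω

section CircuitRun

variable {K V ι o : Type*} [Field K] (ops : FieldOps K V)

/-- Fetch an operand. -/
def Operand.fetch (x : ι → V) (regs : List V) : Operand K ι → V
  | .const c => ops.const c
  | .input i => x i
  | .reg t => regs.getD t (ops.const 0)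

/-- Execute an instruction. -/
def Instr.exec (x : ι → V) (regs : List V) (I : Instr K ι) : Counted V :=
  match I.op with
  | .add => ops.add (I.lhs.fetch ops x regs) (I.rhs.fetch ops x regs)
  | .sub => ops.sub (I.lhs.fetch ops x regs) (I.rhs.fetch ops x regs)
  | .mul => ops.mul (I.lhs.fetch ops x regs) (I.rhs.fetch ops x regs)

/-- Execute a straight-line program. -/
def Circuit.run (c : Circuit K ι o) (x : ι → V) : Counted (o → V) :=
  (Counted.loop (fun regs I => (I.exec ops x regs).bind fun v => .ret (regs ++ [v]))
      [] c.code).bind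
    fun regs => .ret fun j => (c.out j).fetch ops x regs

end CircuitRun

/-! ## Bivariate polynomials as arrays of coefficients -/

/-- A polynomial `∑_{i<a, j<b} c_{ij} X^i Y^j`, given by its coefficients. -/
abbrev BPoly (V : Type*) (a b : ℕ) := Fin a × Fin b → V

namespace BPoly

variable {V : Type*} {a b : ℕ}

/-- The coefficient of `X^i Y^j`, with `z` standing for zero out of the range of the array. -/
def coeffD (z : V) (p : BPoly V a b) (i j : ℕ) : V :=
  if h : i < a ∧ j < b then p (⟨i, h.1⟩, ⟨j, h.2⟩) else z

/-- Truncation modulo `X^a', Y^b'` (or padding by zeros). -/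
def trunc (z : V) (p : BPoly V a b) (a' b' : ℕ) : BPoly V a' b' :=
  fun ij => p.coeffD z ij.1 ij.2

/-- `X^{-s} Y^{-t} p`, truncated to the bounds `a', b'`. -/
def divXY (z : V) (p : BPoly V a b) (s t a' b' : ℕ) : BPoly V a' b' :=
  fun ij => p.coeffD z (ij.1 + s) (ij.2 + t)

/-- `X p` (for `j = 0`) or `Y p` (for `j = 1`), modulo `X^a, Y^b`. -/
def mulVar (z : V) (j : Fin 2) (p : BPoly V a b) : BPoly V a b :=
  fun ij =>
    if j = 0 then (if (ij.1 : ℕ) = 0 then z else p.coeffD z (ij.1 - 1) ij.2)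
    else (if (ij.2 : ℕ) = 0 then z else p.coeffD z ij.1 (ij.2 - 1))

/-- The polynomial with the given coefficients. -/
noncomputable def toPoly {K : Type*} [Field K] (p : BPoly K a b) : BiRing K :=
  ∑ ij : Fin a × Fin b,
    MvPolynomial.C (p ij) * MvPolynomial.X 0 ^ (ij.1 : ℕ) * MvPolynomial.X 1 ^ (ij.2 : ℕ)

/-- The array of the coefficients of `X^i Y^j`, for `i < a` and `j < b`, of a polynomial. -/
noncomputable def ofPoly {K : Type*} [Field K] (a b : ℕ) (f : BiRing K) : BPoly K a b :=
  fun ij => f.coeff (Finsupp.single 0 (ij.1 : ℕ) + Finsupp.single 1 (ij.2 : ℕ))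

end BPoly

/-- A routine for multiplying matrices of bivariate polynomials: for all sizes, a straight-line
program whose inputs are the coefficients of a `k × l` and an `l × c` matrix with entries of
degree less than `a` in `X` and less than `b` in `Y`, and whose outputs are the coefficients of a
`k × c` matrix of such polynomials. -/
abbrev MulRoutine (K : Type*) := ∀ k l c a b : ℕ,
  Circuit K ((Fin k × Fin l × Fin a × Fin b) ⊕ (Fin l × Fin c × Fin a × Fin b))
    (Fin k × Fin c × Fin a × Fin b)

/-- The routine computes the product of the matrices modulo `X^a, Y^b`. -/
def MulRoutine.IsCorrect {K : Type*} [Field K] (M : MulRoutine K) : Prop :=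
  ∀ (k l c a b : ℕ) (P : Fin k → Fin l → BPoly K a b) (Q : Fin l → Fin c → BPoly K a b)
    (i : Fin k) (j : Fin c) (s : Fin a) (t : Fin b),
    (M k l c a b).eval
        (Sum.elim (fun x => P x.1 x.2.1 x.2.2) (fun x => Q x.1 x.2.1 x.2.2)) (i, j, s, t) =
      BPoly.ofPoly a b (∑ r, (P i r).toPoly * (Q r j).toPoly) (s, t)

/-! ## The algorithms -/

section Algorithms

variable {K V : Type*} [Field K] (ops : FieldOps K V)

/-- A row of an elementary Gröbner basis with `k` columns. -/
inductive ElemRow (V : Type*) (k : ℕ) where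
  /-- the row `e_i` -/
  | unit (i : Fin k)
  /-- the row `e_i + c e_π` -/
  | comb (i π : Fin k) (c : V)
  /-- the row `(X_j - α) e_π` -/
  | lin (j : Fin 2) (π : Fin k) (α : V)

/-- An elementary Gröbner basis (a list of rows) with the corresponding list of monomials. -/
structure ElemBasis (V : Type*) (m k : ℕ) where
  rows : ℕ
  row : Fin rows → ElemRow V k
  LM : Fin rows → Mon m

/-- The index `π` that minimizes `e_π` for the Schreyer order among the indices whose flag says
that the value is not zero. -/
def IsPivot {m k : ℕ} (ord : ModMonOrder m) (LM : Fin k → Mon m) (zeroFlag : Fin k → Bool)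
    (π : Fin k) : Prop :=
  zeroFlag π = false ∧
    ∀ i, zeroFlag i = false → (ord.schreyer LM).le ((0 : Fin 2 →₀ ℕ), π) ((0 : Fin 2 →₀ ℕ), i)

open Classical in
/-- The indices `j`, in increasing order, of the variables such that `X_j μ_π` is not in the
module generated by the monomials `μ_i` with `i ≠ π`. -/
noncomputable def keptVars {m k : ℕ} (LM : Fin k → Mon m) (π : Fin k) : List (Fin 2) :=
  (List.finRange 2).filter fun j =>
    ∀ i, i ≠ π → ¬ (LM i).Dvd (Mon.mul (Finsupp.single j 1) (LM π))

/-- The rows of the elementary basis, from top to bottom: `inl i` stands for the row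
`e_i + λ_i e_π` with `i ≠ π`, and `inr j` for the row `(X_j - α_j) e_π`. -/
noncomputable def rowLabels {m k : ℕ} (LM : Fin k → Mon m) (π : Fin k) :
    List (Fin k ⊕ Fin 2) :=
  (List.finRange k).flatMap fun i =>
    if i = π then (keptVars LM π).map Sum.inr else [Sum.inl i]

open Classical in
/-- Algorithm `Syzygy_BaseCase` for the linear functional `lf` (which reads off a coefficient, so
that applying it needs no field operation) and the matrix `G` with rows `G i`. -/
noncomputable def baseCase {m n k a b : ℕ} (lf : (Fin n → BPoly V a b) → V)
    (G : Fin k → Fin n → BPoly V a b) (ord : ModMonOrder m) (LM : Fin k → Mon m) :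
    Counted (ElemBasis V m k) :=
  let v : Fin k → V := fun i => lf (G i)
  (Counted.all fun i => ops.isZero (v i)).bind fun zeroFlag =>
  if h : ∃ π, IsPivot ord LM zeroFlag π then
    let π := h.choose
    let labels := rowLabels LM π
    (Counted.all fun s : Fin labels.length =>
      match labels.get s with
      | .inl i => (ops.sub (ops.const 0) (v i)).bind fun w =>
          (ops.div w (v π)).bind fun c => .ret (ElemRow.comb i π c)
      | .inr j =>
          (ops.div (lf fun c => (G π c).mulVar (ops.const 0) j) (v π)).bind fun α =>
            .ret (ElemRow.lin j π α)).bind fun row =>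
    .ret
      { rows := labels.length
        row := row
        LM := fun s =>
          match labels.get s with
          | .inl i => LM i
          | .inr j => Mon.mul (Finsupp.single j 1) (LM π) }
  else
    .ret { rows := k, row := fun i => .unit i, LM := LM }

/-- The product, modulo `X^a, Y^b`, of an elementary Gröbner basis and a matrix `M`, computed
naively. -/
def elemMul {m k c a b : ℕ} (E : ElemBasis V m k) (M : Fin k → Fin c → BPoly V a b) :
    Counted (Fin E.rows → Fin c → BPoly V a b) :=
  Counted.all fun s => Counted.all fun t => Counted.all fun ij =>
    match E.row s with
    | .unit i => .ret (M i t ij)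
    | .comb i π w => (ops.mul w (M π t ij)).bind fun y => ops.add (M i t ij) y
    | .lin j π α => (ops.mul α (M π t ij)).bind fun y =>
        ops.sub ((M π t).mulVar (ops.const 0) j ij) y

/-- A matrix of bivariate polynomials with `k` columns and a list of monomials, one per row. -/
structure PadeOutput (V : Type*) (m k a b : ℕ) where
  rows : ℕ
  mat : Fin rows → Fin k → BPoly V a b
  LM : Fin rows → Mon m

/-- The state of the loop in the case of the ideal `⟨X, Y⟩`. -/
structure LoopState (V : Type*) (m k n : ℕ) where
  rows : ℕ
  mat : Fin rows → Fin k → BPoly V 2 2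
  res : Fin rows → Fin n → BPoly V 1 1
  LM : Fin rows → Mon m

/-- Algorithm `Padé` for `d = e = 1`. -/
noncomputable def padeOne {m n k a b : ℕ} (G : Fin k → Fin n → BPoly V a b)
    (ord : ModMonOrder m) (LM : Fin k → Mon m) : Counted (PadeOutput V m k 2 2) :=
  let start : LoopState V m k n :=
    { rows := k
      mat := fun i j ij =>
        if i = j ∧ (ij.1 : ℕ) = 0 ∧ (ij.2 : ℕ) = 0 then ops.const 1 else ops.const 0
      res := fun i j => (G i j).trunc (ops.const 0) 1 1
      LM := LM }
  (Counted.loop (fun (S : LoopState V m k n) (i : Fin n) =>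
      (baseCase ops (fun f => f i (0, 0)) S.res ord S.LM).bind fun E =>
      (elemMul ops E S.mat).bind fun mat =>
      (elemMul ops E S.res).bind fun res =>
      .ret { rows := E.rows, mat := mat, res := res, LM := E.LM })
    start (List.finRange n)).bind fun S =>
  .ret { rows := S.rows, mat := S.mat, LM := S.LM }

/-- The product of two matrices of bivariate polynomials modulo `X^a, Y^b`, by the routine `M`. -/
def matMul (M : MulRoutine K) {k l c a b : ℕ} (P : Fin k → Fin l → BPoly V a b)
    (Q : Fin l → Fin c → BPoly V a b) : Counted (Fin k → Fin c → BPoly V a b) :=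
  ((M k l c a b).run ops
      (Sum.elim (fun x => P x.1 x.2.1 x.2.2) (fun x => Q x.1 x.2.1 x.2.2))).bind fun r =>
    .ret fun i j st => r (i, j, st.1, st.2)

/-- Algorithm `Padé` in two variables, for parameters `d, e ≥ 1`, a matrix `G` (whose entries are
only needed modulo `X^d, Y^e`), a monomial order on `K[X,Y]^m`, and a list `LM` of monomials; the
products of polynomial matrices are computed by the routine `M`. -/
noncomputable def pade (M : MulRoutine K) {m n : ℕ} (ord : ModMonOrder m) (d e k : ℕ)
    (G : Fin k → Fin n → BPoly V d e) (LM : Fin k → Mon m) :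
    Counted (PadeOutput V m k (d + 1) (e + 1)) :=
  let z : V := ops.const 0
  if _h : 1 < e then
    (pade M ord d (e / 2) k (fun i j => (G i j).trunc z d (e / 2)) LM).bind fun O₁ =>
    (matMul ops M (fun i j => (O₁.mat i j).trunc z d e) G).bind fun H =>
    (pade M ord d (e - e / 2) O₁.rows
      (fun i j => (H i j).divXY z 0 (e / 2) d (e - e / 2)) O₁.LM).bind fun O₂ =>
    (matMul ops M (fun i j => (O₂.mat i j).trunc z (d + 1) (e + 1))
      (fun i j => (O₁.mat i j).trunc z (d + 1) (e + 1))).bind fun Γ =>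
    .ret { rows := O₂.rows, mat := Γ, LM := O₂.LM }
  else if _h' : 1 < d then
    (pade M ord (d / 2) e k (fun i j => (G i j).trunc z (d / 2) e) LM).bind fun O₁ =>
    (matMul ops M (fun i j => (O₁.mat i j).trunc z d e) G).bind fun H =>
    (pade M ord (d - d / 2) e O₁.rows
      (fun i j => (H i j).divXY z (d / 2) 0 (d - d / 2) e) O₁.LM).bind fun O₂ =>
    (matMul ops M (fun i j => (O₂.mat i j).trunc z (d + 1) (e + 1))
      (fun i j => (O₁.mat i j).trunc z (d + 1) (e + 1))).bind fun Γ =>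
    .ret { rows := O₂.rows, mat := Γ, LM := O₂.LM }
  else
    (padeOne ops G ord LM).bind fun O =>
    .ret { rows := O.rows, mat := fun i j => (O.mat i j).trunc z (d + 1) (e + 1), LM := O.LM }
termination_by d + e
decreasing_by all_goals omega

end Algorithms

section RunPade

variable {K : Type*} [Field K] {m n : ℕ}

/-- Algorithm `Padé` run over `K` on the coefficients of the matrix `F` and on the list
`(e_1, …, e_m)`, with every operation in `K` counted. -/
noncomputable def runPade (M : MulRoutine K) (ord : ModMonOrder m) (d e : ℕ)
    (F : Matrix (Fin m) (Fin n) (BiRing K)) : Counted (PadeOutput K m m (d + 1) (e + 1)) :=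
  pade (FieldOps.counted K) M ord d e m (fun i j => BPoly.ofPoly d e (F i j))
    (fun i => ((0 : Fin 2 →₀ ℕ), i))

/-- The matrix of polynomials in an output of the algorithm. -/
noncomputable def PadeOutput.toMatrix {k a b : ℕ} (O : PadeOutput K m k a b) :
    Matrix (Fin O.rows) (Fin k) (BiRing K) :=
  Matrix.of fun i j => (O.mat i j).toPoly

end RunPade

/-- The quantity `C f log(2 + f)^c`; a quantity is in `Õ(f)` when it is bounded by this for some
constants `C` and `c`. -/
noncomputable def softO (C : ℝ) (c : ℕ) (f : ℝ) : ℝ := C * f * Real.log (2 + f) ^ c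

/-- The quantity `(ρ^{ω-1} + ρ n) (ρ + n) d e` with `ρ = m min(d, e)`. -/
noncomputable def padeBound (ω : ℝ) (m n d e : ℕ) : ℝ :=
  let ρ : ℝ := (m : ℝ) * (min d e : ℕ)
  (ρ ^ (ω - 1) + ρ * n) * (ρ + n) * d * e

/-! ## Monomial orders are well-founded -/

namespace Mon

variable {m : ℕ}

/-! Correctness rests on one local step, `Good.elementary`. Let `P` be a minimal Gröbner basis of
`M` and let `φ` be a linear functional whose kernel on `M` is again a submodule. Among the rows on
which `φ` does not vanish, take as pivot the one with the smallest leading monomial. Adding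
multiples of the pivot to the other rows kills `φ` and leaves their leading monomials alone. The
pivot itself must be multiplied by variables: an element of the kernel cannot have the pivot's
leading monomial, since its remainder would reduce by smaller rows only, all of them in the kernel.
The Padé module is reached by imposing the vanishing of one coefficient of one entry at a time.

The algorithm never sees `P F`, only a truncated residual `G` with `P F = X^s Y^t G` modulo
`⟨X^(s+d), Y^(t+e)⟩` (`Cong`). This relation determines the functionals and passes to both recursive
calls (`cong_second`). Transformation matrices are truncated as well. By `Good.truncate` this is
harmless: the deleted terms multiply `P` into the target module, and the leading terms survive
because X^d and Y^e times each row lie in that module. Leading monomials multiply along products of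
transformations because each row has a single term of greatest weight (`Lead.vecMul`), so nothing
cancels at the top.

For the cost, every intermediate module contains the final syzygy module. In each component the
leading monomials therefore form an antichain with X-exponents at most `d` and Y-exponents at most
`e`, which gives at most m(min(d,e)+1) rows (`Good.rows_le`). The recursion has logarithmic depth,
and the areas of the two subproblems add up to `d e`, so each level costs a fixed amount per unit of
area.

Fast products are needed over an arbitrary field, possibly one without roots of unity. Bivariate
products become cyclic convolutions by Kronecker substitution. These are computed in the manner of
Schönhage and Strassen with the group algebra of ℤ/h as coefficient ring, for `h` a power of 2, or
of 3 in characteristic 2 (`FastConv.step`, `fastConv_pow`). The algorithm obtained is bilinear, so a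
product of polynomial matrices reduces to quasi-linearly many products of scalar matrices. That `ω ≥
2` is derived, not assumed: a program for N × N matrix multiplication needs at least N²
instructions. -/

theorem Dvd.refl (μ : Mon m) : μ.Dvd μ := ⟨0, (mul_zero μ).symm⟩

theorem Dvd.trans {μ₁ μ₂ μ₃ : Mon m} (h : μ₁.Dvd μ₂) (h' : μ₂.Dvd μ₃) : μ₁.Dvd μ₃ := by
  obtain ⟨a, rfl⟩ := h
  obtain ⟨b, rfl⟩ := h'
  exact ⟨b + a, (mul_mul b a μ₁).symm⟩

theorem dvd_iff {μ₁ μ₂ : Mon m} : μ₁.Dvd μ₂ ↔ μ₁.1 ≤ μ₂.1 ∧ μ₁.2 = μ₂.2 := by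
  constructor
  · rintro ⟨a, rfl⟩
    exact ⟨le_add_self, rfl⟩
  · rintro ⟨h, h'⟩
    exact ⟨μ₂.1 - μ₁.1, Prod.ext (tsub_add_cancel_of_le h).symm h'.symm⟩

theorem mul_left_injective {a b : Fin 2 →₀ ℕ} {μ : Mon m} (h : mul a μ = mul b μ) : a = b := by
  simpa [mul] using h

end Mon

namespace ModMonOrder

variable {m : ℕ} (ord : ModMonOrder m)

/-- The strict order of a monomial order. -/
def lt (μ₁ μ₂ : Mon m) : Prop := ord.le μ₁ μ₂ ∧ μ₁ ≠ μ₂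

variable {ord} {μ₁ μ₂ μ₃ : Mon m}

theorem le_of_eq (h : μ₁ = μ₂) : ord.le μ₁ μ₂ := h ▸ ord.refl μ₁

theorem lt_of_le_of_lt (h : ord.le μ₁ μ₂) (h' : ord.lt μ₂ μ₃) : ord.lt μ₁ μ₃ :=
  ⟨ord.trans _ _ _ h h'.1, fun e => h'.2 (ord.antisymm _ _ h'.1 (e ▸ h))⟩

theorem lt_of_lt_of_le (h : ord.lt μ₁ μ₂) (h' : ord.le μ₂ μ₃) : ord.lt μ₁ μ₃ :=
  ⟨ord.trans _ _ _ h.1 h', fun e => h.2 (ord.antisymm _ _ h.1 (e ▸ h'))⟩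

theorem lt_irrefl (h : ord.lt μ₁ μ₁) : False := h.2 rfl

theorem lt_of_not_le (h : ¬ ord.le μ₁ μ₂) : ord.lt μ₂ μ₁ :=
  ⟨(ord.total μ₁ μ₂).resolve_left h, fun e => h (le_of_eq e.symm)⟩

theorem mul_le_mul (a : Fin 2 →₀ ℕ) (h : ord.le μ₁ μ₂) : ord.le (Mon.mul a μ₁) (Mon.mul a μ₂) :=
  (ord.mul a _ _ h).2

theorem mul_lt_mul (a : Fin 2 →₀ ℕ) (h : ord.lt μ₁ μ₂) : ord.lt (Mon.mul a μ₁) (Mon.mul a μ₂) :=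
  ⟨mul_le_mul a h.1, fun e => h.2 (Mon.mul_injective a e)⟩

theorem le_of_dvd (h : μ₁.Dvd μ₂) : ord.le μ₁ μ₂ := by
  obtain ⟨a, rfl⟩ := h
  exact (ord.mul a _ _ (ord.refl _)).1

variable (ord)

/-- Dickson's lemma: in any sequence of monomials an earlier one divides a later one, and
divisibility implies `ord.le`, so no sequence descends forever. -/
theorem wellFounded_lt : WellFounded ord.lt := by
  rw [wellFounded_iff_isEmpty_descending_chain]
  constructor
  rintro ⟨f, hf⟩
  have hlt : ∀ i j, i < j → ord.lt (f j) (f i) := by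
    intro i j hij
    induction j, hij using Nat.le_induction with
    | base => exact hf i
    | succ j _ ih => exact lt_of_le_of_lt (hf j).1 ih
  have h1 : WellQuasiOrdered (α := Fin 2 →₀ ℕ) (· ≤ ·) := wellQuasiOrdered_le
  have h2 : WellQuasiOrdered (α := Fin m) (· = ·) := Finite.wellQuasiOrdered _
  obtain ⟨i, j, hij, h⟩ := h1.prod h2 f
  exact lt_irrefl (lt_of_lt_of_le (hlt i j hij) (le_of_dvd (Mon.dvd_iff.2 h)))

theorem exists_max (s : Finset (Mon m)) (hs : s.Nonempty) :
    ∃ μ ∈ s, ∀ μ' ∈ s, ord.le μ' μ := by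
  classical
  induction hs using Finset.Nonempty.cons_induction with
  | singleton a => exact ⟨a, by simp, by simp [ord.refl]⟩
  | cons a s ha hs ih =>
    obtain ⟨μ, hμ, h⟩ := ih
    rcases ord.total a μ with h' | h'
    · exact ⟨μ, by simp [hμ], by simpa [h'] using fun c d hcd => h (c, d) hcd⟩
    · refine ⟨a, by simp, ?_⟩
      intro μ' hμ'
      rcases Finset.mem_cons.1 hμ' with rfl | h''
      · exact ord.refl _
      · exact ord.trans _ _ _ (h _ h'') h'

theorem exists_min {ι : Type*} (f : ι → Mon m) (p : ι → Prop) (hp : ∃ i, p i) :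
    ∃ i, p i ∧ ∀ j, p j → ord.le (f i) (f j) := by
  obtain ⟨i₀, hi₀⟩ := hp
  obtain ⟨μ, ⟨i, hi, rfl⟩, h⟩ :=
    ord.wellFounded_lt.has_min {μ | ∃ i, p i ∧ f i = μ} ⟨_, i₀, hi₀, rfl⟩
  refine ⟨i, hi, fun j hj => ?_⟩
  by_contra hle
  exact h _ ⟨j, hj, rfl⟩ (lt_of_not_le hle)

end ModMonOrder

/-! ## Leading monomials with respect to a list of monomials -/

section Lead

variable {K : Type*} [Field K] {m k l : ℕ} {ord : ModMonOrder m}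

/-- Give the unit vector `e_j` the weight `LM j`. Then `q` has exactly one term of weight `μ`, and
all its other terms have smaller weights. -/
def Lead (ord : ModMonOrder m) (LM : Fin k → Mon m) (q : Fin k → BiRing K) (μ : Mon m) : Prop :=
  ∃ x : Mon k, (q x.2).coeff x.1 ≠ 0 ∧ Mon.mul x.1 (LM x.2) = μ ∧
    ∀ y : Mon k, y ≠ x → (q y.2).coeff y.1 ≠ 0 → ord.lt (Mon.mul y.1 (LM y.2)) μ

/-- The monomials `e_1, …, e_m`. -/
def unitMon (m : ℕ) : Fin m → Mon m := fun i => (0, i)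

theorem mul_unitMon (x : Mon m) : Mon.mul x.1 (unitMon m x.2) = x := by simp [Mon.mul, unitMon]

theorem lead_unitMon {q : Fin m → BiRing K} {μ : Mon m} :
    Lead ord (unitMon m) q μ ↔ IsLeading ord q μ := by
  simp only [Lead, IsLeading, mul_unitMon]
  constructor
  · rintro ⟨x, hx, rfl, h⟩
    refine ⟨hx, fun y hy => ?_⟩
    by_cases hyx : y = x
    · exact ModMonOrder.le_of_eq hyx
    · exact (h y hyx hy).1
  · rintro ⟨hx, h⟩
    exact ⟨μ, hx, rfl, fun y hyx hy => ⟨h y hy, hyx⟩⟩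

theorem coeff_vecMul (q : Fin k → BiRing K) (P : Matrix (Fin k) (Fin l) (BiRing K)) (i : Fin l)
    (ν : Fin 2 →₀ ℕ) : ((Matrix.vecMul q P) i).coeff ν =
      ∑ jab : (Fin k) × (Finset.HasAntidiagonal.antidiagonal ν), 
        (q jab.1).coeff jab.2.1.1 * (P jab.1 i).coeff jab.2.1.2 := by
  rw [Fintype.sum_prod_type]
  simp only [Matrix.vecMul, dotProduct, MvPolynomial.coeff_sum, MvPolynomial.coeff_mul]
  refine Finset.sum_congr rfl fun j _ => ?_
  rw [← Finset.sum_coe_sort]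

/-- Nothing cancels at the top: the heaviest weight in the product is attained only by the heaviest
term of `q` times the heaviest term of the corresponding row of `P`. Having a unique heaviest term
makes tie-breaking rules irrelevant when transformations are composed. -/
theorem Lead.vecMul {L₀ : Fin l → Mon m} {L : Fin k → Mon m}
    {P : Matrix (Fin k) (Fin l) (BiRing K)} {q : Fin k → BiRing K} {μ : Mon m}
    (hq : Lead ord L q μ) (hP : ∀ j, Lead ord L₀ (P j) (L j)) :
    Lead ord L₀ (Matrix.vecMul q P) μ := by
  obtain ⟨x, hx0, hxμ, hx⟩ := hq
  obtain ⟨y, hy0, hyμ, hy⟩ := hP x.2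
  have key : ∀ (j : Fin k) (i : Fin l) (a b : Fin 2 →₀ ℕ), (q j).coeff a ≠ 0 →
      (P j i).coeff b ≠ 0 → ((a, j) = x ∧ (b, i) = y) ∨ ord.lt (Mon.mul (a + b) (L₀ i)) μ := by
    intro j i a b ha hb
    rw [Mon.mul_mul]
    by_cases hax : (a, j) = x
    · subst hax
      by_cases hby : (b, i) = y
      · exact Or.inl ⟨rfl, hby⟩
      · refine Or.inr ?_
        rw [← hxμ]
        exact ModMonOrder.mul_lt_mul a (hy (b, i) hby hb)
    · refine Or.inr ?_
      obtain ⟨y', -, hy'μ, hy'⟩ := hP j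
      have hle : ord.le (Mon.mul b (L₀ i)) (L j) := by
        by_cases hby : (b, i) = y'
        · rw [← hy'μ, ← hby]; exact ord.refl _
        · exact (hy' (b, i) hby hb).1
      exact ModMonOrder.lt_of_le_of_lt (ModMonOrder.mul_le_mul a hle) (hx (a, j) hax ha)
  refine ⟨(x.1 + y.1, y.2), ?_, ?_, ?_⟩
  · rw [coeff_vecMul, Fintype.sum_eq_single (x.2, ⟨(x.1, y.1), by simp⟩)]
    · exact mul_ne_zero hx0 hy0
    · rintro ⟨j, ⟨⟨a, b⟩, hab⟩⟩ hne
      by_contra h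
      have h1 := left_ne_zero_of_mul h
      have h2 := right_ne_zero_of_mul h
      rcases key _ _ _ _ h1 h2 with ⟨hx', hy'⟩ | h3
      · apply hne
        simp only [Prod.ext_iff] at hx' hy' ⊢
        exact ⟨hx'.2, by simpa using ⟨hx'.1, hy'.1⟩⟩
      · rw [Finset.HasAntidiagonal.mem_antidiagonal] at hab
        simp only at hab h3
        rw [hab, Mon.mul_mul, hyμ, hxμ] at h3
        exact ModMonOrder.lt_irrefl h3
  · simp only [Mon.mul_mul, hyμ, hxμ]
  · rintro ⟨ν, i⟩ hne h
    rw [coeff_vecMul] at h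
    obtain ⟨⟨j, ⟨⟨a, b⟩, hab⟩⟩, -, hne'⟩ := Finset.exists_ne_zero_of_sum_ne_zero h
    rw [Finset.HasAntidiagonal.mem_antidiagonal] at hab
    simp only at hab
    rcases key _ _ _ _ (left_ne_zero_of_mul hne') (right_ne_zero_of_mul hne') with ⟨hx', hy'⟩ | h3
    · refine absurd ?_ hne
      rw [← hx', ← hy']
      exact Prod.ext hab.symm rfl
    · rw [hab] at h3
      exact h3

theorem IsLeading.unique {p : Fin m → BiRing K} {μ μ' : Mon m} (h : IsLeading ord p μ)
    (h' : IsLeading ord p μ') : μ = μ' :=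
  ord.antisymm _ _ (h'.2 _ h.1) (h.2 _ h'.1)

theorem exists_isLeading (ord : ModMonOrder m) {p : Fin m → BiRing K} (hp : p ≠ 0) :
    ∃ μ, IsLeading ord p μ := by
  classical
  let s : Finset (Mon m) := Finset.univ.biUnion fun i => (p i).support.image fun a => (a, i)
  have hs : ∀ μ : Mon m, μ ∈ s ↔ (p μ.2).coeff μ.1 ≠ 0 := by
    rintro ⟨a, i⟩
    simp [s]
  obtain ⟨i, hi⟩ := Function.ne_iff.1 hp
  obtain ⟨a, ha⟩ := MvPolynomial.ne_zero_iff.1 hi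
  obtain ⟨μ, hμ, h⟩ := ord.exists_max s ⟨(a, i), (hs _).2 ha⟩
  exact ⟨μ, (hs μ).1 hμ, fun μ' hμ' => h μ' ((hs μ').2 hμ')⟩

end Lead

/-! ## Minimal Gröbner bases with given leading monomials -/

section Good

variable {K : Type*} [Field K] {m k : ℕ} {ord : ModMonOrder m}

/-- The rows of `P` form a minimal Gröbner basis of `M`, with leading monomials `LM`. -/
structure Good (ord : ModMonOrder m) (M : Submodule (BiRing K) (Fin m → BiRing K))
    (P : Matrix (Fin k) (Fin m) (BiRing K)) (LM : Fin k → Mon m) : Prop where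
  mem : ∀ i, P i ∈ M
  lead : ∀ i, Lead ord (unitMon m) (P i) (LM i)
  anti : ∀ i j, j ≠ i → ¬ (LM j).Dvd (LM i)
  dvd : ∀ p ∈ M, ∀ μ, IsLeading ord p μ → ∃ i, (LM i).Dvd μ

variable {M : Submodule (BiRing K) (Fin m → BiRing K)} {P : Matrix (Fin k) (Fin m) (BiRing K)}
  {LM : Fin k → Mon m}

theorem Good.injective (h : Good ord M P LM) : Function.Injective LM := fun i j hij => by
  by_contra hne
  exact h.anti i j (Ne.symm hne) (hij ▸ Mon.Dvd.refl _)

theorem isLeading_monomial_smul {p : Fin m → BiRing K} {μ : Mon m} (h : IsLeading ord p μ)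
    (a : Fin 2 →₀ ℕ) {c : K} (hc : c ≠ 0) :
    IsLeading ord (MvPolynomial.monomial a c • p) (Mon.mul a μ) := by
  refine ⟨?_, ?_⟩
  · simpa [Mon.mul] using ⟨hc, h.1⟩
  · intro μ' hμ'
    simp only [Pi.smul_apply, smul_eq_mul, MvPolynomial.coeff_monomial_mul'] at hμ'
    split_ifs at hμ' with hle
    · have := ModMonOrder.mul_le_mul a (h.2 (μ'.1 - a, μ'.2) (right_ne_zero_of_mul hμ'))
      simpa [Mon.mul, add_tsub_cancel_of_le hle] using this
    · exact absurd rfl hμ'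

theorem isLeading_sub {p q : Fin m → BiRing K} {μ : Mon m} (hp : IsLeading ord p μ)
    (hq : IsLeading ord q μ) (hpq : (p μ.2).coeff μ.1 = (q μ.2).coeff μ.1) :
    ∀ μ', IsLeading ord (p - q) μ' → ord.lt μ' μ := by
  intro μ' h
  have h1 : ((p μ'.2).coeff μ'.1) - ((q μ'.2).coeff μ'.1) ≠ 0 := by simpa using h.1
  refine ⟨?_, ?_⟩
  · by_cases h2 : (p μ'.2).coeff μ'.1 = 0
    · refine hq.2 _ fun h3 => h1 (by rw [h2, h3, sub_zero])
    · exact hp.2 _ h2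
  · rintro rfl
    exact h1 (sub_eq_zero.2 hpq)

/-- The division algorithm, by well-founded induction on the leading monomial. Only rows with
leading monomial at most `μ` are used, which is what allows rows at or above a pivot to be ignored
in `Good.elementary`. -/
theorem Good.mem_of_isLeading (h : Good ord M P LM) (S : Submodule (BiRing K) (Fin m → BiRing K))
    (μ : Mon m) : ∀ p ∈ M, IsLeading ord p μ → (∀ i, ord.le (LM i) μ → P i ∈ S) → p ∈ S := by
  induction μ using ord.wellFounded_lt.induction with
  | _ μ ih =>
    intro p hp hμ hS
    obtain ⟨i, a, ha⟩ := h.dvd p hp μ hμ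
    have hi := lead_unitMon.1 (h.lead i)
    -- The scalar for which `c` times the monomial multiple of `P i` cancels the leading term of
    -- `p`.
    set c := (p μ.2).coeff μ.1 / ((P i) (LM i).2).coeff (LM i).1 with hc
    have hc0 : c ≠ 0 := div_ne_zero hμ.1 hi.1
    have hq := isLeading_monomial_smul hi a hc0
    rw [← ha] at hq
    set q := MvPolynomial.monomial a c • P i with hqdef
    have hqS : q ∈ S := S.smul_mem _ (hS i (ModMonOrder.le_of_dvd ⟨a, ha⟩))
    have hqM : q ∈ M := M.smul_mem _ (h.mem i)
    have hcoeff : (p μ.2).coeff μ.1 = (q μ.2).coeff μ.1 := by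
      rw [hqdef, ha]
      simp only [Mon.mul, Pi.smul_apply, smul_eq_mul, MvPolynomial.coeff_monomial_mul]
      rw [hc, div_mul_cancel₀ _ hi.1, ha]
      rfl
    have hlt := isLeading_sub hμ hq hcoeff
    have : p - q ∈ S := by
      by_cases h0 : p - q = 0
      · rw [h0]; exact S.zero_mem
      · obtain ⟨μ', hμ'⟩ := exists_isLeading ord h0
        exact ih μ' (hlt μ' hμ') _ (M.sub_mem hp hqM) hμ'
          fun j hj => hS j (ord.trans _ _ _ hj (hlt μ' hμ').1)
    simpa using S.add_mem this hqS

theorem Good.le_of_mem (h : Good ord M P LM) (S : Submodule (BiRing K) (Fin m → BiRing K))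
    (hS : ∀ i, P i ∈ S) : M ≤ S := by
  intro p hp
  by_cases h0 : p = 0
  · rw [h0]; exact S.zero_mem
  · obtain ⟨μ, hμ⟩ := exists_isLeading ord h0
    exact h.mem_of_isLeading S μ p hp hμ fun i _ => hS i

theorem lm_eq {p : Fin m → BiRing K} {μ : Mon m} (h : IsLeading ord p μ) :
    lm ord p = monVec K μ := by
  have hex : ∃ μ, IsLeading ord p μ := ⟨μ, h⟩
  rw [lm, dif_pos hex, IsLeading.unique hex.choose_spec h]

theorem lm_zero : lm ord (0 : Fin m → BiRing K) = 0 := by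
  rw [lm, dif_neg]
  rintro ⟨μ, h⟩
  simpa using h.1

theorem monVec_mul (a : Fin 2 →₀ ℕ) (μ : Mon m) :
    monVec K (Mon.mul a μ) = MvPolynomial.monomial a (1 : K) • monVec K μ := by
  ext1 j
  by_cases h : j = μ.2
  · subst h
    simp [monVec, Mon.mul, MvPolynomial.monomial_mul]
  · simp [monVec, Mon.mul, Pi.single_eq_of_ne h]

theorem dvd_of_monVec_eq_smul {μ μ' : Mon m} {q : BiRing K} (h : monVec K μ = q • monVec K μ') :
    μ'.Dvd μ := by
  have h1 := congrFun h μ.2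
  rw [Mon.dvd_iff]
  by_cases h2 : μ.2 = μ'.2
  · refine ⟨?_, h2.symm⟩
    simp only [monVec, Pi.single_eq_same, Pi.smul_apply, smul_eq_mul, h2] at h1
    have h3 := congrArg (MvPolynomial.coeff μ.1) h1
    rw [MvPolynomial.coeff_mul_monomial'] at h3
    by_contra h4
    rw [if_neg h4] at h3
    simp at h3
  · simp [monVec, Pi.single_eq_of_ne h2] at h1

theorem Good.isMinimalGroebnerBasis (h : Good ord M P LM) : IsMinimalGroebnerBasis ord M P := by
  have hlead := fun i => lead_unitMon.1 (h.lead i)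
  refine ⟨⟨h.mem, le_antisymm ?_ ?_⟩, ?_⟩
  · rw [Submodule.span_le]
    rintro _ ⟨p, hp, rfl⟩
    by_cases h0 : p = 0
    · rw [h0, lm_zero]; exact Submodule.zero_mem _
    · obtain ⟨μ, hμ⟩ := exists_isLeading ord h0
      obtain ⟨i, a, rfl⟩ := h.dvd p hp μ hμ
      rw [lm_eq hμ, monVec_mul, ← lm_eq (hlead i)]
      exact Submodule.smul_mem _ _ (Submodule.subset_span ⟨i, rfl⟩)
  · refine Submodule.span_mono ?_
    rintro _ ⟨i, rfl⟩
    exact ⟨P i, h.mem i, rfl⟩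
  · rintro i j hij ⟨q, hq⟩
    rw [lm_eq (hlead i), lm_eq (hlead j)] at hq
    exact h.anti i j hij (dvd_of_monVec_eq_smul hq)

end Good

/-! ## Truncated polynomials -/

section Truncation

variable {K : Type*} [Field K]

/-- The exponent vector of `X^i Y^j`. -/
noncomputable def expXY (i j : ℕ) : Fin 2 →₀ ℕ := Finsupp.single 0 i + Finsupp.single 1 j

@[simp] theorem expXY_zero_left (i j : ℕ) : expXY i j 0 = i := by simp [expXY]

@[simp] theorem expXY_one (i j : ℕ) : expXY i j 1 = j := by simp [expXY]

theorem expXY_apply (ν : Fin 2 →₀ ℕ) : expXY (ν 0) (ν 1) = ν := by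
  ext i
  fin_cases i <;> simp

theorem le_iff_fin_two {ν ν' : Fin 2 →₀ ℕ} : ν ≤ ν' ↔ ν 0 ≤ ν' 0 ∧ ν 1 ≤ ν' 1 := by
  rw [Finsupp.le_def, Fin.forall_fin_two]

theorem mem_padeIdeal {d e : ℕ} {f : BiRing K} :
    f ∈ padeIdeal K d e ↔ ∀ ν : Fin 2 →₀ ℕ, ν 0 < d → ν 1 < e → f.coeff ν = 0 := by
  have h : ({MvPolynomial.X 0 ^ d, MvPolynomial.X 1 ^ e} : Set (BiRing K)) =
      (fun s => MvPolynomial.monomial s (1 : K)) '' {Finsupp.single 0 d, Finsupp.single 1 e} := by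
    rw [Set.image_pair, MvPolynomial.X_pow_eq_monomial, MvPolynomial.X_pow_eq_monomial]
  rw [padeIdeal, h, MvPolynomial.mem_ideal_span_monomial_image]
  refine forall_congr' fun ν => ?_
  rw [MvPolynomial.mem_support_iff]
  simp only [Set.mem_insert_iff, Set.mem_singleton_iff, exists_eq_or_imp, exists_eq_left,
    le_iff_fin_two]
  simp
  constructor
  · intro h h0 h1
    by_contra h2
    have := h h2
    omega
  · intro h h2
    by_contra h3
    exact h2 (h (by omega) (by omega))

theorem padeIdeal_mono {d e d' e' : ℕ} (hd : d ≤ d') (he : e ≤ e') :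
    padeIdeal K d' e' ≤ padeIdeal K d e := fun f hf =>
  mem_padeIdeal.2 fun ν h0 h1 => mem_padeIdeal.1 hf ν (by omega) (by omega)

theorem monomial_mul_mem_padeIdeal {s t d e : ℕ} {f : BiRing K} :
    MvPolynomial.monomial (expXY s t) 1 * f ∈ padeIdeal K (s + d) (t + e) ↔
      f ∈ padeIdeal K d e := by
  simp only [mem_padeIdeal]
  constructor
  · intro h ν h0 h1
    have := h (expXY s t + ν) (by simpa using h0) (by simpa using h1)
    rwa [MvPolynomial.coeff_monomial_mul, one_mul] at this
  · intro h ν h0 h1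
    rw [MvPolynomial.coeff_monomial_mul', one_mul]
    split_ifs with hle
    · rw [le_iff_fin_two] at hle
      simp only [expXY_zero_left, expXY_one] at hle
      exact h _ (by simp; omega) (by simp; omega)
    · rfl

theorem mem_syzModule {m n d e : ℕ} {F : Matrix (Fin m) (Fin n) (BiRing K)}
    {p : Fin m → BiRing K} : p ∈ syzModule (padeModule K n d e) F ↔
      ∀ c, Matrix.vecMul p F c ∈ padeIdeal K d e := by
  simp [syzModule, padeModule]

namespace BPoly

variable {a b : ℕ}

theorem toPoly_eq_sum_monomial (p : BPoly K a b) :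
    p.toPoly = ∑ ij : Fin a × Fin b, MvPolynomial.monomial (expXY ij.1 ij.2) (p ij) := by
  refine Finset.sum_congr rfl fun ij _ => ?_
  rw [MvPolynomial.X_pow_eq_monomial, MvPolynomial.X_pow_eq_monomial, MvPolynomial.C_mul_monomial,
    MvPolynomial.monomial_mul, mul_one, mul_one]
  rfl

theorem coeff_toPoly (p : BPoly K a b) (ν : Fin 2 →₀ ℕ) :
    p.toPoly.coeff ν = p.coeffD 0 (ν 0) (ν 1) := by
  classical
  have h' : ∀ ij : Fin a × Fin b, expXY ij.1 ij.2 = ν ↔ (ij.1 : ℕ) = ν 0 ∧ (ij.2 : ℕ) = ν 1 := by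
    intro ij
    constructor
    · rintro rfl; simp
    · rintro ⟨h1, h2⟩; rw [h1, h2, expXY_apply]
  simp only [toPoly_eq_sum_monomial, MvPolynomial.coeff_sum, MvPolynomial.coeff_monomial, h',
    coeffD]
  split_ifs with hab
  · rw [Finset.sum_eq_single (⟨ν 0, hab.1⟩, ⟨ν 1, hab.2⟩)]
    · simp
    · rintro ⟨i, j⟩ - hne
      rw [if_neg]
      rintro ⟨h1, h2⟩
      exact hne (Prod.ext (Fin.ext h1) (Fin.ext h2))
    · simp
  · refine Finset.sum_eq_zero fun ij _ => if_neg ?_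
    rintro ⟨h1, h2⟩
    exact hab ⟨h1 ▸ ij.1.2, h2 ▸ ij.2.2⟩

theorem coeffD_of_lt {V : Type*} (z : V) (p : BPoly V a b) {i j : ℕ} (hi : i < a) (hj : j < b) :
    p.coeffD z i j = p (⟨i, hi⟩, ⟨j, hj⟩) := dif_pos ⟨hi, hj⟩

theorem coeffD_of_not {V : Type*} (z : V) (p : BPoly V a b) {i j : ℕ} (h : ¬ (i < a ∧ j < b)) :
    p.coeffD z i j = z := dif_neg h

theorem coeffD_trunc {V : Type*} (z : V) (p : BPoly V a b) (a' b' i j : ℕ) :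
    (p.trunc z a' b').coeffD z i j = if i < a' ∧ j < b' then p.coeffD z i j else z := by
  split_ifs with h
  · rw [coeffD_of_lt _ _ h.1 h.2]; rfl
  · rw [coeffD_of_not _ _ h]

theorem coeffD_ofPoly (f : BiRing K) (a b i j : ℕ) :
    (ofPoly a b f).coeffD 0 i j = if i < a ∧ j < b then f.coeff (expXY i j) else 0 := by
  split_ifs with h
  · rw [coeffD_of_lt _ _ h.1 h.2]; rfl
  · rw [coeffD_of_not _ _ h]

theorem coeffD_divXY {V : Type*} (z : V) (p : BPoly V a b) (s t a' b' i j : ℕ) :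
    (p.divXY z s t a' b').coeffD z i j =
      if i < a' ∧ j < b' then p.coeffD z (i + s) (j + t) else z := by
  split_ifs with h
  · rw [coeffD_of_lt _ _ h.1 h.2]; rfl
  · rw [coeffD_of_not _ _ h]

theorem coeff_toPoly_trunc (p : BPoly K a b) (a' b' : ℕ) (ν : Fin 2 →₀ ℕ) :
    (p.trunc 0 a' b').toPoly.coeff ν = if ν 0 < a' ∧ ν 1 < b' then p.toPoly.coeff ν else 0 := by
  rw [coeff_toPoly, coeffD_trunc, coeff_toPoly]

theorem coeff_toPoly_ofPoly (f : BiRing K) (ν : Fin 2 →₀ ℕ) :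
    (ofPoly a b f).toPoly.coeff ν = if ν 0 < a ∧ ν 1 < b then f.coeff ν else 0 := by
  rw [coeff_toPoly, coeffD_ofPoly, expXY_apply]

theorem toPoly_trunc_sub_mem (p : BPoly K a b) (a' b' : ℕ) :
    (p.trunc 0 a' b').toPoly - p.toPoly ∈ padeIdeal K a' b' :=
  mem_padeIdeal.2 fun ν h0 h1 => by
    rw [MvPolynomial.coeff_sub, coeff_toPoly_trunc, if_pos ⟨h0, h1⟩, sub_self]

theorem toPoly_ofPoly_sub_mem (f : BiRing K) (a b : ℕ) :
    (ofPoly a b f).toPoly - f ∈ padeIdeal K a b :=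
  mem_padeIdeal.2 fun ν h0 h1 => by
    rw [MvPolynomial.coeff_sub, coeff_toPoly_ofPoly, if_pos ⟨h0, h1⟩, sub_self]

theorem toPoly_eq_of_trunc_le (p : BPoly K a b) {a' b' : ℕ} (ha : a ≤ a') (hb : b ≤ b') :
    (p.trunc 0 a' b').toPoly = p.toPoly := by
  ext ν
  rw [coeff_toPoly_trunc]
  split_ifs with h
  · rfl
  · rw [coeff_toPoly, coeffD_of_not]
    omega

/-- Dividing by X^s Y^t discards the coefficients left of `s` or below `t`. The two hypotheses say
that these vanish inside the box considered, so the division is exact there. -/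
theorem toPoly_sub_divXY_mem (p : BPoly K a b) {s t a' b' : ℕ}
    (h : p.toPoly ∈ padeIdeal K s (t + b')) (h' : p.toPoly ∈ padeIdeal K (s + a') t) :
    p.toPoly - MvPolynomial.monomial (expXY s t) 1 * (p.divXY 0 s t a' b').toPoly ∈
      padeIdeal K (s + a') (t + b') := by
  rw [mem_padeIdeal] at *
  intro ν h0 h1
  rw [MvPolynomial.coeff_sub, MvPolynomial.coeff_monomial_mul', one_mul, coeff_toPoly (divXY _ _ _ _ _ _),
    coeffD_divXY]
  simp only [le_iff_fin_two, Finsupp.coe_tsub, Pi.sub_apply, expXY_zero_left, expXY_one]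
  split_ifs with h2 h3
  · rw [coeff_toPoly, Nat.sub_add_cancel h2.1, Nat.sub_add_cancel h2.2, sub_self]
  · omega
  · rw [sub_zero]
    by_cases h4 : ν 0 < s
    · exact h ν h4 h1
    · exact h' ν h0 (by omega)

end BPoly

end Truncation

/-! ## Passing to a submodule -/

section Steps

variable {K : Type*} [Field K] {m k : ℕ} {ord : ModMonOrder m}
  {M M' : Submodule (BiRing K) (Fin m → BiRing K)} {P : Matrix (Fin k) (Fin m) (BiRing K)}
  {LM : Fin k → Mon m}

theorem mul_row {k' l : ℕ} (Q : Matrix (Fin k') (Fin k) (BiRing K))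
    (P : Matrix (Fin k) (Fin l) (BiRing K)) (i : Fin k') : (Q * P) i = Matrix.vecMul (Q i) P := by
  rw [Matrix.mul_apply_eq_vecMul]

theorem single_vecMul {l : ℕ} (i : Fin k) (P : Matrix (Fin k) (Fin l) (BiRing K)) :
    Matrix.vecMul (Pi.single i 1) P = P i :=
  Matrix.single_one_vecMul _ _

theorem lead_single (LM : Fin k → Mon m) (i : Fin k) :
    Lead ord LM ((Pi.single i 1 : Fin k → BiRing K)) (LM i) := by
  classical
  refine ⟨(0, i), by simp, Mon.mul_zero _, ?_⟩
  rintro ⟨ν, j⟩ hne h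
  exfalso
  by_cases hj : j = i
  · subst hj
    simp [MvPolynomial.coeff_one] at h
    exact hne (by rw [h])
  · simp [Pi.single_eq_of_ne hj] at h

theorem lead_single_add (LM : Fin k → Mon m) {i π : Fin k} (hi : i ≠ π) {c : K}
    (hc : c ≠ 0 → ord.lt (LM π) (LM i)) :
    Lead ord LM (Pi.single i 1 + (MvPolynomial.C c : BiRing K) • (Pi.single π 1 : Fin k → BiRing K)) (LM i) := by
  classical
  refine ⟨(0, i), by simp [hi], Mon.mul_zero _, ?_⟩
  rintro ⟨ν, j⟩ hne h
  by_cases hj : j = i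
  · subst hj
    simp [hi, MvPolynomial.coeff_one] at h
    exact absurd (by rw [h]) hne
  · by_cases hj' : j = π
    · subst hj'
      simp [hj, MvPolynomial.coeff_C] at h
      rw [← h.1]
      simpa [Mon.mul_zero] using hc h.2
    · simp [hj, hj'] at h

theorem lead_linear_single (LM : Fin k → Mon m) (j : Fin 2) (π : Fin k) (α : K) :
    Lead ord LM ((MvPolynomial.X j - MvPolynomial.C α) • (Pi.single π 1 : Fin k → BiRing K))
      (Mon.mul (Finsupp.single j 1) (LM π)) := by
  classical
  refine ⟨(Finsupp.single j 1, π), ?_, rfl, ?_⟩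
  · have h0 : (0 : Fin 2 →₀ ℕ) ≠ Finsupp.single j 1 := by
      intro h; simpa using DFunLike.congr_fun h j
    simp [MvPolynomial.coeff_C, h0]
  · rintro ⟨ν, i⟩ hne h
    by_cases hi : i = π
    · subst hi
      simp only [Pi.smul_apply, Pi.single_eq_same, smul_eq_mul, mul_one, MvPolynomial.coeff_sub,
        MvPolynomial.coeff_X, MvPolynomial.coeff_C] at h
      rw [if_neg (fun h' => hne (by rw [h']))] at h
      have h0 : (0 : Fin 2 →₀ ℕ) = ν := by
        by_contra h0
        simp [h0] at h
      subst h0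
      rw [Mon.mul_zero]
      refine ⟨(ord.mul _ _ _ (ord.refl _)).1, fun h' => hne ?_⟩
      rw [← Mon.mul_left_injective ((Mon.mul_zero (LM i)).trans h')]
    · simp [hi] at h

theorem Good.vecMul_mem (h : Good ord M P LM) (q : Fin k → BiRing K) : Matrix.vecMul q P ∈ M := by
  rw [Matrix.vecMul_eq_sum]
  exact M.sum_mem fun i _ => M.smul_mem _ (h.mem i)

/-- Passing from `M` to the kernel of a linear functional. -/
theorem Good.elementary (h : Good ord M P LM) (φ : (Fin m → BiRing K) →ₗ[K] K)
    (hM' : ∀ p, p ∈ M' ↔ p ∈ M ∧ φ p = 0) {π : Fin k} (hπ : φ (P π) ≠ 0)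
    (hmin : ∀ i, φ (P i) ≠ 0 → ord.le (LM π) (LM i)) {k' : ℕ} {lab : Fin k' → Fin k ⊕ Fin 2}
    (hinj : Function.Injective lab) (hinl : ∀ i, (∃ s, lab s = Sum.inl i) ↔ i ≠ π)
    (hinr : ∀ j, (∃ s, lab s = Sum.inr j) ↔
      ∀ i, i ≠ π → ¬ (LM i).Dvd (Mon.mul (Finsupp.single j 1) (LM π)))
    {Q : Matrix (Fin k') (Fin k) (BiRing K)} {LM' : Fin k' → Mon m}
    (hQl : ∀ s i, lab s = Sum.inl i → Q s = Pi.single i 1 +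
      (MvPolynomial.C (-φ (P i) / φ (P π)) : BiRing K) • (Pi.single π 1 : Fin k → BiRing K))
    (hQr : ∀ s j, lab s = Sum.inr j → Q s =
      (MvPolynomial.X j - MvPolynomial.C (φ ((MvPolynomial.X j : BiRing K) • P π) / φ (P π))) •
        (Pi.single π 1 : Fin k → BiRing K))
    (hLl : ∀ s i, lab s = Sum.inl i → LM' s = LM i)
    (hLr : ∀ s j, lab s = Sum.inr j → LM' s = Mon.mul (Finsupp.single j 1) (LM π)) :
    (∀ s, Lead ord LM (Q s) (LM' s)) ∧ Good ord M' (Q * P) LM' := by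
  have hlead : ∀ s, Lead ord LM (Q s) (LM' s) := by
    intro s
    rcases hs : lab s with i | j
    · rw [hQl s i hs, hLl s i hs]
      have hi := (hinl i).1 ⟨s, hs⟩
      -- A nonzero multiplier means that `φ` is nonzero on row `i`, so the choice of the pivot gives
      -- `LM π ≤ LM i`. Equality is excluded because leading monomials in a minimal basis are
      -- distinct.
      refine lead_single_add LM hi fun hc => ⟨hmin i fun h0 => hc (by simp [h0]), fun h' => ?_⟩
      exact hi (h.injective h').symm
    · rw [hQr s j hs, hLr s j hs]
      exact lead_linear_single LM j π _
  have hC : ∀ (c : K) (p : Fin m → BiRing K), φ ((MvPolynomial.C c : BiRing K) • p) = c * φ p := by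
    intro c p
    have : (MvPolynomial.C c : BiRing K) • p = c • p := by
      ext1 i
      simp [MvPolynomial.smul_eq_C_mul]
    rw [this, map_smul, smul_eq_mul]
  have hmem : ∀ s, (Q * P) s ∈ M' := by
    intro s
    rw [hM', mul_row]
    refine ⟨h.vecMul_mem _, ?_⟩
    rcases hs : lab s with i | j
    · rw [hQl s i hs, Matrix.add_vecMul, Matrix.smul_vecMul, single_vecMul,
        single_vecMul, map_add, hC]
      field_simp
      ring
    · rw [hQr s j hs, Matrix.smul_vecMul, single_vecMul, sub_smul, map_sub, hC]
      field_simp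
      ring
  -- A row for the variable `j` is omitted only when another row, which is kept, already has a
  -- leading monomial dividing that of X_j times the pivot.
  have hXY : ∀ j, ∃ s, (LM' s).Dvd (Mon.mul (Finsupp.single j 1) (LM π)) := by
    intro j
    by_cases hj : ∀ i, i ≠ π → ¬ (LM i).Dvd (Mon.mul (Finsupp.single j 1) (LM π))
    · obtain ⟨s, hs⟩ := (hinr j).2 hj
      exact ⟨s, by rw [hLr s j hs]; exact Mon.Dvd.refl _⟩
    · push Not at hj
      obtain ⟨i, hi, hd⟩ := hj
      obtain ⟨s, hs⟩ := (hinl i).2 hi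
      exact ⟨s, by rw [hLl s i hs]; exact hd⟩
  refine ⟨hlead, hmem, fun s => ?_, fun s s' hss' => ?_, fun p hp μ hμ => ?_⟩
  · rw [mul_row]
    exact (hlead s).vecMul h.lead
  · rcases hs : lab s with i | j <;> rcases hs' : lab s' with i' | j'
    · rw [hLl s i hs, hLl s' i' hs']
      refine h.anti i i' ?_
      rintro rfl
      exact hss' (hinj (hs'.trans hs.symm))
    · rw [hLl s i hs, hLr s' j' hs']
      intro hd
      exact h.anti i π ((hinl i).1 ⟨s, hs⟩).symm (Mon.Dvd.trans ⟨_, rfl⟩ hd)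
    · rw [hLr s j hs, hLl s' i' hs']
      exact (hinr j).1 ⟨s, hs⟩ i' ((hinl i').1 ⟨s', hs'⟩)
    · rw [hLr s j hs, hLr s' j' hs', Mon.dvd_iff]
      rintro ⟨hd, -⟩
      have h1 := hd j'
      simp only [Mon.mul, Finsupp.coe_add, Pi.add_apply, Finsupp.single_eq_same] at h1
      have hne : j' ≠ j := by
        rintro rfl
        exact hss' (hinj (hs'.trans hs.symm))
      rw [Finsupp.single_eq_of_ne hne] at h1
      omega
  · obtain ⟨hpM, hφ⟩ := (hM' p).1 hp
    obtain ⟨i, a, ha⟩ := h.dvd p hpM μ hμ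
    by_cases hi : i = π
    · subst hi
      -- This is the only case in which the pivot's leading monomial would have to be kept, and it
      -- is contradictory: after subtracting a scalar multiple of the pivot, the remainder lies
      -- strictly below it.
      by_cases ha0 : a = 0
      · exfalso
        rw [ha0, Mon.mul_zero] at ha
        have hi' := lead_unitMon.1 (h.lead i)
        set c := (p μ.2).coeff μ.1 / ((P i) (LM i).2).coeff (LM i).1 with hc
        have hc0 : c ≠ 0 := div_ne_zero hμ.1 hi'.1
        have hq := isLeading_monomial_smul hi' 0 hc0
        rw [Mon.mul_zero, ← ha] at hq
        have hcoeff : (p μ.2).coeff μ.1 =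
            (((MvPolynomial.monomial 0 c : BiRing K) • P i) μ.2).coeff μ.1 := by
          simp only [Pi.smul_apply, smul_eq_mul]
          have := MvPolynomial.coeff_monomial_mul μ.1 0 c (P i μ.2)
          rw [zero_add] at this
          rw [this, hc, ha, div_mul_cancel₀ _ hi'.1]
        have hlt := isLeading_sub hμ hq hcoeff
        -- Every row that can occur in the reduction of the remainder is smaller than the pivot,
        -- hence killed by `φ`. So the remainder is in `M'`, and `φ` of the scalar multiple of the
        -- pivot must vanish, which it does not.
        have hmem' : p - (MvPolynomial.monomial 0 c : BiRing K) • P i ∈ M' := by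
          by_cases h0 : p - (MvPolynomial.monomial 0 c : BiRing K) • P i = 0
          · rw [h0]; exact M'.zero_mem
          · obtain ⟨μ', hμ'⟩ := exists_isLeading ord h0
            refine h.mem_of_isLeading M' μ' _ (M.sub_mem hpM (M.smul_mem _ (h.mem i))) hμ' ?_
            intro j hj
            refine (hM' _).2 ⟨h.mem j, ?_⟩
            by_contra hφj
            have h1 := hmin j hφj
            rw [← ha] at h1
            exact ModMonOrder.lt_irrefl
              (ModMonOrder.lt_of_lt_of_le (hlt μ' hμ') (ord.trans _ _ _ h1 hj))
        have h2 := ((hM' _).1 hmem').2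
        have h3 : (MvPolynomial.monomial 0 c : BiRing K) = MvPolynomial.C c := rfl
        rw [map_sub, hφ, h3, hC, zero_sub, neg_eq_zero] at h2
        exact mul_ne_zero hc0 hπ h2
      · obtain ⟨j, hj⟩ := Finsupp.ne_iff.1 ha0
        obtain ⟨s, hs⟩ := hXY j
        refine ⟨s, hs.trans ⟨a - Finsupp.single j 1, ?_⟩⟩
        rw [← Mon.mul_mul, tsub_add_cancel_of_le, ha]
        rw [Finsupp.single_le_iff]
        simp at hj
        omega
    · obtain ⟨s, hs⟩ := (hinl i).2 hi
      exact ⟨s, by rw [hLl s i hs]; exact ⟨a, ha⟩⟩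

theorem smul_mem_of_mem_padeIdeal {d e : ℕ} {p : Fin m → BiRing K}
    (hX : (MvPolynomial.X 0 ^ d : BiRing K) • p ∈ M) (hY : (MvPolynomial.X 1 ^ e : BiRing K) • p ∈ M)
    {f : BiRing K} (hf : f ∈ padeIdeal K d e) : f • p ∈ M := by
  have : padeIdeal K d e ≤ M.comap (LinearMap.toSpanSingleton (BiRing K) _ p) := by
    rw [padeIdeal, Ideal.span_le]
    rintro _ (rfl | rfl)
    · exact hX
    · exact hY
  exact this hf

/-- Truncation of the transformation matrix preserves Gröbner bases. -/
theorem Good.truncate (h : Good ord M P LM) {d e k' : ℕ}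
    (hX : ∀ j, (MvPolynomial.X 0 ^ d : BiRing K) • P j ∈ M')
    (hY : ∀ j, (MvPolynomial.X 1 ^ e : BiRing K) • P j ∈ M')
    {Q Q' : Matrix (Fin k') (Fin k) (BiRing K)} {LM' : Fin k' → Mon m}
    (hlead : ∀ s, Lead ord LM (Q s) (LM' s)) (hgood : Good ord M' (Q * P) LM')
    (hQ' : ∀ s j ν, (Q' s j).coeff ν =
      if ν 0 < d + 1 ∧ ν 1 < e + 1 then (Q s j).coeff ν else 0) :
    (∀ s, Lead ord LM (Q' s) (LM' s)) ∧ Good ord M' (Q' * P) LM' := by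
  have hlead' : ∀ s, Lead ord LM (Q' s) (LM' s) := by
    intro s
    obtain ⟨x, hx0, hxμ, hx⟩ := hlead s
    -- If a multiple `a` of row `x.2` lies in `M'`, some new leading monomial divides that of this
    -- multiple. When `a ≤ x.1` it also divides `LM' s`, so by minimality it is `LM' s`, and `x.1`
    -- cannot exceed `a`. Taking for `a` the exponents of X^d and Y^e bounds the leading term of row
    -- `s` by `d` and `e`; truncation modulo X^(d+1), Y^(e+1) therefore keeps it.
    have key : ∀ a : Fin 2 →₀ ℕ, MvPolynomial.monomial a (1 : K) • P x.2 ∈ M' → a ≤ x.1 →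
        x.1 ≤ a := by
      intro a ha hle
      obtain ⟨i, hi⟩ := hgood.dvd _ ha _
        (isLeading_monomial_smul (lead_unitMon.1 (h.lead x.2)) a one_ne_zero)
      have hd : (Mon.mul a (LM x.2)).Dvd (LM' s) := by
        rw [← hxμ, Mon.dvd_iff]
        exact ⟨add_le_add_left hle _, rfl⟩
      by_cases his : i = s
      · subst his
        rw [← hxμ, Mon.dvd_iff] at hi
        exact le_of_add_le_add_right hi.1
      · exact absurd (hi.trans hd) (hgood.anti s i his)
    have hx0d : x.1 0 < d + 1 := by
      by_contra hlt
      have := (le_iff_fin_two.1 (key (Finsupp.single 0 d) (by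
        rw [← MvPolynomial.X_pow_eq_monomial]; exact hX _)
        (le_iff_fin_two.2 (by simp; omega)))).1
      simp at this
      omega
    have hx1e : x.1 1 < e + 1 := by
      by_contra hlt
      have := (le_iff_fin_two.1 (key (Finsupp.single 1 e) (by
        rw [← MvPolynomial.X_pow_eq_monomial]; exact hY _)
        (le_iff_fin_two.2 (by simp; omega)))).2
      simp at this
      omega
    refine ⟨x, by rwa [hQ', if_pos ⟨hx0d, hx1e⟩], hxμ, fun y hy hy0 => hx y hy fun h' => hy0 ?_⟩
    rw [hQ', h', ite_self]
  refine ⟨hlead', fun s => ?_, fun s => ?_, hgood.anti, hgood.dvd⟩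
  · have h1 : (Q' * P) s = (Q * P) s - Matrix.vecMul (Q s - Q' s) P := by
      rw [mul_row, mul_row, Matrix.sub_vecMul, sub_sub_cancel]
    rw [h1, Matrix.vecMul_eq_sum]
    refine M'.sub_mem (hgood.mem s) (M'.sum_mem fun j _ => ?_)
    -- The deleted part of each entry lies in the ideal, so its product with the row of `P` is in
    -- `M'`.
    refine smul_mem_of_mem_padeIdeal (hX j) (hY j) (mem_padeIdeal.2 fun ν h0 h1 => ?_)
    rw [Pi.sub_apply, MvPolynomial.coeff_sub, hQ', if_pos ⟨by omega, by omega⟩, sub_self]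
  · rw [mul_row]
    exact (hlead' s).vecMul h.lead

end Steps

/-! ## Execution of straight-line programs -/

theorem Counted.cost_all_le {ι β : Type*} [Fintype ι] {f : ι → Counted β} {c : ℕ}
    (h : ∀ i, (f i).cost ≤ c) : (Counted.all f).cost ≤ Fintype.card ι * c := by
  refine (Finset.sum_le_card_nsmul Finset.univ _ c fun i _ => h i).trans ?_
  rw [Finset.card_univ, smul_eq_mul]

section Execution

variable {K : Type*} [Field K]

theorem Operand.fetch_counted {ι : Type*} (x : ι → K) (regs : List K) (w : Operand K ι) :
    w.fetch (FieldOps.counted K) x regs = w.eval x regs := by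
  cases w <;> rfl

theorem Instr.exec_counted {ι : Type*} (x : ι → K) (regs : List K) (I : Instr K ι) :
    I.exec (FieldOps.counted K) x regs = ⟨I.eval x regs, 1⟩ := by
  rcases I with ⟨_ | _ | _, l, r⟩ <;> simp only [Instr.exec, Instr.eval, Operand.fetch_counted] <;>
    rfl

theorem Circuit.run_counted {ι o : Type*} (c : Circuit K ι o) (x : ι → K) :
    c.run (FieldOps.counted K) x = ⟨c.eval x, c.size⟩ := by
  have hstep : (fun (regs : List K) I => (Instr.exec (FieldOps.counted K) x regs I).bind
      fun v => .ret (regs ++ [v])) = fun regs I => ⟨regs ++ [I.eval x regs], 1⟩ := by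
    funext regs I
    rw [Instr.exec_counted]
    rfl
  have h : ∀ (code : List (Instr K ι)) (regs : List K),
      Counted.loop (fun regs I => ⟨regs ++ [I.eval x regs], 1⟩) regs code =
      ⟨code.foldl (fun regs I => regs ++ [I.eval x regs]) regs, code.length⟩ := by
    intro code
    induction code with
    | nil => intro regs; rfl
    | cons I code ih =>
      intro regs
      simp only [Counted.loop, Counted.bind, ih, List.foldl_cons, List.length_cons, add_comm]
  rw [Circuit.run, hstep, h]
  simp only [Counted.bind, Counted.ret, Operand.fetch_counted]
  rfl

theorem coeff_matMul {M : MulRoutine K} (hM : M.IsCorrect) {k l c a b : ℕ}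
    (P : Fin k → Fin l → BPoly K a b) (Q : Fin l → Fin c → BPoly K a b) (i : Fin k) (j : Fin c)
    (ν : Fin 2 →₀ ℕ) :
    ((matMul (FieldOps.counted K) M P Q).val i j).toPoly.coeff ν =
      if ν 0 < a ∧ ν 1 < b then (∑ r, (P i r).toPoly * (Q r j).toPoly).coeff ν else 0 := by
  have h : (matMul (FieldOps.counted K) M P Q).val i j =
      BPoly.ofPoly a b (∑ r, (P i r).toPoly * (Q r j).toPoly) := by
    funext st
    rw [← hM]
    simp [matMul, Counted.bind, Counted.ret, Circuit.run_counted]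
  rw [h, BPoly.coeff_toPoly_ofPoly]

theorem cost_matMul {M : MulRoutine K} {k l c a b : ℕ}
    (P : Fin k → Fin l → BPoly K a b) (Q : Fin l → Fin c → BPoly K a b) :
    (matMul (FieldOps.counted K) M P Q).cost = (M k l c a b).size := by
  simp [matMul, Counted.bind, Counted.ret, Circuit.run_counted]

end Execution

/-! ## Elementary Gröbner bases -/

section Elementary

variable {K : Type*} [Field K] {m n k : ℕ} {ord : ModMonOrder m}
  {M M' : Submodule (BiRing K) (Fin m → BiRing K)} {P : Matrix (Fin k) (Fin m) (BiRing K)}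
  {LM : Fin k → Mon m}

/-- The row as a vector of polynomials. -/
noncomputable def ElemRow.toVec : ElemRow K k → Fin k → BiRing K
  | .unit i => Pi.single i 1
  | .comb i π c => Pi.single i 1 + (MvPolynomial.C c : BiRing K) • (Pi.single π 1 : Fin k → BiRing K)
  | .lin j π α => (MvPolynomial.X j - MvPolynomial.C α : BiRing K) •
      (Pi.single π 1 : Fin k → BiRing K)

/-- The elementary Gröbner basis as a matrix of polynomials. -/
noncomputable def ElemBasis.toMatrix (E : ElemBasis K m k) :
    Matrix (Fin E.rows) (Fin k) (BiRing K) :=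
  Matrix.of fun s => (E.row s).toVec

theorem nodup_rowLabels (LM : Fin k → Mon m) (π : Fin k) : (rowLabels LM π).Nodup := by
  rw [rowLabels, List.nodup_flatMap]
  constructor
  · intro i _
    split_ifs
    · refine List.Nodup.map Sum.inr_injective ?_
      exact (List.nodup_finRange 2).filter _
    · exact List.nodup_singleton _
  · refine (List.nodup_finRange k).imp ?_
    intro i j hij
    simp only [Function.onFun, List.disjoint_left]
    split_ifs with h1 h2 h2
    · exact absurd (h1.trans h2.symm) hij
    · simp
    · simp
    · simpa using hij

theorem inl_mem_rowLabels {LM : Fin k → Mon m} {π i : Fin k} :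
    Sum.inl i ∈ rowLabels LM π ↔ i ≠ π := by
  simp only [rowLabels, List.mem_flatMap, List.mem_finRange, true_and]
  constructor
  · rintro ⟨j, hj⟩
    split_ifs at hj with h
    · simp at hj
    · simp only [List.mem_singleton, Sum.inl.injEq] at hj
      rwa [hj]
  · intro h
    exact ⟨i, by simp [h]⟩

theorem inr_mem_rowLabels {LM : Fin k → Mon m} {π : Fin k} {j : Fin 2} :
    Sum.inr j ∈ rowLabels LM π ↔
      ∀ i, i ≠ π → ¬ (LM i).Dvd (Mon.mul (Finsupp.single j 1) (LM π)) := by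
  have : Sum.inr j ∈ rowLabels LM π ↔ j ∈ keptVars LM π := by
    simp only [rowLabels, List.mem_flatMap, List.mem_finRange, true_and]
    constructor
    · rintro ⟨i, hi⟩
      split_ifs at hi with h
      · simpa using hi
      · simp at hi
    · intro h
      exact ⟨π, by simpa using h⟩
  rw [this, keptVars, List.mem_filter]
  simp [List.mem_finRange]

/-- The elementary basis computed by the base case from the pivot `π`. -/
noncomputable def pivotBasis {a b : ℕ} (lf : (Fin n → BPoly K a b) → K)
    (G : Fin k → Fin n → BPoly K a b) (LM : Fin k → Mon m) (π : Fin k) : ElemBasis K m k where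
  rows := (rowLabels LM π).length
  row s := match (rowLabels LM π).get s with
    | .inl i => .comb i π ((0 - lf (G i)) / lf (G π))
    | .inr j => .lin j π (lf (fun c => (G π c).mulVar 0 j) / lf (G π))
  LM s := match (rowLabels LM π).get s with
    | .inl i => LM i
    | .inr j => Mon.mul (Finsupp.single j 1) (LM π)

open Classical in
theorem baseCase_cases {a b : ℕ} (ord : ModMonOrder m) (lf : (Fin n → BPoly K a b) → K)
    (G : Fin k → Fin n → BPoly K a b) (LM : Fin k → Mon m) :
    (∃ π, IsPivot ord LM (fun i => decide (lf (G i) = 0)) π ∧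
      (baseCase (FieldOps.counted K) lf G ord LM).val = pivotBasis lf G LM π) ∨
    ((¬ ∃ π, IsPivot ord LM (fun i => decide (lf (G i) = 0)) π) ∧
      (baseCase (FieldOps.counted K) lf G ord LM).val =
        { rows := k, row := fun i => .unit i, LM := LM }) := by
  unfold baseCase
  dsimp only [Counted.bind]
  split_ifs with hp
  · refine Or.inl ⟨hp.choose, hp.choose_spec, ?_⟩
    simp only [Counted.ret, pivotBasis, Counted.all]
    congr 1
    funext s
    generalize (rowLabels LM _).get s = x
    cases x <;> rfl
  · exact Or.inr ⟨hp, rfl⟩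

/-- The algorithm evaluates `lf` on residuals; `hv` and `hX` say that these values are those of `φ`
on the rows of `P` and on their multiples by a variable. Without a pivot, `φ` vanishes on all of `M`
and the identity is the right answer. -/
theorem baseCase_good (h : Good ord M P LM) (φ : (Fin m → BiRing K) →ₗ[K] K)
    (hM' : ∀ p, p ∈ M' ↔ p ∈ M ∧ φ p = 0) {a b : ℕ} {lf : (Fin n → BPoly K a b) → K}
    {G : Fin k → Fin n → BPoly K a b} (hv : ∀ i, lf (G i) = φ (P i))
    (hX : ∀ i j, lf (fun c => (G i c).mulVar 0 j) = φ ((MvPolynomial.X j : BiRing K) • P i))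
    {E : ElemBasis K m k} (hE : E = (baseCase (FieldOps.counted K) lf G ord LM).val) :
    (∀ s, Lead ord LM (E.toMatrix s) (E.LM s)) ∧ Good ord M' (E.toMatrix * P) E.LM := by
  rcases baseCase_cases ord lf G LM with ⟨π, hπ, hE'⟩ | ⟨hp, hE'⟩
  · rw [hE'] at hE
    subst hE
    refine h.elementary φ hM' (π := π) (lab := fun s => (rowLabels LM π).get s) ?_ ?_ ?_ ?_ ?_ ?_
      ?_ ?_ ?_
    · rw [← hv]
      simpa using hπ.1
    · intro i hi
      have := hπ.2 i (by simpa [hv] using hi)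
      rcases this with h' | h'
      · simpa [Mon.mul_zero] using h'.1
      · exact ModMonOrder.le_of_eq (by simpa [Mon.mul_zero] using h'.1)
    · exact List.nodup_iff_injective_get.1 (nodup_rowLabels LM π)
    · intro i
      rw [← List.mem_iff_get, inl_mem_rowLabels]
    · intro i
      rw [← List.mem_iff_get, inr_mem_rowLabels]
    · intro s i hs
      change ElemRow.toVec _ = _
      dsimp only [pivotBasis] at hs ⊢
      rw [hs]
      simp only [ElemRow.toVec, zero_sub, hv]
    · intro s j hs
      change ElemRow.toVec _ = _
      dsimp only [pivotBasis] at hs ⊢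
      rw [hs]
      simp only [ElemRow.toVec, hv, hX]
    · intro s i hs
      dsimp only [pivotBasis] at hs ⊢
      rw [hs]
    · intro s i hs
      dsimp only [pivotBasis] at hs ⊢
      rw [hs]
  · rw [hE'] at hE
    subst hE
    have h0 : ∀ i, φ (P i) = 0 := by
      intro i
      by_contra hi
      obtain ⟨π, hπ, hmin⟩ := ord.exists_min LM (fun i => φ (P i) ≠ 0) ⟨i, hi⟩
      refine hp ⟨π, by simpa [hv] using hπ, fun j hj => ?_⟩
      have hle := hmin j (by simpa [hv] using hj)
      -- A tie in the Schreyer order would require equal leading monomials, which a minimal basis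
      -- has only for equal indices.
      by_cases hjπ : π = j
      · rw [hjπ]; exact (ord.schreyer LM).refl _
      · refine Or.inl ⟨by simpa [Mon.mul_zero] using hle, fun h' => hjπ (h.injective ?_)⟩
        simpa [Mon.mul_zero] using h'
    have hMM' : M = M' := le_antisymm
      (h.le_of_mem M' fun i => (hM' _).2 ⟨h.mem i, h0 i⟩) fun p hp => ((hM' p).1 hp).1
    subst hMM'
    refine ⟨fun s => lead_single LM s, ?_⟩
    convert h using 1
    funext s
    rw [mul_row]
    exact single_vecMul s P

theorem baseCase_cost {a b : ℕ} (ord : ModMonOrder m) (lf : (Fin n → BPoly K a b) → K)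
    (G : Fin k → Fin n → BPoly K a b) (LM : Fin k → Mon m) :
    (baseCase (FieldOps.counted K) lf G ord LM).cost ≤
      k + 2 * (baseCase (FieldOps.counted K) lf G ord LM).val.rows := by
  classical
  have hsum : ∀ v : Fin k → K, ∑ i, ((FieldOps.counted K).isZero (v i)).cost = k := by
    intro v
    simp [FieldOps.counted]
  unfold baseCase
  dsimp only [Counted.bind]
  split_ifs with hp
  · refine add_le_add (hsum _).le ?_
    simp only [Counted.ret, add_zero]
    refine (Counted.cost_all_le (c := 2) fun s => ?_).trans (by rw [Fintype.card_fin, mul_comm])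
    split <;> simp [FieldOps.counted]
  · exact (add_le_add (hsum _).le (Nat.zero_le _))

theorem BPoly.mulVar_apply {a b : ℕ} (p : BPoly K a b) (j : Fin 2) (ij : Fin a × Fin b) :
    p.mulVar 0 j ij = (MvPolynomial.X j * p.toPoly).coeff (expXY ij.1 ij.2) := by
  rw [MvPolynomial.coeff_X_mul', coeff_toPoly]
  fin_cases j
  · by_cases h : (ij.1 : ℕ) = 0 <;> simp [mulVar, h]
  · by_cases h : (ij.2 : ℕ) = 0 <;> simp [mulVar, h]

theorem coeff_elemMul {c a b : ℕ} (E : ElemBasis K m k) (N : Fin k → Fin c → BPoly K a b)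
    (s : Fin E.rows) (t : Fin c) (ν : Fin 2 →₀ ℕ) :
    ((elemMul (FieldOps.counted K) E N).val s t).toPoly.coeff ν = if ν 0 < a ∧ ν 1 < b then
      ((E.toMatrix * Matrix.of fun i j => (N i j).toPoly : Matrix _ _ (BiRing K)) s t).coeff ν
      else 0 := by
  rw [BPoly.coeff_toPoly]
  split_ifs with h
  · rw [BPoly.coeffD_of_lt _ _ h.1 h.2, mul_row]
    simp only [elemMul, Counted.all]
    rw [show E.toMatrix s = (E.row s).toVec from rfl]
    have hN : ∀ i, N i t (⟨ν 0, h.1⟩, ⟨ν 1, h.2⟩) = (N i t).toPoly.coeff ν := by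
      intro i
      rw [BPoly.coeff_toPoly, BPoly.coeffD_of_lt _ _ h.1 h.2]
    rcases hs : E.row s with i | ⟨i, π, w⟩ | ⟨j, π, α⟩
    · simp only [Counted.ret, ElemRow.toVec, single_vecMul, Matrix.of_apply, hN]
    · simp only [Counted.bind, FieldOps.counted, ElemRow.toVec, Matrix.add_vecMul,
        Matrix.smul_vecMul, single_vecMul, Matrix.of_apply, hN, Pi.add_apply, Pi.smul_apply,
        smul_eq_mul, MvPolynomial.coeff_add, MvPolynomial.coeff_C_mul]
    · simp only [Counted.bind, FieldOps.counted, ElemRow.toVec, sub_smul, Matrix.sub_vecMul,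
        Matrix.smul_vecMul, single_vecMul, Matrix.of_apply, hN, Pi.sub_apply, Pi.smul_apply,
        smul_eq_mul, MvPolynomial.coeff_sub, MvPolynomial.coeff_C_mul, BPoly.mulVar_apply,
        expXY_apply]
  · exact BPoly.coeffD_of_not _ _ h

theorem elemMul_cost {c a b : ℕ} (E : ElemBasis K m k) (N : Fin k → Fin c → BPoly K a b) :
    (elemMul (FieldOps.counted K) E N).cost ≤ E.rows * (c * (a * b * 2)) := by
  refine (Counted.cost_all_le (c := c * (a * b * 2)) fun s => ?_).trans
    (by rw [Fintype.card_fin])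
  refine (Counted.cost_all_le (c := a * b * 2) fun t => ?_).trans (by rw [Fintype.card_fin])
  refine (Counted.cost_all_le (c := 2) fun ij => ?_).trans (by simp)
  split <;> simp [FieldOps.counted, Counted.ret, Counted.bind]

end Elementary

/-! ## Approximation of `P F` by `X^s Y^t G` -/

section Cong

variable {K : Type*} [Field K] {m n k : ℕ} {ord : ModMonOrder m}
  {F : Matrix (Fin m) (Fin n) (BiRing K)}
  {M : Submodule (BiRing K) (Fin m → BiRing K)} {P : Matrix (Fin k) (Fin m) (BiRing K)}
  {LM : Fin k → Mon m} {s t d e : ℕ} {G G' : Matrix (Fin k) (Fin n) (BiRing K)}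

/-- `P F = X^s Y^t G` modulo `⟨X^(s+d), Y^(t+e)⟩`. -/
def Cong (F : Matrix (Fin m) (Fin n) (BiRing K)) (s t d e : ℕ)
    (P : Matrix (Fin k) (Fin m) (BiRing K)) (G : Matrix (Fin k) (Fin n) (BiRing K)) : Prop :=
  ∀ i c, (P * F) i c - MvPolynomial.monomial (expXY s t) 1 * G i c ∈ padeIdeal K (s + d) (t + e)

/-- Two matrices are equal modulo `⟨X^d, Y^e⟩`. -/
def EqMod (d e : ℕ) (G G' : Matrix (Fin k) (Fin n) (BiRing K)) : Prop :=
  ∀ i c, G i c - G' i c ∈ padeIdeal K d e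

theorem EqMod.symm (h : EqMod d e G G') : EqMod d e G' G := fun i c => by
  rw [← neg_sub]
  exact (padeIdeal K d e).neg_mem (h i c)

theorem EqMod.trans {G'' : Matrix (Fin k) (Fin n) (BiRing K)} (h : EqMod d e G G')
    (h' : EqMod d e G' G'') : EqMod d e G G'' := fun i c => by
  rw [← sub_add_sub_cancel]
  exact (padeIdeal K d e).add_mem (h i c) (h' i c)

theorem EqMod.mul {l : ℕ} {Q Q' : Matrix (Fin l) (Fin k) (BiRing K)} (hQ : EqMod d e Q Q')
    (h : EqMod d e G G') : EqMod d e (Q * G) (Q' * G') := fun i c => by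
  rw [Matrix.mul_apply, Matrix.mul_apply, ← Finset.sum_sub_distrib]
  refine (padeIdeal K d e).sum_mem fun j _ => ?_
  rw [show Q i j * G j c - Q' i j * G' j c = (Q i j - Q' i j) * G j c + Q' i j * (G j c - G' j c) by
    ring]
  exact (padeIdeal K d e).add_mem (Ideal.mul_mem_right _ _ (hQ i j))
    (Ideal.mul_mem_left _ _ (h j c))

theorem EqMod.refl (G : Matrix (Fin k) (Fin n) (BiRing K)) : EqMod d e G G := fun i c => by
  rw [sub_self]; exact (padeIdeal K d e).zero_mem

theorem eqMod_of_coeff (h : ∀ i c ν, ν 0 < d → ν 1 < e → (G i c).coeff ν = (G' i c).coeff ν) :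
    EqMod d e G G' := fun i c => mem_padeIdeal.2 fun ν h0 h1 => by
  rw [MvPolynomial.coeff_sub, h i c ν h0 h1, sub_self]

theorem Cong.mul {l : ℕ} (h : Cong F s t d e P G) (Q : Matrix (Fin l) (Fin k) (BiRing K)) :
    Cong F s t d e (Q * P) (Q * G) := fun i c => by
  rw [Matrix.mul_assoc, Matrix.mul_apply, Matrix.mul_apply, Finset.mul_sum,
    ← Finset.sum_sub_distrib]
  refine (padeIdeal K _ _).sum_mem fun j _ => ?_
  rw [mul_left_comm, ← mul_sub]
  exact Ideal.mul_mem_left _ _ (h j c)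

theorem Cong.congr (h : Cong F s t d e P G) (h' : EqMod d e G G') : Cong F s t d e P G' :=
  fun i c => by
    rw [← sub_add_sub_cancel, ← mul_sub]
    exact (padeIdeal K _ _).add_mem (h i c) (monomial_mul_mem_padeIdeal.2 (h' i c))

theorem Cong.mono {d' e' : ℕ} (h : Cong F s t d' e' P G) (hd : d ≤ d') (he : e ≤ e') :
    Cong F s t d e P G := fun i c => padeIdeal_mono (by omega) (by omega) (h i c)

theorem Cong.mem_iff (h : Cong F s t d e P G) (i : Fin k) (c : Fin n) :
    (P * F) i c ∈ padeIdeal K (s + d) (t + e) ↔ G i c ∈ padeIdeal K d e := by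
  rw [← monomial_mul_mem_padeIdeal (s := s) (t := t) (f := G i c)]
  constructor
  · intro h'
    have := (padeIdeal K _ _).sub_mem h' (h i c)
    rwa [sub_sub_cancel] at this
  · intro h'
    have := (padeIdeal K _ _).add_mem (h i c) h'
    rwa [sub_add_cancel] at this

theorem Cong.coeff_eq (h : Cong F s t d e P G) (hd : 1 ≤ d) (he : 1 ≤ e) (i : Fin k) (c : Fin n) :
    ((P * F) i c).coeff (expXY s t) = (G i c).coeff 0 := by
  have := mem_padeIdeal.1 (h i c) (expXY s t) (by simp; omega) (by simp; omega)
  rw [MvPolynomial.coeff_sub, sub_eq_zero] at this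
  rw [this]
  have h0 := MvPolynomial.coeff_monomial_mul 0 (expXY s t) (1 : K) (G i c)
  rwa [add_zero, one_mul] at h0

variable (F) in
/-- The vectors `p` such that the entries of `p F` with index in `A` are zero
modulo `⟨X^d, Y^e⟩`. -/
noncomputable def syzOn (d e : ℕ) (A : Set (Fin n)) :
    Submodule (BiRing K) (Fin m → BiRing K) :=
  (Submodule.pi A fun _ => padeIdeal K d e).comap F.vecMulLinear

theorem mem_syzOn {A : Set (Fin n)} {p : Fin m → BiRing K} :
    p ∈ syzOn F d e A ↔ ∀ c ∈ A, Matrix.vecMul p F c ∈ padeIdeal K d e := by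
  simp [syzOn]

theorem syzOn_univ : syzOn F d e Set.univ = syzModule (padeModule K n d e) F := rfl

theorem syzOn_anti {d' e' : ℕ} (hd : d ≤ d') (he : e ≤ e') (A : Set (Fin n)) :
    syzOn F d' e' A ≤ syzOn F d e A := fun _ hp =>
  mem_syzOn.2 fun c hc => padeIdeal_mono hd he (mem_syzOn.1 hp c hc)

theorem Cong.mem_syzOn_iff (h : Cong F s t d e P G) (i : Fin k) (A : Set (Fin n)) :
    P i ∈ syzOn F (s + d) (t + e) A ↔ ∀ c ∈ A, G i c ∈ padeIdeal K d e := by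
  rw [mem_syzOn]
  refine forall₂_congr fun c _ => ?_
  rw [← h.mem_iff, mul_row]

theorem Cong.smul_mem_syzOn (h : Cong F s t d e P G) (i : Fin k) (A : Set (Fin n))
    {f : BiRing K} (hf : f ∈ padeIdeal K d e) : f • P i ∈ syzOn F (s + d) (t + e) A := by
  rw [mem_syzOn]
  intro c _
  rw [Matrix.smul_vecMul, Pi.smul_apply, smul_eq_mul, ← mul_row]
  have h1 := Ideal.mul_mem_left _ f (h i c)
  have h2 : MvPolynomial.monomial (expXY s t) 1 * (f * G i c) ∈ padeIdeal K (s + d) (t + e) :=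
    monomial_mul_mem_padeIdeal.2 (Ideal.mul_mem_right _ _ hf)
  have := (padeIdeal K _ _).add_mem h1 h2
  rwa [mul_sub, mul_left_comm f, sub_add_cancel] at this

theorem X_zero_pow_mem : (MvPolynomial.X 0 ^ d : BiRing K) ∈ padeIdeal K d e :=
  Ideal.subset_span (by simp)

theorem X_one_pow_mem : (MvPolynomial.X 1 ^ e : BiRing K) ∈ padeIdeal K d e :=
  Ideal.subset_span (by simp)

/-- The number of elements of a minimal Gröbner basis of a module that contains
`Syz_N(F)` with `N` the Padé module. -/
theorem Good.rows_le (h : Good ord M P LM) (hM : syzOn F d e Set.univ ≤ M) :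
    k ≤ m * (min d e + 1) := by
  have hmem : ∀ (f : BiRing K) (i : Fin m), f ∈ padeIdeal K d e →
      f • (Pi.single i 1 : Fin m → BiRing K) ∈ M := by
    intro f i hf
    refine hM (mem_syzOn.2 fun c _ => ?_)
    rw [Matrix.smul_vecMul]
    exact Ideal.mul_mem_right _ _ hf
  -- The module contains X^d and Y^e times every unit vector. A basis monomial that is a multiple of
  -- one of these must, by minimality, divide it as well; so all exponents are at most `d` and `e`.
  have key : ∀ (a : Fin 2 →₀ ℕ), MvPolynomial.monomial a (1 : K) ∈ padeIdeal K d e →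
      ∀ s, a ≤ (LM s).1 → (LM s).1 ≤ a := by
    intro a ha s hs
    have hl : IsLeading ord (MvPolynomial.monomial a (1 : K) •
        (Pi.single (LM s).2 1 : Fin m → BiRing K)) (Mon.mul a (unitMon m (LM s).2)) :=
      isLeading_monomial_smul (lead_unitMon.1 (lead_single (ord := ord) (unitMon m) (LM s).2)) a
        one_ne_zero
    obtain ⟨i, hi⟩ := h.dvd _ (hmem _ (LM s).2 ha) _ hl
    have hx : Mon.mul a (unitMon m (LM s).2) = (a, (LM s).2) := mul_unitMon (a, (LM s).2)
    rw [hx] at hi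
    have hd : Mon.Dvd (a, (LM s).2) (LM s) := Mon.dvd_iff.2 ⟨hs, rfl⟩
    by_cases his : i = s
    · subst his
      exact (Mon.dvd_iff.1 hi).1
    · exact absurd (hi.trans hd) (h.anti s i his)
  have h0 : ∀ s, (LM s).1 0 < d + 1 := by
    intro s
    by_contra hlt
    have := (le_iff_fin_two.1 (key (Finsupp.single 0 d)
      (by rw [← MvPolynomial.X_pow_eq_monomial]; exact X_zero_pow_mem) s
      (le_iff_fin_two.2 (by simp; omega)))).1
    simp at this
    omega
  have h1 : ∀ s, (LM s).1 1 < e + 1 := by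
    intro s
    by_contra hlt
    have := (le_iff_fin_two.1 (key (Finsupp.single 1 e)
      (by rw [← MvPolynomial.X_pow_eq_monomial]; exact X_one_pow_mem) s
      (le_iff_fin_two.2 (by simp; omega)))).2
    simp at this
    omega
  -- Two monomials in the same component with one equal exponent are comparable for divisibility, so
  -- in an antichain the component and either exponent determine the monomial.
  have hne : ∀ j : Fin 2, ∀ s s', (LM s).2 = (LM s').2 → (LM s).1 j = (LM s').1 j → s = s' := by
    intro j s s' h2 hj
    by_contra hss
    have hnot := h.anti s s' (Ne.symm hss)
    have hnot' := h.anti s' s hss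
    rw [Mon.dvd_iff, le_iff_fin_two] at hnot hnot'
    fin_cases j
    · simp only [Fin.zero_eta] at hj
      rcases le_total ((LM s).1 1) ((LM s').1 1) with hle | hle
      · exact hnot' ⟨⟨hj.le, hle⟩, h2⟩
      · exact hnot ⟨⟨hj.ge, hle⟩, h2.symm⟩
    · simp only [Fin.mk_one] at hj
      rcases le_total ((LM s).1 0) ((LM s').1 0) with hle | hle
      · exact hnot' ⟨⟨hle, hj.le⟩, h2⟩
      · exact hnot ⟨⟨hle, hj.ge⟩, h2.symm⟩
  have hcard : ∀ (j : Fin 2) (b : ℕ), (∀ s, (LM s).1 j < b) → k ≤ m * b := by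
    intro j b hb
    have := Fintype.card_le_of_injective
      (fun s : Fin k => (((LM s).2, ⟨(LM s).1 j, hb s⟩) : Fin m × Fin b)) (by
        intro s s' hss
        simp only [Prod.mk.injEq, Fin.mk.injEq] at hss
        exact hne j s s' hss.1 hss.2)
    simpa using this
  rcases le_total d e with hde | hde
  · rw [min_eq_left hde]; exact hcard 0 _ h0
  · rw [min_eq_right hde]; exact hcard 1 _ h1

end Cong

/-! ## Correctness of the algorithm -/

section Correctness

variable {K : Type*} [Field K] {m n k : ℕ} {ord : ModMonOrder m}
  {F : Matrix (Fin m) (Fin n) (BiRing K)}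
  {M : Submodule (BiRing K) (Fin m → BiRing K)} {P : Matrix (Fin k) (Fin m) (BiRing K)}
  {LM : Fin k → Mon m} {s t d e : ℕ}

/-- The matrix of polynomials with the given arrays of coefficients. -/
noncomputable def polyMat {k l a b : ℕ} (G : Fin k → Fin l → BPoly K a b) :
    Matrix (Fin k) (Fin l) (BiRing K) :=
  Matrix.of fun i j => (G i j).toPoly

/-- Elements of `M` lie in the border of the box `[0, s] × [0, t]`. -/
theorem Good.le_border {G : Matrix (Fin k) (Fin n) (BiRing K)} (h : Good ord M P LM)
    (hc : Cong F s t d e P G) :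
    M ≤ syzOn F s (t + e) Set.univ ⊓ syzOn F (s + d) t Set.univ := by
  have key : ∀ i c, MvPolynomial.monomial (expXY s t) 1 * G i c ∈
      padeIdeal K s (t + e) ⊓ padeIdeal K (s + d) t := by
    intro i c
    constructor <;> rw [SetLike.mem_coe, mem_padeIdeal] <;> intro ν h0 h1 <;>
      rw [MvPolynomial.coeff_monomial_mul', if_neg] <;> rw [le_iff_fin_two] <;> simp <;> omega
  refine h.le_of_mem _ fun i => ⟨mem_syzOn.2 fun c _ => ?_, mem_syzOn.2 fun c _ => ?_⟩
  · rw [← mul_row]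
    have := Ideal.add_mem _ (padeIdeal_mono (Nat.le_add_right s d) le_rfl (hc i c)) (key i c).1
    rwa [sub_add_cancel] at this
  · rw [← mul_row]
    have := Ideal.add_mem _ (padeIdeal_mono le_rfl (Nat.le_add_right t e) (hc i c)) (key i c).2
    rwa [sub_add_cancel] at this

variable (F) in
/-- The coefficient of `X^s Y^t` in the entry `c` of `p F`. -/
noncomputable def coeffFunctional (s t : ℕ) (c : Fin n) : (Fin m → BiRing K) →ₗ[K] K where
  toFun p := (Matrix.vecMul p F c).coeff (expXY s t)
  map_add' p q := by rw [Matrix.add_vecMul, Pi.add_apply, MvPolynomial.coeff_add]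
  map_smul' a p := by
    rw [Matrix.smul_vecMul, Pi.smul_apply, MvPolynomial.coeff_smul, RingHom.id_apply]

/-- Once the rest of the box is known to vanish, membership depends on the corner coefficient alone.
Each pass of the base case thus imposes one linear functional. -/
theorem mem_padeIdeal_succ {f : BiRing K} (h : f ∈ padeIdeal K s (t + 1))
    (h' : f ∈ padeIdeal K (s + 1) t) :
    f ∈ padeIdeal K (s + 1) (t + 1) ↔ f.coeff (expXY s t) = 0 := by
  rw [mem_padeIdeal] at *
  constructor
  · intro h''
    exact h'' _ (by simp) (by simp)
  · intro h'' ν h0 h1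
    by_cases h2 : ν 0 < s
    · exact h ν h2 h1
    · by_cases h3 : ν 1 < t
      · exact h' ν h0 h3
      · rw [← expXY_apply ν, show ν 0 = s by omega, show ν 1 = t by omega]
        exact h''

/-- The corner coefficient of X_j f is a coefficient of `f` already known to vanish. So the
functional is zero on X_j times a row, in agreement with the algorithm, whose residuals are kept
modulo X, Y and become zero when multiplied by a variable. -/
theorem X_smul_coeff_eq_zero {f : BiRing K} (h : f ∈ padeIdeal K s (t + 1))
    (h' : f ∈ padeIdeal K (s + 1) t) (j : Fin 2) :
    (MvPolynomial.X j * f).coeff (expXY s t) = 0 := by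
  rw [mem_padeIdeal] at *
  rw [MvPolynomial.coeff_X_mul']
  split_ifs with hj
  · fin_cases j
    · refine h _ ?_ ?_ <;> simp at hj ⊢ <;> omega
    · refine h' _ ?_ ?_ <;> simp at hj ⊢ <;> omega
  · rfl

/-- The invariant of the loop in the base case, when the columns in `A` have been processed. -/
structure LoopInv (ord : ModMonOrder m) (F : Matrix (Fin m) (Fin n) (BiRing K))
    (M : Submodule (BiRing K) (Fin m → BiRing K)) (P : Matrix (Fin k) (Fin m) (BiRing K))
    (LM : Fin k → Mon m) (s t : ℕ) (G : Matrix (Fin k) (Fin n) (BiRing K))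
    (A : Set (Fin n)) (S : LoopState K m k n) : Prop where
  lead : ∀ i, Lead ord LM (polyMat S.mat i) (S.LM i)
  good : Good ord (M ⊓ syzOn F (s + 1) (t + 1) A) (polyMat S.mat * P) S.LM
  res : EqMod 1 1 (polyMat S.res) (polyMat S.mat * G)

/-- One iteration of the loop in the base case. -/
noncomputable def loopStep (ord : ModMonOrder m) (S : LoopState K m k n) (i : Fin n) :
    Counted (LoopState K m k n) :=
  (baseCase (FieldOps.counted K) (fun f => f i (0, 0)) S.res ord S.LM).bind fun E =>
    (elemMul (FieldOps.counted K) E S.mat).bind fun mat =>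
    (elemMul (FieldOps.counted K) E S.res).bind fun res =>
    .ret { rows := E.rows, mat := mat, res := res, LM := E.LM }

/-- `baseCase_good` is applied to the current basis, with the corner coefficient in column `c` as
functional. The accumulated transformation is then truncated relative to the initial basis `P`, and
the residual, needed modulo X, Y only, is unaffected by that truncation. -/
theorem LoopInv.step (h : Good ord M P LM) {G : Matrix (Fin k) (Fin n) (BiRing K)}
    (hc : Cong F s t 1 1 P G) {A : Set (Fin n)} {S : LoopState K m k n}
    (hS : LoopInv ord F M P LM s t G A S) (c : Fin n) :
    LoopInv ord F M P LM s t G (insert c A) (loopStep ord S c).val := by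
  set E := (baseCase (FieldOps.counted K) (fun f => f c (0, 0)) S.res ord S.LM).val with hE
  have hborder := h.le_border hc
  have hcS : Cong F s t 1 1 (polyMat S.mat * P) (polyMat S.res) := (hc.mul _).congr hS.res.symm
  have hbd : ∀ p ∈ M, Matrix.vecMul p F c ∈ padeIdeal K s (t + 1) ∧
      Matrix.vecMul p F c ∈ padeIdeal K (s + 1) t := fun p hp =>
    ⟨mem_syzOn.1 (hborder hp).1 c trivial, mem_syzOn.1 (hborder hp).2 c trivial⟩
  obtain ⟨hlead, hgood⟩ := baseCase_good (M' := M ⊓ syzOn F (s + 1) (t + 1) (insert c A))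
    hS.good (coeffFunctional F s t c) (lf := fun f => f c (0, 0)) (G := S.res) (by
      intro p
      constructor
      · rintro ⟨h1, h2⟩
        rw [SetLike.mem_coe, mem_syzOn] at h2
        refine ⟨⟨h1, mem_syzOn.2 fun c' hc' => h2 c' (Set.mem_insert_of_mem _ hc')⟩, ?_⟩
        exact (mem_padeIdeal_succ (hbd p h1).1 (hbd p h1).2).1 (h2 c (Set.mem_insert _ _))
      · rintro ⟨⟨h1, h2⟩, h3⟩
        refine ⟨h1, mem_syzOn.2 fun c' hc' => ?_⟩
        rcases Set.mem_insert_iff.1 hc' with rfl | hc'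
        · exact (mem_padeIdeal_succ (hbd p h1).1 (hbd p h1).2).2 h3
        · exact mem_syzOn.1 h2 c' hc')
    (by
      intro i
      change _ = (Matrix.vecMul _ F c).coeff (expXY s t)
      rw [← mul_row, hcS.coeff_eq le_rfl le_rfl, polyMat, Matrix.of_apply, BPoly.coeff_toPoly]
      rfl)
    (by
      intro i j
      change _ = (Matrix.vecMul _ F c).coeff (expXY s t)
      have hi := hbd _ (hS.good.mem i).1
      rw [Matrix.smul_vecMul, Pi.smul_apply, smul_eq_mul, X_smul_coeff_eq_zero hi.1 hi.2]
      simp [BPoly.mulVar]) hE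
  rw [← Matrix.mul_assoc] at hgood
  have hQ : ∀ i, Lead ord LM ((E.toMatrix * polyMat S.mat) i) (E.LM i) := fun i => by
    rw [mul_row]
    exact (hlead i).vecMul hS.lead
  -- Over one box of size 1 × 1, multiplication by X or Y already brings the initial rows into the
  -- target module, as `Good.truncate` requires with `d = e = 1`.
  have hmem : ∀ j, ∀ f ∈ padeIdeal K 1 1,
      f • P j ∈ M ⊓ syzOn F (s + 1) (t + 1) (insert c A) := fun j f hf =>
    ⟨M.smul_mem _ (h.mem j), hc.smul_mem_syzOn j _ hf⟩
  have hcoeff : ∀ i j ν, (polyMat (loopStep ord S c).val.mat i j).coeff ν =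
      if ν 0 < 1 + 1 ∧ ν 1 < 1 + 1 then ((E.toMatrix * polyMat S.mat) i j).coeff ν else 0 :=
    fun i j ν => coeff_elemMul E S.mat i j ν
  obtain ⟨h1, h2⟩ := h.truncate (fun j => hmem j _ X_zero_pow_mem) (fun j => hmem j _ X_one_pow_mem)
    hQ hgood hcoeff
  refine ⟨h1, h2, ?_⟩
  have e1 : EqMod 1 1 (polyMat (loopStep ord S c).val.res) (E.toMatrix * polyMat S.res) :=
    eqMod_of_coeff fun i c' ν h0 h1 => by
      have := coeff_elemMul E S.res i c' ν
      rw [if_pos ⟨h0, h1⟩] at this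
      exact this
  have e2 : EqMod 1 1 (polyMat (loopStep ord S c).val.mat) (E.toMatrix * polyMat S.mat) :=
    eqMod_of_coeff fun i j ν h0 h1 => by rw [hcoeff, if_pos ⟨by omega, by omega⟩]
  have e3 := (EqMod.refl E.toMatrix).mul hS.res (d := 1) (e := 1)
  rw [← Matrix.mul_assoc] at e3
  exact (e1.trans e3).trans (e2.symm.mul (EqMod.refl G))

theorem loopStep_cost (ord : ModMonOrder m) (S : LoopState K m k n) (c : Fin n) :
    (loopStep ord S c).cost ≤ S.rows + 2 * (loopStep ord S c).val.rows +
      (loopStep ord S c).val.rows * (k * 8) + (loopStep ord S c).val.rows * (n * 2) := by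
  have h1 := baseCase_cost ord (fun f => f c (0, 0)) S.res S.LM
  have h2 := elemMul_cost
    (baseCase (FieldOps.counted K) (fun f => f c (0, 0)) S.res ord S.LM).val S.mat
  have h3 := elemMul_cost
    (baseCase (FieldOps.counted K) (fun f => f c (0, 0)) S.res ord S.LM).val S.res
  simp only [loopStep, Counted.bind, Counted.ret]
  simp only [mul_one, one_mul, Nat.reduceMul] at h2 h3
  omega

/-- The cost of a pass with at most `B` rows: zero tests and row coefficients take at most 3B,
updating the 2 × 2 truncated transformation at most 8B², and updating the residual at most 2Bn. The
bound `B` is asked of every state satisfying the invariant, so it covers all intermediate row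
counts. -/
theorem LoopInv.loop (h : Good ord M P LM) {G : Matrix (Fin k) (Fin n) (BiRing K)}
    (hc : Cong F s t 1 1 P G) (l : List (Fin n)) : ∀ (A : Set (Fin n)) (S : LoopState K m k n),
    LoopInv ord F M P LM s t G A S →
    LoopInv ord F M P LM s t G (A ∪ {c | c ∈ l}) (Counted.loop (loopStep ord) S l).val ∧
    ∀ B : ℕ, k ≤ B → (∀ A' S', LoopInv ord F M P LM s t G A' S' → S'.rows ≤ B) →
      (Counted.loop (loopStep ord) S l).cost ≤ l.length * (3 * B + 8 * B * B + 2 * B * n) := by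
  induction l with
  | nil =>
    intro A S hS
    exact ⟨by simpa [Counted.loop, Counted.ret] using hS, by simp [Counted.loop, Counted.ret]⟩
  | cons c l ih =>
    intro A S hS
    have hstep := hS.step h hc c
    obtain ⟨h1, h2⟩ := ih _ _ hstep
    constructor
    · have : A ∪ {c' | c' ∈ c :: l} = insert c A ∪ {c' | c' ∈ l} := by
        ext c'
        simp only [List.mem_cons, Set.mem_union, Set.mem_ofPred_eq, Set.mem_insert_iff]
        tauto
      rw [this]
      exact h1
    · intro B hk hB
      have h3 := h2 B hk hB
      have h4 := loopStep_cost ord S c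
      have h5 := hB _ _ hS
      have h6 := hB _ _ hstep
      have h7 : (loopStep ord S c).val.rows * (k * 8) ≤ B * (B * 8) := by gcongr
      have h8 : (loopStep ord S c).val.rows * (n * 2) ≤ B * (n * 2) := by gcongr
      have h9 : (Counted.loop (loopStep ord) S (c :: l)).cost = (loopStep ord S c).cost +
          (Counted.loop (loopStep ord) (loopStep ord S c).val l).cost := rfl
      rw [h9, List.length_cons, add_mul, one_mul]
      have h10 : B * (B * 8) = 8 * B * B := by ring
      have h11 : B * (n * 2) = 2 * B * n := by ring
      omega

end Correctness

/-! ### Correctness and cost of the divide-and-conquer recursion -/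

section PadeCorrectness

variable {K : Type*} [Field K] {m n k : ℕ} {ord : ModMonOrder m}
  {F : Matrix (Fin m) (Fin n) (BiRing K)}
  {M : Submodule (BiRing K) (Fin m → BiRing K)} {P : Matrix (Fin k) (Fin m) (BiRing K)}
  {LM : Fin k → Mon m} {s t d e : ℕ}

/-- Correctness and cost of a run of Algorithm `Padé` that refines the Gröbner basis `P` of `M`
to the submodule of the `p ∈ M` with `p F = 0` modulo `⟨X^(s+d), Y^(t+e)⟩`. -/
structure PadeSpec (R : MulRoutine K) (ord : ModMonOrder m) (F : Matrix (Fin m) (Fin n) (BiRing K))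
    (M : Submodule (BiRing K) (Fin m → BiRing K)) (P : Matrix (Fin k) (Fin m) (BiRing K))
    (LM : Fin k → Mon m) (s t d e : ℕ) (O : Counted (PadeOutput K m k (d + 1) (e + 1))) :
    Prop where
  lead : ∀ i, Lead ord LM (polyMat O.val.mat i) (O.val.LM i)
  good : Good ord (M ⊓ syzOn F (s + d) (t + e) Set.univ) (polyMat O.val.mat * P) O.val.LM
  cost : ∀ D E B τ : ℕ, s + d ≤ D → t + e ≤ E → syzOn F D E Set.univ ≤ M →
    m * (min D E + 1) ≤ B →
    (∀ k l c a b, k ≤ B → l ≤ B → (c = n ∨ c ≤ B) → a ≤ D + 1 → b ≤ E + 1 →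
      (R k l c a b).size ≤ τ * (a * b)) →
    O.cost ≤ d * e * (n * (3 * B + 8 * B * B + 2 * B * n) + 5 * τ * (Nat.clog 2 d + Nat.clog 2 e))

theorem padeOne_spec (R : MulRoutine K) (h : Good ord M P LM) {a b : ℕ}
    (G : Fin k → Fin n → BPoly K a b) (hc : Cong F s t 1 1 P (polyMat G)) :
    PadeSpec R ord F M P LM s t 1 1 (padeOne (FieldOps.counted K) G ord LM) := by
  let S₀ : LoopState K m k n :=
    { rows := k
      mat := fun i j ij => if i = j ∧ (ij.1 : ℕ) = 0 ∧ (ij.2 : ℕ) = 0 then 1 else 0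
      res := fun i j => (G i j).trunc 0 1 1
      LM := LM }
  have hmat : polyMat S₀.mat = 1 := by
    ext i j ν
    change (BPoly.toPoly (S₀.mat i j)).coeff ν = _
    rw [BPoly.coeff_toPoly, Matrix.one_apply]
    by_cases hij : i = j
    · rw [if_pos hij, MvPolynomial.coeff_one]
      have h0 : (0 : Fin 2 →₀ ℕ) = ν ↔ ν 0 = 0 ∧ ν 1 = 0 := by
        rw [eq_comm, DFunLike.ext_iff, Fin.forall_fin_two]
        rfl
      simp only [BPoly.coeffD, S₀, hij, true_and, h0]
      split_ifs <;> first | rfl | omega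
    · rw [if_neg hij]
      simp [BPoly.coeffD, S₀, hij]
  have hinit : LoopInv ord F M P LM s t (polyMat G) ∅ S₀ := by
    refine ⟨fun i => ?_, ?_, ?_⟩
    · rw [hmat, ← Matrix.diagonal_one, Matrix.diagonal]
      convert lead_single LM i using 1
      funext j
      simp [Pi.single_apply, eq_comm]
    · rw [hmat, Matrix.one_mul]
      have : M ⊓ syzOn F (s + 1) (t + 1) ∅ = M :=
        inf_eq_left.2 fun p _ => mem_syzOn.2 fun c hc' => absurd hc' (Set.notMem_empty c)
      rw [this]
      exact h
    · rw [hmat, Matrix.one_mul]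
      intro i c
      exact BPoly.toPoly_trunc_sub_mem (G i c) 1 1
  obtain ⟨h1, h2⟩ := LoopInv.loop h hc (List.finRange n) ∅ S₀ hinit
  have hA : (∅ : Set (Fin n)) ∪ {c | c ∈ List.finRange n} = Set.univ := by
    ext c; simp [List.mem_finRange]
  rw [hA] at h1
  refine ⟨h1.lead, h1.good, ?_⟩
  intro D E B τ hD hE hM hB _
  have hk : k ≤ B := (h.rows_le hM).trans hB
  have := h2 B hk fun A' S' hS' => (hS'.good.rows_le
    (le_inf hM ((syzOn_anti hD hE _).trans fun p hp => mem_syzOn.2 fun c _ =>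
      mem_syzOn.1 hp c trivial))).trans hB
  rw [List.length_finRange] at this
  change (Counted.loop (loopStep ord) S₀ (List.finRange n)).cost + 0 ≤ _
  simpa using this

/-- The rows from the first call lie in the smaller syzygy module, so the residual vanishes on the
first box and dividing it by the split variable's power is exact modulo `⟨X^d, Y^e⟩`. `hsplit`
covers the two directions of splitting: Y, with `ds = 0`, or X, with `dt = 0`. -/
theorem cong_second {R : MulRoutine K} (hR : R.IsCorrect) {d₁ e₁ d₂ e₂ ds dt : ℕ}
    (hsplit : (ds = 0 ∧ d₁ = d ∧ dt = e₁) ∨ (dt = 0 ∧ e₁ = e ∧ ds = d₁))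
    (hd : ds + d₂ = d) (he : dt + e₂ = e) (hd₁ : d₁ ≤ d) (he₁ : e₁ ≤ e)
    (G : Fin k → Fin n → BPoly K d e) (hc : Cong F s t d e P (polyMat G))
    {k' a b : ℕ} (Q : Fin k' → Fin k → BPoly K a b)
    (hQ : ∀ i, (polyMat Q * P) i ∈ syzOn F (s + d₁) (t + e₁) Set.univ) :
    Cong F (s + ds) (t + dt) d₂ e₂ (polyMat Q * P)
      (polyMat fun i j => ((matMul (FieldOps.counted K) R
        (fun i j => (Q i j).trunc 0 d e) G).val i j).divXY 0 ds dt d₂ e₂) := by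
  set H := (matMul (FieldOps.counted K) R (fun i j => (Q i j).trunc 0 d e) G).val with hH
  have h1 : EqMod d e (polyMat H) (polyMat Q * polyMat G) := by
    have h2 : EqMod d e (polyMat fun i j => (Q i j).trunc 0 d e) (polyMat Q) := fun i j =>
      BPoly.toPoly_trunc_sub_mem (Q i j) d e
    refine EqMod.trans (eqMod_of_coeff fun i c ν h0 h1 => ?_) (h2.mul (EqMod.refl (polyMat G)))
    have := coeff_matMul hR (fun i j => (Q i j).trunc 0 d e) G i c ν
    rw [if_pos ⟨h0, h1⟩] at this
    exact this
  have hcH : Cong F s t d e (polyMat Q * P) (polyMat H) := (hc.mul _).congr h1.symm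
  have hH₁ : ∀ i c, (H i c).toPoly ∈ padeIdeal K d₁ e₁ := fun i c =>
    (((hcH.mono hd₁ he₁).mem_syzOn_iff i Set.univ).1 (hQ i)) c trivial
  have hdiv : ∀ i c, (H i c).toPoly - MvPolynomial.monomial (expXY ds dt) 1 *
      ((H i c).divXY 0 ds dt d₂ e₂).toPoly ∈ padeIdeal K (ds + d₂) (dt + e₂) := by
    intro i c
    -- In the direction that is not split the shift is 0, so one of the two vanishing conditions is
    -- empty; the other is the vanishing on the first box.
    rcases hsplit with ⟨rfl, rfl, rfl⟩ | ⟨rfl, rfl, rfl⟩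
    · refine BPoly.toPoly_sub_divXY_mem _ (mem_padeIdeal.2 fun ν h0 _ => absurd h0 (by omega)) ?_
      rw [hd]
      exact hH₁ i c
    · refine BPoly.toPoly_sub_divXY_mem _ ?_ (mem_padeIdeal.2 fun ν _ h0 => absurd h0 (by omega))
      rw [he]
      exact hH₁ i c
  intro i c
  have h3 := hcH i c
  have h4 := monomial_mul_mem_padeIdeal (s := s) (t := t).2 (hdiv i c)
  rw [hd, he] at h4
  rw [mul_sub, ← mul_assoc, MvPolynomial.monomial_mul, one_mul,
    show expXY s t + expXY ds dt = expXY (s + ds) (t + dt) by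
      rw [← expXY_apply (expXY s t + expXY ds dt)]; simp] at h4
  have := (padeIdeal K _ _).add_mem h3 h4
  rw [show polyMat H i c = (H i c).toPoly from rfl, sub_add_sub_cancel] at this
  rw [add_assoc, add_assoc, hd, he]
  exact this

/-- Intersecting the two conditions gives the full one, and the product of the two transformations
is truncated by `Good.truncate`. For the cost, the areas add up (`hde`) while both halves have
logarithmic depth smaller by one, which leaves room for the two matrix products. `O₂` is given
beforehand, so the middle continuation ignores its argument. -/
theorem PadeSpec.compose {R : MulRoutine K} (hR : R.IsCorrect) {d₁ e₁ d₂ e₂ ds dt : ℕ}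
    (hd : ds + d₂ = d) (he : dt + e₂ = e) (hd₁ : d₁ ≤ d) (he₁ : e₁ ≤ e)
    (hde : d₁ * e₁ + d₂ * e₂ = d * e) (hd1 : 1 ≤ d) (he1 : 1 ≤ e)
    (hlog₁ : Nat.clog 2 d₁ + Nat.clog 2 e₁ + 1 ≤ Nat.clog 2 d + Nat.clog 2 e)
    (hlog₂ : Nat.clog 2 d₂ + Nat.clog 2 e₂ + 1 ≤ Nat.clog 2 d + Nat.clog 2 e)
    (h : Good ord M P LM) (G : Fin k → Fin n → BPoly K d e) (hc : Cong F s t d e P (polyMat G))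
    {O₁ : Counted (PadeOutput K m k (d₁ + 1) (e₁ + 1))}
    (h₁ : PadeSpec R ord F M P LM s t d₁ e₁ O₁)
    {O₂ : Counted (PadeOutput K m O₁.val.rows (d₂ + 1) (e₂ + 1))}
    (h₂ : PadeSpec R ord F (M ⊓ syzOn F (s + d₁) (t + e₁) Set.univ) (polyMat O₁.val.mat * P)
      O₁.val.LM (s + ds) (t + dt) d₂ e₂ O₂) :
    PadeSpec R ord F M P LM s t d e (O₁.bind fun O₁' =>
      (matMul (FieldOps.counted K) R (fun i j => (O₁'.mat i j).trunc 0 d e) G).bind fun _ =>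
      Counted.bind ⟨O₂.val, O₂.cost⟩ fun O₂' =>
      (matMul (FieldOps.counted K) R (fun i j => (O₂'.mat i j).trunc 0 (d + 1) (e + 1))
        (fun i j => (O₁.val.mat i j).trunc 0 (d + 1) (e + 1))).bind fun Γ =>
      .ret { rows := O₂'.rows, mat := Γ, LM := O₂'.LM }) := by
  have hinf : M ⊓ syzOn F (s + d₁) (t + e₁) Set.univ ⊓
      syzOn F (s + ds + d₂) (t + dt + e₂) Set.univ = M ⊓ syzOn F (s + d) (t + e) Set.univ := by
    rw [add_assoc, add_assoc, hd, he, inf_assoc,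
      inf_eq_right.2 (syzOn_anti (by omega) (by omega) _)]
  have hgood := h₂.good
  rw [hinf, ← Matrix.mul_assoc] at hgood
  have hlead : ∀ i, Lead ord LM ((polyMat O₂.val.mat * polyMat O₁.val.mat) i) (O₂.val.LM i) :=
    fun i => by
      rw [mul_row]
      exact (h₂.lead i).vecMul h₁.lead
  have hmem : ∀ j, ∀ f ∈ padeIdeal K d e, f • P j ∈ M ⊓ syzOn F (s + d) (t + e) Set.univ :=
    fun j f hf => ⟨M.smul_mem _ (h.mem j), hc.smul_mem_syzOn j _ hf⟩
  obtain ⟨h3, h4⟩ := h.truncate (fun j => hmem j _ X_zero_pow_mem)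
    (fun j => hmem j _ X_one_pow_mem) hlead hgood
    (Q' := polyMat (matMul (FieldOps.counted K) R
      (fun i j => (O₂.val.mat i j).trunc 0 (d + 1) (e + 1))
      (fun i j => (O₁.val.mat i j).trunc 0 (d + 1) (e + 1))).val) (by
      intro i j ν
      rw [polyMat, Matrix.of_apply, coeff_matMul hR, Matrix.mul_apply]
      simp only [BPoly.toPoly_eq_of_trunc_le _ (show d₁ + 1 ≤ d + 1 by omega)
        (show e₁ + 1 ≤ e + 1 by omega), BPoly.toPoly_eq_of_trunc_le _
        (show d₂ + 1 ≤ d + 1 by omega) (show e₂ + 1 ≤ e + 1 by omega)]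
      rfl)
  refine ⟨h3, h4, fun D E B τ hD hE hM hB hτ => ?_⟩
  have hk : k ≤ B := (h.rows_le hM).trans hB
  have hM₁ : syzOn F D E Set.univ ≤ M ⊓ syzOn F (s + d₁) (t + e₁) Set.univ :=
    le_inf hM (syzOn_anti (by omega) (by omega) _)
  have hk₁ : O₁.val.rows ≤ B := (h₁.good.rows_le hM₁).trans hB
  -- All modules met contain the syzygy module of the final order `(D, E)`, so a single `B` bounds
  -- the rows throughout the recursion.
  have hk₂ : O₂.val.rows ≤ B :=
    (hgood.rows_le (le_inf hM (syzOn_anti (by omega) (by omega) _))).trans hB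
  have c₁ := h₁.cost D E B τ (by omega) (by omega) hM hB hτ
  have c₂ := h₂.cost D E B τ (by omega) (by omega) hM₁ hB hτ
  have c₃ := hτ O₁.val.rows k n d e hk₁ hk (Or.inl rfl) (by omega) (by omega)
  have c₄ := hτ O₂.val.rows O₁.val.rows k (d + 1) (e + 1) hk₂ hk₁ (Or.inr hk) (by omega) (by omega)
  simp only [Counted.bind, Counted.ret, cost_matMul]
  obtain ⟨C, hC⟩ : ∃ C, Nat.clog 2 d + Nat.clog 2 e = C + 1 := ⟨_, by
    rw [Nat.sub_add_cancel]; omega⟩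
  rw [hC] at hlog₁ hlog₂ ⊢
  set β := n * (3 * B + 8 * B * B + 2 * B * n)
  have c₁' : O₁.cost ≤ d₁ * e₁ * (β + 5 * τ * C) := c₁.trans (by gcongr; omega)
  have c₂' : O₂.cost ≤ d₂ * e₂ * (β + 5 * τ * C) := c₂.trans (by gcongr; omega)
  -- The residual costs at most `τ d e` and the product of the transformations at most `τ (d+1)(e+1)
  -- ≤ 4 τ d e`; this is the factor 5 in `PadeSpec`.
  have c₄' : τ * ((d + 1) * (e + 1)) ≤ τ * ((d + d) * (e + e)) := by gcongr
  have c₅ : d * e * (β + 5 * τ * (C + 1)) = d₁ * e₁ * (β + 5 * τ * C) +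
      d₂ * e₂ * (β + 5 * τ * C) + τ * (d * e) + τ * ((d + d) * (e + e)) := by
    rw [← add_mul, hde]
    ring
  rw [c₅]
  omega

theorem pade_spec {R : MulRoutine K} (hR : R.IsCorrect) (N : ℕ) : ∀ (d e k : ℕ), d + e = N →
    1 ≤ d → 1 ≤ e → ∀ (M : Submodule (BiRing K) (Fin m → BiRing K))
    (P : Matrix (Fin k) (Fin m) (BiRing K)) (LM : Fin k → Mon m) (s t : ℕ)
    (G : Fin k → Fin n → BPoly K d e), Good ord M P LM → Cong F s t d e P (polyMat G) →
    PadeSpec R ord F M P LM s t d e (pade (FieldOps.counted K) R ord d e k G LM) := by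
  induction N using Nat.strong_induction_on with
  | _ N ih =>
    intro d e k hN hd he M P LM s t G h hc
    have htrunc : ∀ d' e', d' ≤ d → e' ≤ e →
        Cong F s t d' e' P (polyMat fun i j => (G i j).trunc 0 d' e') := fun d' e' hd' he' =>
      (hc.mono hd' he').congr
        (EqMod.symm fun i c => BPoly.toPoly_trunc_sub_mem (G i c) d' e')
    rw [pade]
    by_cases he' : 1 < e
    · rw [dif_pos he']
      -- The larger half governs the depth: halving with rounding up lowers the rounded-up binary
      -- logarithm by exactly one.
      have hlog : Nat.clog 2 e = Nat.clog 2 (e - e / 2) + 1 := by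
        rw [Nat.clog_of_two_le (by norm_num) (by omega)]
        congr 2
        omega
      have hlog' : Nat.clog 2 (e / 2) ≤ Nat.clog 2 (e - e / 2) := Nat.clog_mono_right _ (by omega)
      have h₁ := ih (d + e / 2) (by omega) d (e / 2) k rfl hd (by omega) M P LM s t _ h
        (htrunc d (e / 2) le_rfl (by omega))
      have hsplit : (0 = 0 ∧ d = d ∧ e / 2 = e / 2) ∨ (e / 2 = 0 ∧ e / 2 = e ∧ 0 = d) :=
        Or.inl ⟨rfl, rfl, rfl⟩
      have h₂ := ih (d + (e - e / 2)) (by omega) d (e - e / 2) _ rfl hd (by omega) _ _ _ (s + 0)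
        (t + e / 2) _ h₁.good (cong_second hR hsplit (by omega) (by omega) le_rfl (by omega) G hc _
          fun i => (h₁.good.mem i).2)
      exact PadeSpec.compose hR (by omega) (by omega) le_rfl (by omega)
        (by rw [← mul_add, Nat.add_sub_cancel' (Nat.div_le_self e 2)]) hd he (by omega) (by omega)
        h G hc h₁ h₂
    · rw [dif_neg he']
      obtain rfl : e = 1 := by omega
      by_cases hd' : 1 < d
      · rw [dif_pos hd']
        have hlog : Nat.clog 2 d = Nat.clog 2 (d - d / 2) + 1 := by
          rw [Nat.clog_of_two_le (by norm_num) (by omega)]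
          congr 2
          omega
        have hlog' : Nat.clog 2 (d / 2) ≤ Nat.clog 2 (d - d / 2) :=
          Nat.clog_mono_right _ (by omega)
        have h₁ := ih (d / 2 + 1) (by omega) (d / 2) 1 k rfl (by omega) le_rfl M P LM s t _ h
          (htrunc (d / 2) 1 (by omega) le_rfl)
        have hsplit : (d / 2 = 0 ∧ d / 2 = d ∧ 0 = 1) ∨ (0 = 0 ∧ 1 = 1 ∧ d / 2 = d / 2) :=
          Or.inr ⟨rfl, rfl, rfl⟩
        have h₂ := ih (d - d / 2 + 1) (by omega) (d - d / 2) 1 _ rfl (by omega) le_rfl _ _ _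
          (s + d / 2) (t + 0) _ h₁.good (cong_second hR hsplit (by omega) (by omega) (by omega)
          le_rfl G hc _ fun i => (h₁.good.mem i).2)
        exact PadeSpec.compose hR (by omega) (by omega) (by omega) le_rfl
          (by rw [← add_mul, Nat.add_sub_cancel' (Nat.div_le_self d 2)]) hd he (by omega)
          (by omega) h G hc h₁ h₂
      · rw [dif_neg hd']
        obtain rfl : d = 1 := by omega
        have h₁ := padeOne_spec R h G hc
        have heq : polyMat (fun i j => ((padeOne (FieldOps.counted K) G ord LM).val.mat i j).trunc 0
            (1 + 1) (1 + 1)) = polyMat (padeOne (FieldOps.counted K) G ord LM).val.mat := by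
          ext1 i j
          exact BPoly.toPoly_eq_of_trunc_le ((padeOne (FieldOps.counted K) G ord LM).val.mat i j)
            le_rfl le_rfl
        refine ⟨?_, ?_, h₁.cost⟩
        · have := h₁.lead
          rw [← heq] at this
          exact this
        · have := h₁.good
          rw [← heq] at this
          exact this

theorem good_one (ord : ModMonOrder m) :
    Good ord ⊤ (1 : Matrix (Fin m) (Fin m) (BiRing K)) (unitMon m) where
  mem _ := trivial
  lead i := by
    convert lead_single (K := K) (unitMon m) i using 1
    funext j
    simp [Matrix.one_apply, Pi.single_apply, eq_comm]
  anti i j hij h := hij (Mon.dvd_iff.1 h).2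
  dvd p _ μ _ := ⟨μ.2, μ.1, (mul_unitMon μ).symm⟩

theorem runPade_spec {R : MulRoutine K} (hR : R.IsCorrect) (ord : ModMonOrder m) (hd : 1 ≤ d)
    (he : 1 ≤ e) (F : Matrix (Fin m) (Fin n) (BiRing K)) :
    PadeSpec R ord F ⊤ 1 (unitMon m) 0 0 d e (runPade R ord d e F) := by
  refine pade_spec hR _ d e m rfl hd he ⊤ 1 _ 0 0 _ (good_one ord) fun i c => ?_
  rw [Matrix.one_mul, show expXY 0 0 = 0 by simp [expXY], ← MvPolynomial.C_apply, map_one, one_mul,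
    zero_add, zero_add, ← neg_sub]
  exact (padeIdeal K d e).neg_mem (BPoly.toPoly_ofPoly_sub_mem (F i c) d e)

theorem runPade_isMinimalGroebnerBasis {R : MulRoutine K} (hR : R.IsCorrect)
    (ord : ModMonOrder m) (hd : 1 ≤ d) (he : 1 ≤ e) (F : Matrix (Fin m) (Fin n) (BiRing K)) :
    IsMinimalGroebnerBasis ord (syzModule (padeModule K n d e) F)
      (runPade R ord d e F).val.toMatrix := by
  have := (runPade_spec hR ord hd he F).good
  rw [Matrix.mul_one, top_inf_eq, zero_add, zero_add, syzOn_univ] at this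
  exact this.isMinimalGroebnerBasis

end PadeCorrectness

/-! ## Functions computed by straight-line programs -/

section Reach

variable {K X : Type*} [Field K]

/-- The set `T` of functions is computed exactly by a straight-line program with `n` instructions
whose inputs are the functions in `S`. -/
inductive StraightLine (S : Set (X → K)) : ℕ → Set (X → K) → Prop
  | base : StraightLine S 0 (S ∪ Set.range fun c _ => c)
  | add {n T f g} : StraightLine S n T → f ∈ T → g ∈ T → StraightLine S (n + 1) (insert (f + g) T)
  | sub {n T f g} : StraightLine S n T → f ∈ T → g ∈ T → StraightLine S (n + 1) (insert (f - g) T)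
  | mul {n T f g} : StraightLine S n T → f ∈ T → g ∈ T → StraightLine S (n + 1) (insert (f * g) T)

variable {S S' T U : Set (X → K)} {n n' : ℕ}

theorem StraightLine.subset (h : StraightLine S n T) : S ⊆ T := by
  induction h with
  | base => exact Set.subset_union_left
  | add _ _ _ ih => exact ih.trans (Set.subset_insert _ _)
  | sub _ _ _ ih => exact ih.trans (Set.subset_insert _ _)
  | mul _ _ _ ih => exact ih.trans (Set.subset_insert _ _)

theorem StraightLine.const_mem (h : StraightLine S n T) (c : K) : (fun _ => c) ∈ T := by
  induction h with
  | base => exact Or.inr ⟨c, rfl⟩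
  | add _ _ _ ih => exact Or.inr ih
  | sub _ _ _ ih => exact Or.inr ih
  | mul _ _ _ ih => exact Or.inr ih

/-- Functions already computed may be offered as extra inputs. This is how programs are concatenated
without renumbering registers. -/
theorem StraightLine.enlarge (h : StraightLine S n T) (hS : S ⊆ S') :
    StraightLine S' n (S' ∪ T) := by
  induction h with
  | base =>
    rw [← Set.union_assoc, Set.union_eq_self_of_subset_right hS]
    exact .base
  | add _ hf hg ih => rw [Set.union_insert]; exact .add ih (Or.inr hf) (Or.inr hg)
  | sub _ hf hg ih => rw [Set.union_insert]; exact .sub ih (Or.inr hf) (Or.inr hg)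
  | mul _ hf hg ih => rw [Set.union_insert]; exact .mul ih (Or.inr hf) (Or.inr hg)

theorem StraightLine.trans (h : StraightLine S n T) (h' : StraightLine T n' U) :
    StraightLine S (n + n') U := by
  induction h' with
  | base =>
    rw [Set.union_eq_self_of_subset_right]
    · exact h
    · rintro _ ⟨c, rfl⟩
      exact h.const_mem c
  | add _ hf hg ih => exact .add ih hf hg
  | sub _ hf hg ih => exact .sub ih hf hg
  | mul _ hf hg ih => exact .mul ih hf hg

theorem StraightLine.comp {Y : Type*} (h : StraightLine S n T) (u : Y → X) :
    StraightLine ((fun f => f ∘ u) '' S) n ((fun f => f ∘ u) '' T) := by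
  induction h with
  | base =>
    rw [Set.image_union, ← Set.range_comp]
    exact .base
  | add _ hf hg ih =>
    rw [Set.image_insert_eq]
    exact .add ih (Set.mem_image_of_mem _ hf) (Set.mem_image_of_mem _ hg)
  | sub _ hf hg ih =>
    rw [Set.image_insert_eq]
    exact .sub ih (Set.mem_image_of_mem _ hf) (Set.mem_image_of_mem _ hg)
  | mul _ hf hg ih =>
    rw [Set.image_insert_eq]
    exact .mul ih (Set.mem_image_of_mem _ hf) (Set.mem_image_of_mem _ hg)

/-- The functions in `T` can be computed with at most `n` instructions from those in `S`. -/
def Reach (S : Set (X → K)) (n : ℕ) (T : Set (X → K)) : Prop :=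
  ∃ n' ≤ n, ∃ T', StraightLine S n' T' ∧ T ⊆ T'

theorem Reach.of_subset (h : T ⊆ S ∪ Set.range fun c _ => c) : Reach S 0 T :=
  ⟨0, le_rfl, _, .base, h⟩

theorem Reach.mono (h : Reach S n T) (hn : n ≤ n') (hS : S ⊆ S') (hT : U ⊆ T) : Reach S' n' U := by
  obtain ⟨i, hi, T', hT', hTT'⟩ := h
  exact ⟨i, hi.trans hn, _, hT'.enlarge hS, (hT.trans hTT').trans Set.subset_union_right⟩

theorem Reach.trans (h : Reach S n T) (h' : Reach T n' U) : Reach S (n + n') U := by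
  obtain ⟨i, hi, T', hT', hTT'⟩ := h
  obtain ⟨j, hj, U', hU', hUU'⟩ := h'
  exact ⟨i + j, by omega, _, hT'.trans (hU'.enlarge hTT'), hUU'.trans Set.subset_union_right⟩

theorem Reach.union (h : Reach S n T) (h' : Reach S n' U) : Reach S (n + n') (T ∪ U) := by
  obtain ⟨i, hi, T', hT', hTT'⟩ := h
  obtain ⟨j, hj, U', hU', hUU'⟩ := h'
  exact ⟨i + j, by omega, _, hT'.trans (hU'.enlarge hT'.subset),
    Set.union_subset_union hTT' hUU'⟩

theorem Reach.iUnion {ι : Type*} (s : Finset ι) {n : ι → ℕ} {T : ι → Set (X → K)}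
    (h : ∀ i ∈ s, Reach S (n i) (T i)) : Reach S (∑ i ∈ s, n i) (⋃ i ∈ s, T i) := by
  classical
  induction s using Finset.induction_on with
  | empty => exact Reach.of_subset (by simp)
  | insert a s ha ih =>
    rw [Finset.sum_insert ha, Finset.set_biUnion_insert]
    exact (h a (Finset.mem_insert_self _ _)).union
      (ih fun i hi => h i (Finset.mem_insert_of_mem hi))

theorem Reach.comp {Y : Type*} (h : Reach S n T) (u : Y → X) :
    Reach ((fun f => f ∘ u) '' S) n ((fun f => f ∘ u) '' T) := by
  obtain ⟨i, hi, T', hT', hTT'⟩ := h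
  exact ⟨i, hi, _, hT'.comp u, Set.image_mono hTT'⟩

theorem Reach.add {f g : X → K} (hf : Reach S n {f}) (hg : Reach S n' {g}) :
    Reach S (n + n' + 1) {f + g} := by
  obtain ⟨i, hi, T', hT', hTT'⟩ := hf.union hg
  exact ⟨i + 1, by omega, _, .add hT' (hTT' (Or.inl rfl)) (hTT' (Or.inr rfl)),
    Set.singleton_subset_iff.2 (Set.mem_insert _ _)⟩

theorem Reach.sub {f g : X → K} (hf : Reach S n {f}) (hg : Reach S n' {g}) :
    Reach S (n + n' + 1) {f - g} := by
  obtain ⟨i, hi, T', hT', hTT'⟩ := hf.union hg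
  exact ⟨i + 1, by omega, _, .sub hT' (hTT' (Or.inl rfl)) (hTT' (Or.inr rfl)),
    Set.singleton_subset_iff.2 (Set.mem_insert _ _)⟩

theorem Reach.mul {f g : X → K} (hf : Reach S n {f}) (hg : Reach S n' {g}) :
    Reach S (n + n' + 1) {f * g} := by
  obtain ⟨i, hi, T', hT', hTT'⟩ := hf.union hg
  exact ⟨i + 1, by omega, _, .mul hT' (hTT' (Or.inl rfl)) (hTT' (Or.inr rfl)),
    Set.singleton_subset_iff.2 (Set.mem_insert _ _)⟩

theorem Reach.sum {ι : Type*} (s : Finset ι) {f : ι → X → K} (h : ∀ i ∈ s, f i ∈ S) :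
    Reach S s.card {∑ i ∈ s, f i} := by
  classical
  induction s using Finset.induction_on with
  | empty => exact Reach.of_subset (by rintro _ rfl; exact Or.inr ⟨0, by simp; rfl⟩)
  | insert a s ha ih =>
    rw [Finset.sum_insert ha, Finset.card_insert_of_notMem ha, ← zero_add s.card]
    refine Reach.add (Reach.of_subset ?_) (ih fun i hi => h i (Finset.mem_insert_of_mem hi))
    exact Set.singleton_subset_iff.2 (Or.inl (h a (Finset.mem_insert_self _ _)))

end Reach

/-! ### Cost of maps between coefficient arrays, and translation to circuits -/

section Computes

variable {K α β γ ι : Type*} [Field K]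

/-- The map `f` can be computed by a straight-line program with at most `n` instructions. -/
def Computes (f : (α → K) → β → K) (n : ℕ) : Prop :=
  Reach (Set.range fun a (x : α → K) => x a) n (Set.range fun b x => f x b)

theorem Computes.reach {X : Type*} {f : (α → K) → β → K} {n : ℕ} (h : Computes f n)
    (u : X → α → K) :
    Reach (Set.range fun a x => u x a) n (Set.range fun b x => f (u x) b) := by
  have := Reach.comp h u
  rwa [← Set.range_comp, ← Set.range_comp] at this

theorem Computes.mono {f : (α → K) → β → K} {n n' : ℕ} (h : Computes f n) (hn : n ≤ n') :
    Computes f n' :=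
  Reach.mono h hn subset_rfl subset_rfl

theorem Computes.comp {f : (α → K) → β → K} {g : (β → K) → γ → K} {n n' : ℕ}
    (hg : Computes g n') (hf : Computes f n) : Computes (fun x => g (f x)) (n + n') :=
  Reach.trans hf (hg.reach f)

theorem Computes.of_coord {f : (α → K) → β → K}
    (h : ∀ b, (∃ a, ∀ x, f x b = x a) ∨ ∃ c, ∀ x, f x b = c) : Computes f 0 := by
  refine Reach.of_subset ?_
  rintro _ ⟨b, rfl⟩
  rcases h b with ⟨a, ha⟩ | ⟨c, hc⟩
  · exact Or.inl ⟨a, by funext x; exact (ha x).symm⟩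
  · exact Or.inr ⟨c, by funext x; exact (hc x).symm⟩

theorem Computes.reindex (σ : β → α) : Computes (fun (x : α → K) b => x (σ b)) 0 :=
  .of_coord fun b => Or.inl ⟨σ b, fun _ => rfl⟩

/-- Independent computations with the same inputs. -/
theorem Computes.prod [Fintype ι] {f : ι → (α → K) → β → K} {n : ι → ℕ}
    (h : ∀ i, Computes (f i) (n i)) :
    Computes (fun x (ib : ι × β) => f ib.1 x ib.2) (∑ i, n i) := by
  refine Reach.mono (Reach.iUnion Finset.univ fun i _ => h i) le_rfl subset_rfl ?_
  rintro _ ⟨⟨i, b⟩, rfl⟩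
  exact Set.mem_biUnion (Finset.mem_univ i) ⟨b, rfl⟩

/-- Independent computations with separate inputs. -/
theorem Computes.map [Fintype ι] {f : ι → (α → K) → β → K} {n : ι → ℕ}
    (h : ∀ i, Computes (f i) (n i)) :
    Computes (fun (x : ι × α → K) (ib : ι × β) => f ib.1 (fun a => x (ib.1, a)) ib.2)
      (∑ i, n i) := by
  have := Computes.prod (f := fun i (x : ι × α → K) => f i fun a => x (i, a)) (n := n) fun i => by
    simpa using (h i).comp (Computes.reindex (K := K) fun a => (i, a))
  exact this

theorem Computes.sumElim {α' β' : Type*} {f : (α → K) → β → K} {g : (α' → K) → β' → K} {n n' : ℕ}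
    (hf : Computes f n) (hg : Computes g n') :
    Computes (fun (x : α ⊕ α' → K) => Sum.elim (f fun a => x (Sum.inl a))
      (g fun a => x (Sum.inr a))) (n + n') := by
  have h1 := hf.comp (Computes.reindex (K := K) (Sum.inl : α → α ⊕ α'))
  have h2 := hg.comp (Computes.reindex (K := K) (Sum.inr : α' → α ⊕ α'))
  rw [zero_add] at h1 h2
  refine Reach.mono (Reach.union h1 h2) le_rfl subset_rfl ?_
  rintro _ ⟨b | b, rfl⟩
  · exact Or.inl ⟨b, rfl⟩
  · exact Or.inr ⟨b, rfl⟩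

theorem Computes.of_reach [Fintype β] {f : (α → K) → β → K} {n : β → ℕ}
    (h : ∀ b, Reach (Set.range fun a (x : α → K) => x a) (n b) {fun x => f x b}) :
    Computes f (∑ b, n b) := by
  refine Reach.mono (Reach.iUnion Finset.univ fun b _ => h b) le_rfl subset_rfl ?_
  rintro _ ⟨b, rfl⟩
  exact Set.mem_biUnion (Finset.mem_univ b) rfl

theorem Computes.sum [Fintype β] (A : β → Finset α) :
    Computes (fun (x : α → K) b => ∑ a ∈ A b, x a) (∑ b, (A b).card) := by
  refine Computes.of_reach fun b => ?_
  have := Reach.sum (A b) (f := fun a (x : α → K) => x a)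
    (S := Set.range fun a (x : α → K) => x a) fun a _ => ⟨a, rfl⟩
  convert this using 2
  funext x
  simp

theorem Computes.sum_reindex [Fintype β] [Fintype γ] (σ : β → γ → α) :
    Computes (fun (x : α → K) b => ∑ c, x (σ b c)) (Fintype.card β * Fintype.card γ) := by
  have := Computes.of_reach (f := fun (x : α → K) b => ∑ c, x (σ b c))
    (n := fun _ => Fintype.card γ) fun b => by
      have := Reach.sum Finset.univ (f := fun c (x : α → K) => x (σ b c))
        (S := Set.range fun a (x : α → K) => x a) fun c _ => ⟨σ b c, rfl⟩
      rw [Finset.card_univ] at this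
      convert this using 2
      funext x
      simp
  simpa using this

theorem reach_coord (a : α) : Reach (Set.range fun a (x : α → K) => x a) 0 {fun x => x a} :=
  Reach.of_subset (Set.singleton_subset_iff.2 (Or.inl ⟨a, rfl⟩))

theorem Computes.const_mul_sub [Fintype β] (c : K) (σ τ : β → α) :
    Computes (fun (x : α → K) b => c * (x (σ b) - x (τ b))) (Fintype.card β * 2) := by
  have := Computes.of_reach (f := fun (x : α → K) b => c * (x (σ b) - x (τ b))) (n := fun _ => 2)
    fun b => (Reach.of_subset (Set.singleton_subset_iff.2 (Or.inr ⟨c, rfl⟩))).mul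
      ((reach_coord (σ b)).sub (reach_coord (τ b)))
  simpa using this

theorem Operand.eval_append {A : Type*} [CommRing A] [Algebra K A] (x : α → A) (regs regs' : List A)
    (w : Operand K α) (hw : ∀ t, w = .reg t → t < regs.length) :
    w.eval x (regs ++ regs') = w.eval x regs := by
  cases w with
  | const c => rfl
  | input i => rfl
  | reg t => exact List.getD_append _ _ _ _ (hw t rfl)

/-- The results of the instructions of a straight-line program. -/
def runCode {A : Type*} [CommRing A] [Algebra K A] (x : α → A) (code : List (Instr K α)) : List A :=
  code.foldl (fun regs I => regs ++ [I.eval x regs]) []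

theorem runCode_append {A : Type*} [CommRing A] [Algebra K A] (x : α → A) (code : List (Instr K α))
    (I : Instr K α) : runCode x (code ++ [I]) = runCode x code ++ [I.eval x (runCode x code)] := by
  simp [runCode]

theorem length_runCode {A : Type*} [CommRing A] [Algebra K A] (x : α → A)
    (code : List (Instr K α)) : (runCode x code).length = code.length := by
  induction code using List.reverseRecOn with
  | nil => rfl
  | append_singleton code I ih => rw [runCode_append]; simp [ih]

/-- Turns the set-based description into actual code: each computed function gets an operand.
Bounding its register number ensures that appending an instruction does not change its value. -/
theorem StraightLine.exists_code {T : Set ((α → K) → K)} {n : ℕ}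
    (h : StraightLine (Set.range fun a (x : α → K) => x a) n T) :
    ∃ code : List (Instr K α), code.length = n ∧ ∀ f ∈ T, ∃ w : Operand K α,
      (∀ t, w = .reg t → t < n) ∧ ∀ x, w.eval x (runCode x code) = f x := by
  have key : ∀ (n : ℕ) (T : Set ((α → K) → K)) (f g : (α → K) → K) (op : ArithOp)
      (F : (α → K) → K), f ∈ T → g ∈ T →
      (∃ code : List (Instr K α), code.length = n ∧ ∀ f ∈ T, ∃ w : Operand K α,
        (∀ t, w = .reg t → t < n) ∧ ∀ x, w.eval x (runCode x code) = f x) →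
      (∀ (l r : Operand K α) x regs, l.eval x regs = f x → r.eval x regs = g x →
        (Instr.mk op l r).eval x regs = F x) →
      ∃ code : List (Instr K α), code.length = n + 1 ∧ ∀ f ∈ insert F T, ∃ w : Operand K α,
        (∀ t, w = .reg t → t < n + 1) ∧ ∀ x, w.eval x (runCode x code) = f x := by
    rintro n T f g op F hf hg ⟨code, hlen, hcode⟩ hF
    obtain ⟨l, hl, hlx⟩ := hcode f hf
    obtain ⟨r, hr, hrx⟩ := hcode g hg
    refine ⟨code ++ [⟨op, l, r⟩], by simp [hlen], ?_⟩
    rintro p (rfl | hp)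
    -- Registers are numbered from 0, so the result of the instruction appended to `n` others is
    -- number `n`.
    · refine ⟨.reg n, fun t ht => ?_, fun x => ?_⟩
      · injection ht with ht
        omega
      · rw [runCode_append, hF l r x _ (hlx x) (hrx x)]
        simp [Operand.eval, ← hlen, ← length_runCode x code]
    · obtain ⟨w, hw, hwx⟩ := hcode p hp
      refine ⟨w, fun t ht => (hw t ht).trans (Nat.lt_succ_self n), fun x => ?_⟩
      rw [runCode_append, Operand.eval_append _ _ _ _ fun t ht => ?_, hwx]
      rw [length_runCode, hlen]
      exact hw t ht
  induction h with
  | base =>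
    refine ⟨[], rfl, ?_⟩
    rintro f (⟨a, rfl⟩ | ⟨c, rfl⟩)
    · exact ⟨.input a, by simp, fun x => rfl⟩
    · exact ⟨.const c, by simp, fun x => rfl⟩
  | add _ hf hg ih =>
    exact key _ _ _ _ .add _ hf hg ih fun l r x regs h1 h2 => by simp [Instr.eval, h1, h2]
  | sub _ hf hg ih =>
    exact key _ _ _ _ .sub _ hf hg ih fun l r x regs h1 h2 => by simp [Instr.eval, h1, h2]
  | mul _ hf hg ih =>
    exact key _ _ _ _ .mul _ hf hg ih fun l r x regs h1 h2 => by simp [Instr.eval, h1, h2]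

theorem Computes.exists_circuit {f : (α → K) → β → K} {n : ℕ} (h : Computes f n) :
    ∃ c : Circuit K α β, c.size ≤ n ∧ ∀ x, c.eval x = f x := by
  obtain ⟨n', hn', T, hT, hfT⟩ := h
  obtain ⟨code, hlen, hcode⟩ := hT.exists_code
  choose w _ hwx using fun b => hcode _ (hfT ⟨b, rfl⟩)
  refine ⟨⟨code, w⟩, hlen.trans_le hn', fun x => ?_⟩
  funext b
  exact hwx b x

/-- The converse translation, used for the given programs for matrix multiplication. A reference to
a register not yet filled reads as 0, which is a constant and so costs nothing. -/
theorem Circuit.computes (c : Circuit K α β) : Computes (fun x : α → K => (c.eval x : β → K)) c.size := by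
  have key : ∀ code : List (Instr K α), ∃ T,
      StraightLine (Set.range fun a (x : α → K) => x a) code.length T ∧
      ∀ w : Operand K α, (fun x => w.eval x (runCode x code)) ∈ T := by
    intro code
    induction code using List.reverseRecOn with
    | nil =>
      refine ⟨_, .base, fun w => ?_⟩
      cases w with
      | const c => exact Or.inr ⟨c, rfl⟩
      | input i => exact Or.inl ⟨i, rfl⟩
      | reg t => exact Or.inr ⟨0, by funext x; simp [Operand.eval, runCode]⟩
    | append_singleton code I ih =>
      obtain ⟨T, hT, hw⟩ := ih
      have hI : ∃ T', StraightLine (Set.range fun a (x : α → K) => x a) (code.length + 1) T' ∧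
          T ⊆ T' ∧ (fun x => I.eval x (runCode x code)) ∈ T' := by
        rcases I with ⟨_ | _ | _, l, r⟩
        · exact ⟨_, .add hT (hw l) (hw r), Set.subset_insert _ _, Set.mem_insert _ _⟩
        · exact ⟨_, .sub hT (hw l) (hw r), Set.subset_insert _ _, Set.mem_insert _ _⟩
        · exact ⟨_, .mul hT (hw l) (hw r), Set.subset_insert _ _, Set.mem_insert _ _⟩
      obtain ⟨T', hT', hTT', hIT'⟩ := hI
      refine ⟨T', by simpa using hT', fun w => ?_⟩
      simp only [runCode_append]
      by_cases hreg : ∃ t, w = .reg t ∧ code.length ≤ t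
      · obtain ⟨t, rfl, ht⟩ := hreg
        rcases ht.eq_or_lt with rfl | ht
        · convert hIT' using 2 with x
          simp [Operand.eval, ← length_runCode x code]
        · convert hT'.const_mem 0 using 2 with x
          rw [Operand.eval, List.getD_eq_default]
          simp only [List.length_append, length_runCode, List.length_singleton]
          omega
      · push Not at hreg
        convert hTT' (hw w) using 2 with x
        refine Operand.eval_append _ _ _ _ fun t ht => ?_
        rw [length_runCode]
        exact hreg t ht
  obtain ⟨T, hT, hw⟩ := key c.code
  refine ⟨c.code.length, le_rfl, T, hT, ?_⟩
  rintro _ ⟨b, rfl⟩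
  exact hw (c.out b)

end Computes

/-! ## Fast convolution -/

section FastFourierTransform

variable {K : Type*} [Field K]

/-- The fast Fourier transform over the group algebra of `G`, with an element of `G` as the root of
unity; its multiplications are translations of `G`. -/
theorem computes_fft {G : Type*} [AddCommGroup G] [Fintype G] {s : ℕ} (hs : 0 < s) (l : ℕ) :
    ∀ a : G, s ^ l • a = 0 → Computes (fun (z : Fin (s ^ l) × G → K) (p : Fin (s ^ l) × G) =>
      ∑ v : Fin (s ^ l), z (v, p.2 - ((p.1 : ℕ) * v) • a)) (l * s * (s ^ l * Fintype.card G)) := by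
  induction l with
  | zero =>
    intro a _
    rw [zero_mul, zero_mul]
    refine .of_coord fun p => Or.inl ⟨((0 : Fin 1), p.2), fun z => ?_⟩
    change ∑ v : Fin 1, z (v, p.2 - ((p.1 : ℕ) * v) • a) = _
    simp
  | succ l ih =>
    intro a ha
    have hsa : s ^ l • (s • a) = 0 := by rw [smul_smul, ← pow_succ, ha]
    have hpos : 0 < s ^ l := pow_pos hs l
    -- Decimation by residue modulo `s`: writing the summation index as `c + s v` leaves `s`
    -- transforms of length s^l with root `s • a`.
    let e : Fin (s ^ l) × Fin s ≃ Fin (s ^ (l + 1)) := finProdFinEquiv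
    have he : ∀ v c, (e (v, c) : ℕ) = c + s * v := fun _ _ => rfl
    have h1 := Computes.reindex (K := K) fun q : Fin s × Fin (s ^ l) × G => (e (q.2.1, q.1), q.2.2)
    have h2 := Computes.map (ι := Fin s) fun _ => ih (s • a) hsa
    have h3 := Computes.sum_reindex (K := K) fun (p : Fin (s ^ (l + 1)) × G) (c : Fin s) =>
      (c, (⟨p.1 % s ^ l, Nat.mod_lt _ hpos⟩ : Fin (s ^ l)), p.2 - ((p.1 : ℕ) * c) • a)
    have h4 := h3.comp (h2.comp h1)
    convert h4 using 1
    · funext z p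
      rw [← Equiv.sum_comp e, Fintype.sum_prod_type_right]
      refine Finset.sum_congr rfl fun c _ => Finset.sum_congr rfl fun v _ => ?_
      -- The smaller transforms have period s^l in the output index, because s^l kills `s • a`.
      have hmod : ((p.1 : ℕ) % s ^ l * v) • (s • a) = ((p.1 : ℕ) * v) • (s • a) := by
        conv_rhs => rw [← Nat.mod_add_div p.1 (s ^ l)]
        rw [add_mul, add_smul, mul_assoc, mul_comm (s ^ l), mul_smul _ (s ^ l), hsa, smul_zero,
          add_zero]
      simp only [he]
      rw [hmod, sub_sub, smul_smul, ← add_smul]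
      congr 4
      ring
    · simp only [Finset.sum_const, Finset.card_univ, Fintype.card_prod, Fintype.card_fin, smul_eq_mul]
      ring

/-- The cyclic convolution of length `h`. -/
def cconv {h : ℕ} [NeZero h] (f g : ZMod h → K) : ZMod h → K := fun i => ∑ j, f j * g (i - j)

/-- Cyclic convolution of length `h` has a bilinear algorithm with `r` products whose linear maps
can be computed in `q` instructions each. -/
def FastConv (K : Type*) [Field K] (h r q : ℕ) [NeZero h] : Prop :=
  ∃ (ι : Type) (_ : Fintype ι) (A B : (ZMod h → K) →ₗ[K] (ι → K)) (C : (ι → K) →ₗ[K] (ZMod h → K)),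
    Fintype.card ι ≤ r ∧ Computes A q ∧ Computes B q ∧ Computes C q ∧
      ∀ f g, C (A f * B g) = cconv f g

theorem FastConv.mono {h r q r' q' : ℕ} [NeZero h] (H : FastConv K h r q) (hr : r ≤ r')
    (hq : q ≤ q') : FastConv K h r' q' := by
  obtain ⟨ι, hι, A, B, C, hc, hA, hB, hC, H⟩ := H
  exact ⟨ι, hι, A, B, C, hc.trans hr, hA.mono hq, hB.mono hq, hC.mono hq, H⟩

theorem cconv_eq_sum {h : ℕ} [NeZero h] (f g : ZMod h → K) (j : ZMod h) :
    cconv f g j = ∑ x, ∑ y, f x * g y * if x + y = j then 1 else 0 := by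
  refine Finset.sum_congr rfl fun x _ => ?_
  rw [Finset.sum_eq_single (j - x)]
  · simp
  · intro y _ hy
    rw [if_neg, mul_zero]
    rintro rfl
    simp at hy
  · simp

theorem sum_card_fiber {α β : Type*} [Fintype α] [Fintype β] [DecidableEq β] (τ : α → β) :
    ∑ b, (Finset.univ.filter fun a => τ a = b).card = Fintype.card α := by
  rw [← Finset.card_univ, Finset.card_eq_sum_card_fiberwise (f := τ) (t := Finset.univ) (by simp)]

theorem sum_card_fiber_le {α β : Type*} [Fintype α] [Fintype β] [DecidableEq β] (τ : α → β)
    (p : α → Prop) [DecidablePred p] :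
    ∑ b, (Finset.univ.filter fun a => p a ∧ τ a = b).card ≤ Fintype.card α := by
  rw [← sum_card_fiber τ]
  refine Finset.sum_le_sum fun b _ => Finset.card_le_card fun a => ?_
  simp

/-- The classical algorithm. -/
theorem fastConv_naive (h : ℕ) [NeZero h] : FastConv K h (h * h) (h * h) := by
  refine ⟨ZMod h × ZMod h, inferInstance, LinearMap.funLeft K K Prod.fst,
    LinearMap.funLeft K K Prod.snd,
    { toFun := fun w j => ∑ p ∈ Finset.univ.filter fun p : ZMod h × ZMod h => p.1 + p.2 = j, w p
      map_add' := fun w w' => by funext j; simp [Finset.sum_add_distrib]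
      map_smul' := fun c w => by funext j; simp [Finset.mul_sum] },
    by simp [ZMod.card], (Computes.reindex _).mono (Nat.zero_le _),
    (Computes.reindex _).mono (Nat.zero_le _), ?_, fun f g => ?_⟩
  · have := Computes.sum (K := K) fun j : ZMod h =>
      Finset.univ.filter fun p : ZMod h × ZMod h => p.1 + p.2 = j
    refine this.mono ?_
    rw [sum_card_fiber]
    simp [ZMod.card]
  · funext j
    rw [cconv_eq_sum, ← Fintype.sum_prod_type']
    simp [Finset.sum_filter, LinearMap.funLeft]

/-! ### Two-dimensional arrays and Fourier transforms with group elements as roots of unity -/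

section Recursion

/-- The position of the index `x = u + m v` in a two-dimensional array. -/
def splitIndex (m h : ℕ) {H : ℕ} (x : ZMod H) : ZMod h × ZMod h := ((x.val / m : ℕ), (x.val % m : ℕ))

/-- The inverse of `splitIndex`. -/
def joinIndex (m : ℕ) {h : ℕ} (H : ℕ) (p : ZMod h × ZMod h) : ZMod H := (p.2.val + m * p.1.val : ℕ)

/-- The two-dimensional array of the entries of `f`, padded by zeros. -/
def padArray (K : Type*) [Field K] (m b h H : ℕ) : (ZMod H → K) →ₗ[K] (ZMod h × ZMod h → K) where
  toFun f p := if p.2.val < m ∧ p.1.val < b then f (joinIndex m H p) else 0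
  map_add' f g := by funext p; simp only [Pi.add_apply]; split_ifs <;> simp
  map_smul' c f := by funext p; simp only [Pi.smul_apply, RingHom.id_apply]; split_ifs <;> simp

variable {h m b H : ℕ}

theorem computes_padArray : Computes (padArray K m b h H) 0 := by
  refine .of_coord fun p => ?_
  by_cases hp : p.2.val < m ∧ p.1.val < b
  · exact Or.inl ⟨joinIndex m H p, fun f => if_pos hp⟩
  · exact Or.inr ⟨0, fun f => if_neg hp⟩

variable [NeZero H]

theorem div_lt_of_splitIndex (hm : 0 < m) (hH : H = m * b)
    (x : ZMod H) : x.val / m < b := by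
  rw [Nat.div_lt_iff_lt_mul hm, mul_comm, ← hH]
  exact ZMod.val_lt x

theorem val_splitIndex (hm : 0 < m) (hH : H = m * b) (hmh : m ≤ h) (hbh : b ≤ h)
    (x : ZMod H) :
    (splitIndex m h x).1.val = x.val / m ∧ (splitIndex m h x).2.val = x.val % m := by
  have h1 := div_lt_of_splitIndex hm hH x
  have h2 := Nat.mod_lt x.val hm
  exact ⟨ZMod.val_cast_of_lt (by omega), ZMod.val_cast_of_lt (by omega)⟩

theorem joinIndex_splitIndex (hm : 0 < m) (hH : H = m * b) (hmh : m ≤ h) (hbh : b ≤ h) (x : ZMod H) :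
    joinIndex m H (splitIndex m h x) = x := by
  obtain ⟨h1, h2⟩ := val_splitIndex hm hH hmh hbh x
  rw [joinIndex, h1, h2, Nat.mod_add_div, ZMod.natCast_zmod_val]

theorem val_add_splitIndex (hm : 0 < m) (hH : H = m * b) (hmh : 2 * m ≤ h) (hbh : 2 * b ≤ h)
    (x y : ZMod H) : (splitIndex m h x + splitIndex m h y).2.val = x.val % m + y.val % m ∧
      (splitIndex m h x + splitIndex m h y).1.val = x.val / m + y.val / m := by
  obtain ⟨h1, h2⟩ := val_splitIndex (h := h) hm hH (by omega) (by omega) x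
  obtain ⟨h3, h4⟩ := val_splitIndex (h := h) hm hH (by omega) (by omega) y
  have h5 := Nat.mod_lt x.val hm
  have h6 := Nat.mod_lt y.val hm
  have h7 := div_lt_of_splitIndex hm hH x
  have h8 := div_lt_of_splitIndex hm hH y
  constructor
  · rw [Prod.snd_add, ZMod.val_add_of_lt, h2, h4]
    omega
  · rw [Prod.fst_add, ZMod.val_add_of_lt, h1, h3]
    omega

/-- The array has room for sums of indices without wrapping in either coordinate, so a convolution
of arrays computes the one-dimensional convolution after reassembly, where carries and reduction
modulo `H` take place. -/
theorem joinIndex_add_splitIndex (hm : 0 < m) (hH : H = m * b) (hmh : 2 * m ≤ h) (hbh : 2 * b ≤ h)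
    (x y : ZMod H) : joinIndex m H (splitIndex m h x + splitIndex m h y) = x + y := by
  obtain ⟨h1, h2⟩ := val_add_splitIndex hm hH hmh hbh x y
  rw [joinIndex, h1, h2]
  have : x.val % m + y.val % m + m * (x.val / m + y.val / m) = x.val + y.val := by
    have h3 := Nat.mod_add_div x.val m
    have h4 := Nat.mod_add_div y.val m
    rw [mul_add]
    omega
  rw [this, Nat.cast_add, ZMod.natCast_zmod_val, ZMod.natCast_zmod_val]

variable [NeZero h]

/-- The discrete Fourier transform over the group algebra of `ℤ/h`. -/
def dft (h : ℕ) [NeZero h] : (ZMod h × ZMod h → K) →ₗ[K] (ZMod h × ZMod h → K) where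
  toFun z p := ∑ v, z (v, p.2 - p.1 * v)
  map_add' z z' := by funext p; simp [Finset.sum_add_distrib]
  map_smul' c z := by funext p; simp [Finset.mul_sum]

theorem computes_dft {s l : ℕ} (hs : 0 < s) [NeZero (s ^ l)] :
    Computes (dft (K := K) (s ^ l)) (l * s * (s ^ l * s ^ l)) := by
  let e : Fin (s ^ l) ≃ ZMod (s ^ l) := (ZMod.finEquiv (s ^ l)).toEquiv
  have he : ∀ i : Fin (s ^ l), ((i : ℕ) : ZMod (s ^ l)) = e i := fun i => by
    have : ∀ (n : ℕ) [NeZero n] (i : Fin n), (((i : Fin n) : ℕ) : ZMod n) = ZMod.finEquiv n i := by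
      intro n hn i
      obtain ⟨n, rfl⟩ := Nat.exists_eq_succ_of_ne_zero hn.out
      exact Fin.cast_val_eq_self i
    exact this _ i
  have h1 := computes_fft (K := K) (G := ZMod (s ^ l)) hs l 1 (by simp)
  have h2 := (Computes.reindex (K := K)
    fun p : ZMod (s ^ l) × ZMod (s ^ l) => ((e.symm p.1, p.2) : Fin (s ^ l) × ZMod (s ^ l))).comp
    (h1.comp (Computes.reindex (K := K) fun p : Fin (s ^ l) × ZMod (s ^ l) => (e p.1, p.2)))
  convert h2 using 1
  · funext z p
    change ∑ v, z (v, p.2 - p.1 * v) = _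
    rw [← Equiv.sum_comp e]
    refine Finset.sum_congr rfl fun v _ => ?_
    simp only [nsmul_eq_mul, Nat.cast_mul, he, Equiv.apply_symm_apply, mul_one]
  · rw [ZMod.card, zero_add, add_zero]

theorem sum_padArray (hm : 0 < m) (hH : H = m * b) (hmh : m ≤ h) (hbh : b ≤ h) (f : ZMod H → K)
    (φ : ZMod h × ZMod h → K) : ∑ p, padArray K m b h H f p * φ p = ∑ x, f x * φ (splitIndex m h x) := by
  have hl : ∀ p, padArray K m b h H f p * φ p =
      if p.2.val < m ∧ p.1.val < b then f (joinIndex m H p) * φ p else 0 := by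
    intro p
    change (if p.2.val < m ∧ p.1.val < b then f (joinIndex m H p) else 0) * φ p = _
    split_ifs <;> simp
  simp only [hl]
  rw [← Finset.sum_filter]
  symm
  refine Finset.sum_bij' (fun x _ => splitIndex m h x) (fun p _ => joinIndex m H p) ?_ ?_ ?_ ?_ ?_
  · intro x _
    obtain ⟨h1, h2⟩ := val_splitIndex (h := h) hm hH hmh hbh x
    simp only [Finset.mem_filter, Finset.mem_univ, true_and, h1, h2]
    exact ⟨Nat.mod_lt _ hm, div_lt_of_splitIndex hm hH x⟩
  · simp
  · intro x _
    exact joinIndex_splitIndex hm hH hmh hbh x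
  · intro p hp
    simp only [Finset.mem_filter, Finset.mem_univ, true_and] at hp
    have hlt : p.2.val + m * p.1.val < H := by
      rw [hH]
      calc p.2.val + m * p.1.val < m + m * p.1.val := by omega
        _ = m * (p.1.val + 1) := by ring
        _ ≤ m * b := Nat.mul_le_mul_left _ hp.2
    rw [splitIndex, joinIndex, ZMod.val_cast_of_lt hlt]
    rw [Nat.add_mul_div_left _ _ hm, Nat.div_eq_of_lt hp.1, zero_add, Nat.add_mul_mod_self_left,
      Nat.mod_eq_of_lt hp.1, ZMod.natCast_zmod_val, ZMod.natCast_zmod_val]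
  · intro x _
    rw [joinIndex_splitIndex hm hH hmh hbh x]

theorem dft_padArray (hm : 0 < m) (hH : H = m * b) (hmh : m ≤ h) (hbh : b ≤ h) (f : ZMod H → K)
    (i u : ZMod h) : dft h (padArray K m b h H f) (i, u) =
      ∑ x, f x * if (splitIndex m h x).2 + i * (splitIndex m h x).1 = u then 1 else 0 := by
  rw [← sum_padArray hm hH hmh hbh f fun p => if p.2 + i * p.1 = u then 1 else 0,
    Fintype.sum_prod_type]
  refine Finset.sum_congr rfl fun v _ => ?_
  dsimp only
  rw [Finset.sum_eq_single (u - i * v)]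
  · simp
  · intro w _ hw
    rw [if_neg, mul_zero]
    intro h'
    exact hw (eq_sub_of_add_eq h')
  · simp

/-- Row `i` of the transform is the value of the array, seen as a polynomial over the group algebra,
at the `i`-th power of the generator. Convolution in the group algebra multiplies these values. -/
theorem cconv_dft_padArray (hm : 0 < m) (hH : H = m * b) (hmh : m ≤ h) (hbh : b ≤ h)
    (f g : ZMod H → K) (i u : ZMod h) :
    cconv (fun u => dft h (padArray K m b h H f) (i, u)) (fun u => dft h (padArray K m b h H g) (i, u)) u =
      ∑ x, ∑ y, f x * g y * if (splitIndex m h x + splitIndex m h y).2 +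
        i * (splitIndex m h x + splitIndex m h y).1 = u then 1 else 0 := by
  simp only [cconv, dft_padArray hm hH hmh hbh, Finset.sum_mul_sum]
  rw [Finset.sum_comm]
  refine Finset.sum_congr rfl fun x _ => ?_
  rw [Finset.sum_comm]
  refine Finset.sum_congr rfl fun y _ => ?_
  rw [Finset.sum_eq_single ((splitIndex m h x).2 + i * (splitIndex m h x).1)]
  · rw [if_pos rfl, mul_one, mul_assoc]
    congr 3
    rw [eq_sub_iff_add_eq, Prod.snd_add, Prod.fst_add, eq_iff_iff]
    constructor <;> intro h' <;> rw [← h'] <;> ring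
  · intro j _ hj
    rw [if_neg (Ne.symm hj)]
    simp
  · simp

/-- Orthogonality: modulo functions that are periodic with period `t`. -/
theorem sum_indicator_sub {t : ℕ} (ht : ∀ j : ZMod h, j ≠ 0 → ∃ i, i * j = (t : ZMod h))
    (ht2 : 2 * t ≤ h) {S p : ZMod h × ZMod h} (hS : S.2.val < t) (hp : p.2.val < t) :
    (∑ i, if S.2 + i * S.1 = p.2 + i * p.1 then (1 : K) else 0) -
      (∑ i, if S.2 + i * S.1 = p.2 + t + i * p.1 then (1 : K) else 0) =
      h * if S = p then 1 else 0 := by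
  by_cases h1 : S.1 = p.1
  · have hne : S.2 ≠ p.2 + t := by
      intro h'
      have ht' : (t : ZMod h).val = t := ZMod.val_cast_of_lt (by omega)
      have := congrArg ZMod.val h'
      rw [ZMod.val_add_of_lt (by omega), ht'] at this
      omega
    simp only [h1, add_left_inj, hne, if_false, Finset.sum_const_zero, sub_zero, Prod.ext_iff,
      true_and, Finset.sum_const, Finset.card_univ, ZMod.card, nsmul_eq_mul]
  · obtain ⟨i₀, hi₀⟩ := ht (S.1 - p.1) (sub_ne_zero.2 h1)
    rw [if_neg fun h' => h1 (by rw [h']), mul_zero, sub_eq_zero,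
      ← Equiv.sum_comp (Equiv.addRight i₀) fun i =>
        if S.2 + i * S.1 = p.2 + t + i * p.1 then (1 : K) else 0]
    refine Finset.sum_congr rfl fun i _ => ?_
    congr 1
    rw [eq_iff_iff, ← hi₀, Equiv.coe_addRight]
    constructor <;> intro h'
    · linear_combination h'
    · linear_combination h'

end Recursion

end FastFourierTransform

/-! ### The recursion for convolutions of prime power length -/

section FastConvolution

variable {K : Type*} [Field K]

/-- Application of a linear map to every row of an array. -/
def rowMap {κ α β : Type*} (A : (α → K) →ₗ[K] (β → K)) : (κ × α → K) →ₗ[K] (κ × β → K) where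
  toFun z p := A (fun u => z (p.1, u)) p.2
  map_add' z z' := by
    funext p
    exact congrFun (map_add A (fun u => z (p.1, u)) fun u => z' (p.1, u)) p.2
  map_smul' c z := by
    funext p
    exact congrFun (map_smul A c fun u => z (p.1, u)) p.2

theorem computes_rowMap {κ α β : Type*} [Fintype κ] {A : (α → K) →ₗ[K] (β → K)} {n : ℕ}
    (hA : Computes A n) : Computes (rowMap (κ := κ) A) (Fintype.card κ * n) := by
  have := Computes.map (ι := κ) fun _ => hA
  rw [Finset.sum_const, Finset.card_univ, smul_eq_mul] at this
  exact this

variable {h m b H : ℕ} [NeZero h] [NeZero H]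

/-- The difference, scaled by `1/h`, between an array and its translate by `t`. -/
def unscale (K : Type*) [Field K] (h t : ℕ) : (ZMod h × ZMod h → K) →ₗ[K] (ZMod h × ZMod h → K) where
  toFun w p := (h : K)⁻¹ * (w (-p.1, p.2) - w (-p.1, p.2 + t))
  map_add' w w' := by funext p; simp only [Pi.add_apply]; ring
  map_smul' c w := by
    funext p
    simp only [Pi.smul_apply, smul_eq_mul, RingHom.id_apply]
    ring

/-- The reassembly of a one-dimensional array. -/
def collect (K : Type*) [Field K] (m H h t : ℕ) [NeZero h] :
    (ZMod h × ZMod h → K) →ₗ[K] (ZMod H → K) where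
  toFun w j := ∑ p ∈ Finset.univ.filter fun p : ZMod h × ZMod h =>
    p.2.val < t ∧ joinIndex m H p = j, w p
  map_add' w w' := by funext j; simp [Finset.sum_add_distrib]
  map_smul' c w := by funext j; simp [Finset.mul_sum]

/-- Reduction of a convolution to `h` convolutions of length `h`, after Schönhage and Strassen. -/
theorem FastConv.step {r q L t : ℕ} (hK : (h : K) ≠ 0) (hL : Computes (dft (K := K) h) L)
    (hm : 0 < m) (hH : H = m * b) (hmt : 2 * m ≤ t) (hth : 2 * t ≤ h) (hbh : 2 * b ≤ h)
    (ht : ∀ j : ZMod h, j ≠ 0 → ∃ i, i * j = (t : ZMod h)) (Hc : FastConv K h r q) :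
    FastConv K H (h * r) (L + h * q + 3 * (h * h)) := by
  obtain ⟨ι, hι, A, B, C, hcard, hA, hB, hC, hconv⟩ := Hc
  have hcost : ∀ A : (ZMod h → K) →ₗ[K] (ι → K), Computes A q →
      Computes (rowMap (κ := ZMod h) A ∘ₗ dft h ∘ₗ padArray K m b h H) (L + h * q + 3 * (h * h)) := by
    intro A hA
    have := (computes_rowMap (κ := ZMod h) hA).comp (hL.comp (computes_padArray (m := m) (b := b)
      (H := H)))
    rw [ZMod.card] at this
    exact this.mono (by omega)
  refine ⟨ZMod h × ι, inferInstance, rowMap A ∘ₗ dft h ∘ₗ padArray K m b h H,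
    rowMap B ∘ₗ dft h ∘ₗ padArray K m b h H,
    collect K m H h t ∘ₗ unscale K h t ∘ₗ dft h ∘ₗ rowMap C, ?_, hcost A hA, hcost B hB, ?_, ?_⟩
  · rw [Fintype.card_prod, ZMod.card]
    exact Nat.mul_le_mul_left _ hcard
  · have h1 : Computes (unscale K h t) (h * h * 2) := by
      have := Computes.const_mul_sub (K := K) (h : K)⁻¹
        (fun p : ZMod h × ZMod h => (-p.1, p.2)) fun p => (-p.1, p.2 + (t : ZMod h))
      rwa [Fintype.card_prod, ZMod.card] at this
    have h2 : Computes (collect K m H h t) (h * h) := by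
      have := Computes.sum (K := K) fun j : ZMod H => Finset.univ.filter
        fun p : ZMod h × ZMod h => p.2.val < t ∧ joinIndex m H p = j
      refine this.mono ((sum_card_fiber_le _ _).trans ?_)
      rw [Fintype.card_prod, ZMod.card]
    have := h2.comp (h1.comp (hL.comp (computes_rowMap (κ := ZMod h) hC)))
    rw [ZMod.card] at this
    exact this.mono (by omega)
  · intro f g
    funext j
    have hmh : m ≤ h := by omega
    have hbh' : b ≤ h := by omega
    have h1 : ∀ i u, rowMap C ((rowMap A ∘ₗ dft h ∘ₗ padArray K m b h H) f *
        (rowMap B ∘ₗ dft h ∘ₗ padArray K m b h H) g) (i, u) = ∑ x, ∑ y, f x * g y *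
          if (splitIndex m h x + splitIndex m h y).2 + i * (splitIndex m h x + splitIndex m h y).1 = u
          then 1 else 0 := by
      intro i u
      rw [← cconv_dft_padArray hm hH hmh hbh', ← hconv]
      rfl
    -- The inverse transform, up to the factor `h` and terms of period `t`, is the transform itself
    -- read at the opposite index. `unscale` removes both defects.
    have h2 : ∀ v u, dft h (rowMap C ((rowMap A ∘ₗ dft h ∘ₗ padArray K m b h H) f *
        (rowMap B ∘ₗ dft h ∘ₗ padArray K m b h H) g)) (-v, u) = ∑ x, ∑ y, f x * g y *
          ∑ i, if (splitIndex m h x + splitIndex m h y).2 + i * (splitIndex m h x + splitIndex m h y).1 = u + i * v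
          then 1 else 0 := by
      intro v u
      change ∑ i, rowMap C _ (i, u - -v * i) = _
      simp only [h1, Finset.mul_sum]
      rw [Finset.sum_comm]
      refine Finset.sum_congr rfl fun x _ => ?_
      rw [Finset.sum_comm]
      refine Finset.sum_congr rfl fun y _ => Finset.sum_congr rfl fun i _ => ?_
      rw [neg_mul, sub_neg_eq_add, mul_comm v]
    have hlt : ∀ x y : ZMod H, (splitIndex m h x + splitIndex m h y).2.val < t := by
      intro x y
      rw [(val_add_splitIndex hm hH (by omega) hbh x y).1]
      have := Nat.mod_lt x.val hm
      have := Nat.mod_lt y.val hm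
      omega
    have h3 : ∀ p : ZMod h × ZMod h, p.2.val < t → unscale K h t (dft h (rowMap C
        ((rowMap A ∘ₗ dft h ∘ₗ padArray K m b h H) f *
        (rowMap B ∘ₗ dft h ∘ₗ padArray K m b h H) g))) p =
          ∑ x, ∑ y, f x * g y * if splitIndex m h x + splitIndex m h y = p then 1 else 0 := by
      intro p hp
      change (h : K)⁻¹ * (dft h (rowMap C _) (-p.1, p.2) - dft h (rowMap C _) (-p.1, p.2 + t)) = _
      rw [h2, h2, ← Finset.sum_sub_distrib, Finset.mul_sum]
      refine Finset.sum_congr rfl fun x _ => ?_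
      rw [← Finset.sum_sub_distrib, Finset.mul_sum]
      refine Finset.sum_congr rfl fun y _ => ?_
      rw [← mul_sub, sum_indicator_sub ht hth (hlt x y) hp]
      field_simp
    change ∑ p ∈ Finset.univ.filter fun p : ZMod h × ZMod h => p.2.val < t ∧ joinIndex m H p = j,
      unscale K h t (dft h (rowMap C _)) p = _
    rw [Finset.sum_congr rfl fun p hp => h3 p (Finset.mem_filter.1 hp).2.1, cconv_eq_sum,
      Finset.sum_comm]
    refine Finset.sum_congr rfl fun x _ => ?_
    rw [Finset.sum_comm]
    refine Finset.sum_congr rfl fun y _ => ?_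
    rw [← Finset.mul_sum, Finset.sum_ite_eq]
    congr 1
    simp only [Finset.mem_filter, Finset.mem_univ, true_and, hlt x y,
      joinIndex_add_splitIndex hm hH (show 2 * m ≤ h by omega) hbh]

/-- A nonzero residue modulo s^(a+1) has a greatest common divisor s^v with the modulus, where `v ≤
a`; Bézout's identity then makes s^a a multiple of it. This is the periodicity required by
`FastConv.step`. -/
theorem exists_mul_eq_pow {s : ℕ} (hs : s.Prime) (a : ℕ) [NeZero (s ^ (a + 1))]
    (j : ZMod (s ^ (a + 1))) (hj : j ≠ 0) : ∃ i, i * j = ((s ^ a : ℕ) : ZMod (s ^ (a + 1))) := by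
  obtain ⟨v, hv, hg⟩ := (Nat.dvd_prime_pow hs).1 (Nat.gcd_dvd_right j.val (s ^ (a + 1)))
  have hva : v ≤ a := by
    by_contra hlt
    obtain rfl : v = a + 1 := by omega
    have h1 : s ^ (a + 1) ∣ j.val := Nat.gcd_eq_right_iff_dvd.1 hg
    exact hj ((ZMod.val_eq_zero j).1 (Nat.eq_zero_of_dvd_of_lt h1 (ZMod.val_lt j)))
  have h2 := congrArg (Int.cast : ℤ → ZMod (s ^ (a + 1))) (Nat.gcd_eq_gcd_ab j.val (s ^ (a + 1)))
  rw [hg] at h2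
  simp only [Int.cast_natCast, Int.cast_add, Int.cast_mul, ZMod.natCast_self, zero_mul, add_zero,
    ZMod.natCast_zmod_val] at h2
  refine ⟨(s ^ (a - v) : ℕ) * (Nat.gcdA j.val (s ^ (a + 1)) : ZMod (s ^ (a + 1))), ?_⟩
  rw [mul_assoc, mul_comm _ j, ← h2, ← Nat.cast_mul, ← pow_add, Nat.sub_add_cancel hva]

/-- A convolution of length s^k is reduced to s^(a+2) convolutions of length s^(a+2), with `a` about
k/2. The padded array is at most 243 times larger than the input; a constant factor per level over
about log k levels amounts to a power of `k`. -/
theorem fastConv_pow {s : ℕ} [NeZero s] (hs : s.Prime) (hs3 : s ≤ 3) (hK : (s : K) ≠ 0) (k : ℕ) :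
    FastConv K (s ^ k) (243 * s ^ k * (k + 1) ^ 48) (243 * s ^ k * (k + 1) ^ 48) := by
  have hs2 := hs.two_le
  have hs5 : s ^ 5 ≤ 243 := (Nat.pow_le_pow_left hs3 5).trans (by norm_num)
  induction k using Nat.strong_induction_on with
  | _ k ih =>
    -- The recursive exponent `a + 2` is smaller than `k` only from `k = 6` on.
    by_cases hk : k ≤ 5
    · have h1 : s ^ k * s ^ k ≤ 243 * s ^ k * (k + 1) ^ 48 := by
        calc s ^ k * s ^ k ≤ 243 * s ^ k := by
              gcongr
              exact (Nat.pow_le_pow_right (by omega) hk).trans hs5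
          _ ≤ 243 * s ^ k * (k + 1) ^ 48 := Nat.le_mul_of_pos_right _ (by positivity)
      exact (fastConv_naive (s ^ k)).mono h1 h1
    · obtain ⟨a, b, hab, hba, hak⟩ : ∃ a b, k = a + b ∧ b ≤ a ∧ a ≤ b + 1 :=
        ⟨k - k / 2, k / 2, by omega, by omega, by omega⟩
      have h0 := ih (a + 2) (by omega)
      have hpow : ∀ i, s ^ (i + 1) = s ^ i * s := fun i => pow_succ s i
      -- One factor `s ≥ 2` separates the block length from the period `t`, and another separates
      -- `t` from the transform length; they leave room for the products and for the comparison with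
      -- the translate.
      have hstep := FastConv.step (H := s ^ k) (m := s ^ a) (b := s ^ b) (t := s ^ (a + 1))
        (by rw [Nat.cast_pow]; exact pow_ne_zero _ hK) (computes_dft (by omega)) (by positivity)
        (by rw [hab, pow_add])
        (by rw [hpow, mul_comm]; gcongr) (by rw [hpow (a + 1), mul_comm]; gcongr)
        (by
          rw [hpow (a + 1), mul_comm]
          exact Nat.mul_le_mul (Nat.pow_le_pow_right (by omega) (by omega)) hs2)
        (exists_mul_eq_pow hs (a + 1)) h0
      have hh : s ^ (a + 2) * s ^ (a + 2) ≤ 243 * s ^ k := by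
        rw [← pow_add]
        calc s ^ (a + 2 + (a + 2)) ≤ s ^ (5 + k) := Nat.pow_le_pow_right (by omega) (by omega)
          _ = s ^ 5 * s ^ k := pow_add _ _ _
          _ ≤ 243 * s ^ k := by gcongr
      -- The exponent 48 is large enough that (8/7)^48 exceeds 486 = 2 · 243: one factor 243 pays
      -- for the padding, and the 2 absorbs the transforms and corrections.
      have hpoly : 486 * (a + 3) ^ 48 ≤ (k + 1) ^ 48 := by
        have h1 : (8 * (a + 3)) ^ 48 ≤ (7 * (k + 1)) ^ 48 := Nat.pow_le_pow_left (by omega) 48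
        rw [mul_pow, mul_pow] at h1
        have h2 : 486 * 7 ^ 48 ≤ 8 ^ 48 := by norm_num
        refine Nat.le_of_mul_le_mul_left (?_ : 8 ^ 48 * _ ≤ 8 ^ 48 * _) (by norm_num)
        calc 8 ^ 48 * (486 * (a + 3) ^ 48) = 486 * (8 ^ 48 * (a + 3) ^ 48) := by ring
          _ ≤ 486 * (7 ^ 48 * (k + 1) ^ 48) := by gcongr
          _ = 486 * 7 ^ 48 * (k + 1) ^ 48 := by ring
          _ ≤ 8 ^ 48 * (k + 1) ^ 48 := by gcongr
      have hbound : (a + 2) * s * (s ^ (a + 2) * s ^ (a + 2)) +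
          s ^ (a + 2) * (243 * s ^ (a + 2) * (a + 2 + 1) ^ 48) +
          3 * (s ^ (a + 2) * s ^ (a + 2)) ≤ 243 * s ^ k * (k + 1) ^ 48 := by
        have h1 : a + 3 ≤ (a + 3) ^ 48 := Nat.le_self_pow (by norm_num) _
        calc _ = s ^ (a + 2) * s ^ (a + 2) * ((a + 2) * s + 243 * (a + 3) ^ 48 + 3) := by ring
          _ ≤ 243 * s ^ k * ((a + 2) * 3 + 243 * (a + 3) ^ 48 + 3) := by gcongr
          _ ≤ 243 * s ^ k * (k + 1) ^ 48 := by
            gcongr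
            omega
      refine hstep.mono (le_trans ?_ hbound) hbound
      exact (Nat.le_add_left _ _).trans (Nat.le_add_right _ _)

end FastConvolution

/-! ## Multiplication of bivariate polynomials -/

section BivariateMul

variable {K : Type*} [Field K]

theorem BPoly.ofPoly_toPoly_mul {a b : ℕ} (p q : BPoly K a b) (st : Fin a × Fin b) :
    ofPoly a b (p.toPoly * q.toPoly) st = ∑ x : Fin a × Fin b, ∑ y : Fin a × Fin b,
      p x * q y * if (x.1 : ℕ) + y.1 = st.1 ∧ (x.2 : ℕ) + y.2 = st.2 then 1 else 0 := by
  have h : ∀ i j s t : ℕ, ∀ i' j' : ℕ,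
      expXY i j + expXY i' j' = expXY s t ↔ i + i' = s ∧ j + j' = t := by
    intro i j s t i' j'
    constructor
    · intro h
      have h0 := DFunLike.congr_fun h 0
      have h1 := DFunLike.congr_fun h 1
      simp only [Finsupp.add_apply, expXY_zero_left, expXY_one] at h0 h1
      exact ⟨h0, h1⟩
    · rintro ⟨rfl, rfl⟩
      ext v
      fin_cases v <;> simp
  change MvPolynomial.coeff (expXY st.1 st.2) _ = _
  rw [toPoly_eq_sum_monomial, toPoly_eq_sum_monomial, Finset.sum_mul_sum, MvPolynomial.coeff_sum]
  refine Finset.sum_congr rfl fun x _ => ?_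
  rw [MvPolynomial.coeff_sum]
  refine Finset.sum_congr rfl fun y _ => ?_
  rw [MvPolynomial.monomial_mul, MvPolynomial.coeff_monomial, mul_ite, mul_one, mul_zero]
  simp only [h]

/-- Products in `K[X,Y]/(X^a, Y^b)` have a bilinear algorithm with `T` multiplications whose linear
maps can be computed in `T` instructions each. -/
def FastBivariate (K : Type*) [Field K] (a b T : ℕ) : Prop :=
  ∃ (ι : Type) (_ : Fintype ι) (A B : BPoly K a b →ₗ[K] (ι → K)) (C : (ι → K) →ₗ[K] BPoly K a b),
    Fintype.card ι ≤ T ∧ Computes A T ∧ Computes B T ∧ Computes C T ∧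
      ∀ p q, C (A p * B q) = BPoly.ofPoly a b (p.toPoly * q.toPoly)

/-- Kronecker substitution `Y = X^{2a}`, modulo `X^H - 1`. -/
def kronecker (K : Type*) [Field K] (a b H : ℕ) : BPoly K a b →ₗ[K] (ZMod H → K) where
  toFun p x := ∑ ij ∈ Finset.univ.filter fun ij : Fin a × Fin b =>
    ((ij.1 + 2 * a * ij.2 : ℕ) : ZMod H) = x, p ij
  map_add' p q := by funext x; simp [Finset.sum_add_distrib]
  map_smul' c p := by funext x; simp [Finset.mul_sum]

/-- With Y = X^(2a) the X-degrees of a product stay below 2a, so exponents do not overlap, and `H ≥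
4ab` prevents wrapping around. Hence the exponent recovers both degrees. -/
theorem cconv_kronecker {a b H : ℕ} [NeZero H] (hH : 4 * (a * b) ≤ H) (p q : BPoly K a b)
    (st : Fin a × Fin b) :
    cconv (kronecker K a b H p) (kronecker K a b H q) ((st.1 + 2 * a * st.2 : ℕ) : ZMod H) =
      BPoly.ofPoly a b (p.toPoly * q.toPoly) st := by
  have hpush : ∀ (p : BPoly K a b) (F : ZMod H → K), ∑ x, kronecker K a b H p x * F x =
      ∑ ij, p ij * F ((ij.1 + 2 * a * ij.2 : ℕ) : ZMod H) := by
    intro p F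
    rw [← Finset.sum_fiberwise Finset.univ
      fun ij : Fin a × Fin b => ((ij.1 + 2 * a * ij.2 : ℕ) : ZMod H)]
    refine Finset.sum_congr rfl fun x _ => ?_
    change (∑ ij ∈ _, p ij) * F x = _
    rw [Finset.sum_mul]
    refine Finset.sum_congr rfl fun ij hij => ?_
    rw [(Finset.mem_filter.1 hij).2]
  have hlt : ∀ x : Fin a × Fin b, (x.1 : ℕ) + 2 * a * x.2 + a < 2 * (a * b) + 1 := by
    intro x
    have h1 : a * ((x.2 : ℕ) + 1) ≤ a * b := Nat.mul_le_mul_left _ x.2.isLt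
    have := x.1.isLt
    nlinarith
  have hiff : ∀ x y : Fin a × Fin b, ((x.1 + 2 * a * x.2 : ℕ) : ZMod H) +
      ((y.1 + 2 * a * y.2 : ℕ) : ZMod H) = ((st.1 + 2 * a * st.2 : ℕ) : ZMod H) ↔
      (x.1 : ℕ) + y.1 = st.1 ∧ (x.2 : ℕ) + y.2 = st.2 := by
    intro x y
    have ha := x.1.isLt
    have ha' := y.1.isLt
    have ha'' := st.1.isLt
    have h1 := hlt x
    have h2 := hlt y
    have h3 := hlt st
    rw [← Nat.cast_add, ZMod.natCast_eq_natCast_iff', Nat.mod_eq_of_lt (by omega),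
      Nat.mod_eq_of_lt (by omega)]
    constructor
    · intro h
      have h' : (x.1 + y.1 : ℕ) + 2 * a * (x.2 + y.2) = st.1 + 2 * a * st.2 := by
        rw [mul_add]
        omega
      have hm := congrArg (· % (2 * a)) h'
      simp only [Nat.add_mul_mod_self_left] at hm
      rw [Nat.mod_eq_of_lt (by omega), Nat.mod_eq_of_lt (by omega)] at hm
      refine ⟨hm, ?_⟩
      rw [hm] at h'
      exact Nat.eq_of_mul_eq_mul_left (by omega) (Nat.add_left_cancel h')
    · rintro ⟨h, h'⟩
      rw [← h, ← h']
      ring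
  rw [cconv_eq_sum, BPoly.ofPoly_toPoly_mul]
  have assoc : ∀ u v w : K, u * v * w = u * (v * w) := mul_assoc
  simp only [assoc, ← Finset.mul_sum, hpush, hiff]

theorem FastConv.fastBivariate {a b H r T : ℕ} [NeZero H] (Hc : FastConv K H r r)
    (hH : 4 * (a * b) ≤ H) (hT : a * b + r ≤ T) : FastBivariate K a b T := by
  obtain ⟨ι, hι, A, B, C, hc, hA, hB, hC, hconv⟩ := Hc
  have hE : Computes (kronecker K a b H) (a * b) := by
    have := Computes.sum (K := K) fun x : ZMod H => Finset.univ.filter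
      fun ij : Fin a × Fin b => ((ij.1 + 2 * a * ij.2 : ℕ) : ZMod H) = x
    refine this.mono ((sum_card_fiber _).trans ?_).le
    simp
  let out : (ZMod H → K) →ₗ[K] BPoly K a b :=
    LinearMap.funLeft K K fun st : Fin a × Fin b => ((st.1 + 2 * a * st.2 : ℕ) : ZMod H)
  have hout : Computes out 0 := Computes.reindex _
  refine ⟨ι, hι, A ∘ₗ kronecker K a b H, B ∘ₗ kronecker K a b H, out ∘ₗ C,
    by omega, (hA.comp hE).mono hT, (hB.comp hE).mono hT, (hout.comp hC).mono (by omega), ?_⟩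
  intro p q
  funext st
  rw [← cconv_kronecker hH, ← hconv]
  rfl

/-- The length is the first power of `s` that is at least 4ab, hence at most 12ab; 2917 = 1 + 243 ·
12 accounts for the substitution and the convolution. -/
theorem fastBivariate (a b : ℕ) (ha : 1 ≤ a) (hb : 1 ≤ b) :
    FastBivariate K a b (2917 * (a * b) * (Nat.clog 2 (a * b) + 3) ^ 48) := by
  -- The inverse transform divides by a power of `s`. Since 3 - 2 = 1, the primes 2 and 3 cannot
  -- both vanish in `K`.
  obtain ⟨s, hs, hs3, hK⟩ : ∃ s : ℕ, s.Prime ∧ s ≤ 3 ∧ (s : K) ≠ 0 := by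
    by_cases h2 : ((2 : ℕ) : K) = 0
    · refine ⟨3, Nat.prime_three, le_rfl, fun h3 => one_ne_zero (α := K) ?_⟩
      push_cast at h2 h3
      linear_combination h3 - h2
    · exact ⟨2, Nat.prime_two, by norm_num, h2⟩
  have : NeZero s := ⟨hs.ne_zero⟩
  have hab : 1 ≤ a * b := Nat.mul_pos ha hb
  set κ := Nat.clog s (4 * (a * b)) with hκ
  have hκ2 : κ + 1 ≤ Nat.clog 2 (a * b) + 3 := by
    have h1 : κ ≤ Nat.clog 2 (4 * (a * b)) := Nat.clog_anti_left (by norm_num) hs.two_le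
    have h2 : Nat.clog 2 (4 * (a * b)) ≤ Nat.clog 2 (a * b) + 2 := by
      refine Nat.clog_le_of_le_pow ?_
      rw [pow_add, mul_comm 4]
      exact Nat.mul_le_mul_right 4 (Nat.le_pow_clog (by norm_num) _)
    omega
  have hH : 4 * (a * b) ≤ s ^ κ := Nat.le_pow_clog hs.one_lt _
  have hH' : s ^ κ ≤ 12 * (a * b) := by
    have hpos : 0 < κ := Nat.clog_pos hs.one_lt (by omega)
    have h1 : s ^ κ.pred < 4 * (a * b) := Nat.pow_pred_clog_lt_self hs.one_lt (by omega)
    calc s ^ κ = s ^ κ.pred * s := by rw [← pow_succ, Nat.pred_eq_sub_one, Nat.sub_add_cancel hpos]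
      _ ≤ 4 * (a * b) * 3 := Nat.mul_le_mul h1.le hs3
      _ = 12 * (a * b) := by ring
  refine (fastConv_pow hs hs3 hK κ).fastBivariate hH ?_
  have h48 : (κ + 1) ^ 48 ≤ (Nat.clog 2 (a * b) + 3) ^ 48 := Nat.pow_le_pow_left hκ2 48
  have hL : 1 ≤ (Nat.clog 2 (a * b) + 3) ^ 48 := Nat.one_le_pow _ _ (by omega)
  generalize (κ + 1) ^ 48 = x at h48
  generalize (Nat.clog 2 (a * b) + 3) ^ 48 = y at h48 hL
  calc a * b + 243 * s ^ κ * x ≤ a * b * y + 243 * (12 * (a * b)) * y :=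
        Nat.add_le_add (Nat.le_mul_of_pos_right _ hL)
          (Nat.mul_le_mul (Nat.mul_le_mul_left _ hH') h48)
    _ = 2917 * (a * b) * y := by ring

end BivariateMul

/-! ## Multiplication of matrices over the field -/

section MatrixMul

variable {K : Type*} [Field K]

theorem runCode_algHom {α A B : Type*} [CommRing A] [Algebra K A] [CommRing B] [Algebra K B]
    (f : A →ₐ[K] B) (x : α → A) (code : List (Instr K α)) :
    runCode (f ∘ x) code = (runCode x code).map f ∧ ∀ w : Operand K α,
      w.eval (f ∘ x) (runCode (f ∘ x) code) = f (w.eval x (runCode x code)) := by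
  have hw : ∀ regs : List A, ∀ w : Operand K α,
      w.eval (f ∘ x) (regs.map f) = f (w.eval x regs) := by
    intro regs w
    cases w with
    | const c => exact (f.commutes c).symm
    | input i => rfl
    | reg t =>
      change (regs.map f).getD t 0 = f (regs.getD t 0)
      rw [← map_zero f, List.getD_map]
  have h : runCode (f ∘ x) code = (runCode x code).map f := by
    induction code using List.reverseRecOn with
    | nil => rfl
    | append_singleton code I ih =>
      rw [runCode_append, runCode_append, ih, List.map_append]
      congr 1
      rcases I with ⟨_ | _ | _, l, r⟩ <;> simp [Instr.eval, hw]
  exact ⟨h, fun w => by rw [h, hw]⟩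

theorem Circuit.ComputesMatMul.eval_eq {N : ℕ}
    {c : Circuit K ((Fin N × Fin N) ⊕ (Fin N × Fin N)) (Fin N × Fin N)} (hc : c.ComputesMatMul)
    (x : (Fin N × Fin N) ⊕ (Fin N × Fin N) → K) (p : Fin N × Fin N) :
    c.eval x p = ∑ l, x (Sum.inl (p.1, l)) * x (Sum.inr (l, p.2)) := by
  have h := congrArg (MvPolynomial.aeval (R := K) x) (hc p.1 p.2)
  have h' := (runCode_algHom (MvPolynomial.aeval (R := K) x) MvPolynomial.X c.code).2 (c.out p)
  have hx : (MvPolynomial.aeval (R := K) x) ∘ MvPolynomial.X = x := by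
    funext v
    simp
  rw [hx] at h'
  refine h'.trans (h.trans ?_)
  simp

/-- Each output must be the result of its own instruction. Outputs that are constants or inputs are
excluded by setting one factor to zero, and two outputs in one register are separated by a product
of matrix units. -/
theorem Circuit.ComputesMatMul.sq_le_size {N : ℕ} (hN : 1 ≤ N)
    {c : Circuit K ((Fin N × Fin N) ⊕ (Fin N × Fin N)) (Fin N × Fin N)} (hc : c.ComputesMatMul) :
    N * N ≤ c.size := by
  classical
  let u (i : Fin N) : Fin N × Fin N → K := Pi.single (i, ⟨0, hN⟩) 1
  let v (j : Fin N) : Fin N × Fin N → K := Pi.single (⟨0, hN⟩, j) 1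
  have h1 : ∀ i j, c.eval (Sum.elim (u i) (v j)) (i, j) = 1 := by
    intro i j
    rw [hc.eval_eq, Finset.sum_eq_single ⟨0, hN⟩]
    · simp [u, v]
    · intro l _ hl
      simp [u, hl]
    · simp
  have h2 : ∀ i j p, p ≠ (i, j) → c.eval (Sum.elim (u i) (v j)) p = 0 := by
    rintro i j ⟨i', j'⟩ hp
    rw [hc.eval_eq]
    refine Finset.sum_eq_zero fun l _ => ?_
    by_cases hi : i' = i
    · have hj : j' ≠ j := fun hj => hp (by rw [hi, hj])
      simp [v, hj]
    · simp [u, hi]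
  have h3 : ∀ (x : _ → K) p, c.eval (Sum.elim x 0) p = 0 := fun x p => by simp [hc.eval_eq]
  have h4 : ∀ (x : _ → K) p, c.eval (Sum.elim 0 x) p = 0 := fun x p => by simp [hc.eval_eq]
  have hreg : ∀ p, ∃ t : Fin c.size, c.out p = .reg t := by
    intro p
    have h1p := h1 p.1 p.2
    have h3p := h3 (u p.1) p
    have h4p := h4 (v p.2) p
    unfold Circuit.eval at h1p h3p h4p
    rcases hout : c.out p with a | (a | a) | t <;> rw [hout] at h1p h3p h4p
    · exact absurd (h1p.symm.trans h3p) one_ne_zero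
    · exact absurd (h1p.symm.trans h3p) one_ne_zero
    · exact absurd (h1p.symm.trans h4p) one_ne_zero
    · refine ⟨⟨t, ?_⟩, rfl⟩
      by_contra ht
      refine zero_ne_one (α := K) (Eq.trans ?_ h1p)
      refine (List.getD_eq_default _ _ ?_).symm
      change (runCode _ _).length ≤ t
      rw [length_runCode]
      exact not_lt.1 ht
  choose t ht using hreg
  have hinj : Function.Injective t := by
    intro p q hpq
    by_contra hne
    have hout : c.out p = c.out q := by rw [ht, ht, hpq]
    have h := h1 p.1 p.2
    unfold Circuit.eval at h
    rw [hout] at h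
    exact one_ne_zero (h.symm.trans (h2 p.1 p.2 q (Ne.symm hne)))
  simpa using Fintype.card_le_of_injective t hinj

/-- The product of a `k × l` and an `l × c` matrix. -/
def mulEntries (K : Type*) [Field K] (k l c : ℕ) (x : (Fin k × Fin l) ⊕ (Fin l × Fin c) → K)
    (p : Fin k × Fin c) : K := ∑ r, x (Sum.inl (p.1, r)) * x (Sum.inr (r, p.2))

/-- Rectangular products from square ones. -/
theorem computes_mulEntries {N W k l c : ℕ} (hN : 1 ≤ N) (hW : Computes (mulEntries K N N N) W)
    (hk : k ≤ N) (hl : l ≤ N) : Computes (mulEntries K k l c) ((c / N + 1) * W) := by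
  have h1 : Computes (fun (x : (Fin k × Fin l) ⊕ (Fin l × Fin c) → K)
      (q : Fin (c / N + 1) × ((Fin N × Fin N) ⊕ (Fin N × Fin N))) =>
      q.2.elim
        (fun y => if h : (y.1 : ℕ) < k ∧ (y.2 : ℕ) < l then
          x (Sum.inl (⟨y.1, h.1⟩, ⟨y.2, h.2⟩)) else 0)
        (fun y => if h : (y.1 : ℕ) < l ∧ (N * q.1 + y.2 : ℕ) < c then
          x (Sum.inr (⟨y.1, h.1⟩, ⟨N * q.1 + y.2, h.2⟩)) else 0)) 0 := by
    refine .of_coord ?_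
    rintro ⟨β, y | y⟩
    · by_cases h : (y.1 : ℕ) < k ∧ (y.2 : ℕ) < l
      · exact Or.inl ⟨Sum.inl (⟨y.1, h.1⟩, ⟨y.2, h.2⟩), fun x => dif_pos h⟩
      · exact Or.inr ⟨0, fun x => dif_neg h⟩
    · by_cases h : (y.1 : ℕ) < l ∧ (N * β + y.2 : ℕ) < c
      · exact Or.inl ⟨Sum.inr (⟨y.1, h.1⟩, ⟨N * β + y.2, h.2⟩), fun x => dif_pos h⟩
      · exact Or.inr ⟨0, fun x => dif_neg h⟩
  have h2 := Computes.map (ι := Fin (c / N + 1)) fun _ => hW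
  rw [Finset.sum_const, Finset.card_univ, Fintype.card_fin, smul_eq_mul] at h2
  have h3 := Computes.reindex (K := K) fun p : Fin k × Fin c =>
    ((⟨p.2 / N, Nat.lt_succ_of_le (Nat.div_le_div_right p.2.isLt.le)⟩ : Fin (c / N + 1)),
      (p.1.castLE hk, (⟨p.2 % N, Nat.mod_lt _ hN⟩ : Fin N)))
  have h4 := h3.comp (h2.comp h1)
  rw [zero_add, add_zero] at h4
  convert h4 using 1
  funext x p
  refine Fintype.sum_of_injective (Fin.castLE hl) (Fin.castLE_injective hl) _ _ ?_ fun r => ?_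
  · intro r hr
    have hr' : ¬ (r : ℕ) < l := fun h => hr ⟨⟨r, h⟩, rfl⟩
    simp [hr']
  · simp [Nat.div_add_mod]

end MatrixMul

/-! ## Multiplication of polynomial matrices -/

section PolynomialMatrixMul

variable {K : Type*} [Field K]

/-- The product modulo `X^a, Y^b` of two matrices of bivariate polynomials. -/
noncomputable def mulPolyEntries (K : Type*) [Field K] (k l c a b : ℕ)
    (x : (Fin k × Fin l × Fin a × Fin b) ⊕ (Fin l × Fin c × Fin a × Fin b) → K)
    (p : Fin k × Fin c × Fin a × Fin b) : K :=
  BPoly.ofPoly a b (∑ r, BPoly.toPoly (fun u => x (Sum.inl (p.1, r, u))) *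
    BPoly.toPoly fun u => x (Sum.inr (r, p.2.1, u))) p.2.2

/-- Bilinearity is essential here: the linear maps are applied once per matrix entry, and each of
the at most `T` products of scalars becomes one product of scalar matrices. -/
theorem FastBivariate.computes_mulPolyEntries {k l c a b T W : ℕ} (H : FastBivariate K a b T)
    (hW : Computes (mulEntries K k l c) W) :
    Computes (mulPolyEntries K k l c a b) (T * (k * l + l * c + k * c + W)) := by
  obtain ⟨ι, hι, A, B, C, hc, hA, hB, hC, hmul⟩ := H
  have hcoord : ∀ {i j : ℕ} {A : BPoly K a b →ₗ[K] (ι → K)}, Computes A T →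
      Computes (fun (x : Fin i × Fin j × Fin a × Fin b → K) =>
        rowMap A fun q : (Fin i × Fin j) × Fin a × Fin b => x (q.1.1, q.1.2, q.2))
        (i * j * T) := by
    intro i j A hA
    have := (computes_rowMap (κ := Fin i × Fin j) hA).comp (Computes.reindex (K := K)
      fun q : (Fin i × Fin j) × Fin a × Fin b => (q.1.1, q.1.2, q.2))
    simpa using this
  have h1 := (hcoord (i := k) (j := l) hA).sumElim (hcoord (i := l) (j := c) hB)
  have h2 := Computes.reindex (K := K) fun q : ι × ((Fin k × Fin l) ⊕ (Fin l × Fin c)) =>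
    q.2.elim (fun y => (Sum.inl (y, q.1) : ((Fin k × Fin l) × ι) ⊕ ((Fin l × Fin c) × ι)))
      fun y => Sum.inr (y, q.1)
  have h3 := Computes.map (ι := ι) fun _ => hW
  rw [Finset.sum_const, Finset.card_univ, smul_eq_mul] at h3
  have h4 := Computes.reindex (K := K) fun q : (Fin k × Fin c) × ι => (q.2, q.1)
  have h5 := computes_rowMap (κ := Fin k × Fin c) hC
  rw [Fintype.card_prod, Fintype.card_fin, Fintype.card_fin] at h5
  have h6 := Computes.reindex (K := K) fun p : Fin k × Fin c × Fin a × Fin b =>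
    ((p.1, p.2.1), p.2.2)
  have h7 := (h6.comp (h5.comp (h4.comp (h3.comp (h2.comp h1))))).mono
    (n' := T * (k * l + l * c + k * c + W)) (by
      have : Fintype.card ι * W ≤ T * W := Nat.mul_le_mul_right _ hc
      nlinarith)
  convert h7 using 1
  funext x p
  have hsum : ∀ r, BPoly.ofPoly a b (BPoly.toPoly (fun u => x (Sum.inl (p.1, r, u))) *
      BPoly.toPoly fun u => x (Sum.inr (r, p.2.1, u))) =
      C (A (fun u => x (Sum.inl (p.1, r, u))) * B fun u => x (Sum.inr (r, p.2.1, u))) :=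
    fun r => (hmul _ _).symm
  have hof : ∀ (g : Fin l → BiRing K), BPoly.ofPoly a b (∑ r, g r) = ∑ r, BPoly.ofPoly a b (g r) := by
    intro g
    funext st
    rw [Finset.sum_apply]
    exact MvPolynomial.coeff_sum _ _ _
  rw [mulPolyEntries, hof, Finset.sum_congr rfl fun r _ => hsum r, ← map_sum]
  change _ = C _ p.2.2
  refine congrFun (congrArg C ?_) _
  funext u
  rw [Finset.sum_apply]
  rfl

/-- A correct routine whose cost is that of fast convolution times that of matrix
multiplication over the field. -/
theorem exists_mulRoutine {W : ℕ → ℕ} (hW : ∀ N, 1 ≤ N → Computes (mulEntries K N N N) (W N)) :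
    ∃ R : MulRoutine K, R.IsCorrect ∧ ∀ k l c a b : ℕ, (R k l c a b).size ≤
      2917 * (a * b) * (Nat.clog 2 (a * b) + 3) ^ 48 * (k * l + l * c + k * c +
        (c / max (max k l) 1 + 1) * W (max (max k l) 1)) := by
  have key : ∀ k l c a b : ℕ, ∃ R : Circuit K
      ((Fin k × Fin l × Fin a × Fin b) ⊕ (Fin l × Fin c × Fin a × Fin b))
      (Fin k × Fin c × Fin a × Fin b), (R.size ≤
        2917 * (a * b) * (Nat.clog 2 (a * b) + 3) ^ 48 * (k * l + l * c + k * c +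
          (c / max (max k l) 1 + 1) * W (max (max k l) 1))) ∧
        ∀ x p, R.eval x p = mulPolyEntries K k l c a b x p := by
    intro k l c a b
    by_cases hab : 1 ≤ a ∧ 1 ≤ b
    · obtain ⟨R, hR, hR'⟩ := ((fastBivariate (K := K) a b hab.1 hab.2).computes_mulPolyEntries
        (computes_mulEntries (c := c) (le_max_right _ _) (hW (max (max k l) 1) (le_max_right _ _))
          ((le_max_left k l).trans (le_max_left _ _))
          ((le_max_right k l).trans (le_max_left _ _)))).exists_circuit
      exact ⟨R, hR, fun x p => congrFun (hR' x) p⟩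
    · refine ⟨⟨[], fun _ => .const 0⟩, Nat.zero_le _, ?_⟩
      rintro x ⟨i, j, s, t⟩
      exact absurd ⟨Nat.one_le_of_lt s.isLt, Nat.one_le_of_lt t.isLt⟩ hab
  choose R hR hR' using key
  refine ⟨R, ?_, hR⟩
  intro k l c a b P Q i j s t
  exact hR' k l c a b _ _

end PolynomialMatrixMul

/-! ## The number of operations -/

section Complexity

variable {K : Type*} [Field K]

/-- Otherwise N^(2-ω) would tend to infinity while staying below `A`. -/
theorem two_le_of_sq_le_rpow {A ω : ℝ} (h : ∀ N : ℕ, 1 ≤ N → (N : ℝ) ^ 2 ≤ A * (N : ℝ) ^ ω) :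
    2 ≤ ω := by
  by_contra! hω
  have hlim := (tendsto_rpow_atTop (sub_pos.2 hω)).comp (tendsto_natCast_atTop_atTop (R := ℝ))
  obtain ⟨N, hN, hN1⟩ := ((hlim.eventually_gt_atTop A).and (Filter.eventually_ge_atTop 1)).exists
  have hpos : (0 : ℝ) < N := by exact_mod_cast hN1
  have h1 : (N : ℝ) ^ 2 = (N : ℝ) ^ (2 - ω) * (N : ℝ) ^ ω := by
    rw [← Real.rpow_add hpos, sub_add_cancel, Real.rpow_two]
  have h2 := h N hN1
  rw [h1] at h2
  exact absurd (le_of_mul_le_mul_right h2 (Real.rpow_pos_of_pos hpos ω)) (not_le.2 hN)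

/-- With `N` the larger inner dimension, c/N + 1 square products cost about N^(ω-1)(c + N), which
grows with `N` as `ω ≥ 1`. The entrywise transforms are absorbed because B ≤ A B^(ω-1). -/
theorem rectangular_cost_le {A ω : ℝ} {W : ℕ → ℕ}
    (hW : ∀ N : ℕ, 1 ≤ N → (W N : ℝ) ≤ A * (N : ℝ) ^ ω)
    (hA : ∀ N : ℕ, 1 ≤ N → (N : ℝ) ^ 2 ≤ A * (N : ℝ) ^ ω) {k l c n B : ℕ} (hk : k ≤ B)
    (hl : l ≤ B) (hc : c ≤ n + B) (hB : 1 ≤ B) :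
    ((k * l + l * c + k * c + (c / max (max k l) 1 + 1) * W (max (max k l) 1) : ℕ) : ℝ) ≤
      5 * A * (B : ℝ) ^ (ω - 1) * (B + n) := by
  have hω := two_le_of_sq_le_rpow hA
  have hA1 : 1 ≤ A := by simpa using hA 1 le_rfl
  have hpow : ∀ {N : ℕ}, 1 ≤ N → (N : ℝ) ^ ω = (N : ℝ) ^ (ω - 1) * N := by
    intro N hN
    have hN0 : (0 : ℝ) < N := by exact_mod_cast hN
    rw [← Real.rpow_add_one hN0.ne', sub_add_cancel]
  have hB0 : (0 : ℝ) < B := by exact_mod_cast hB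
  have hBA : (B : ℝ) ≤ A * (B : ℝ) ^ (ω - 1) := by
    have := hA B hB
    rw [hpow hB, sq, ← mul_assoc] at this
    exact le_of_mul_le_mul_right this hB0
  set N := max (max k l) 1 with hN
  have hN1 : 1 ≤ N := le_max_right _ _
  have hN0 : (0 : ℝ) < N := by exact_mod_cast hN1
  have hNB : N ≤ B := max_le (max_le hk hl) hB
  have hNB' : (N : ℝ) ≤ B := by exact_mod_cast hNB
  have hc' : (c : ℝ) ≤ n + B := by exact_mod_cast hc
  have hk' : (k : ℝ) ≤ B := by exact_mod_cast hk
  have hl' : (l : ℝ) ≤ B := by exact_mod_cast hl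
  have hn0 : (0 : ℝ) ≤ n := Nat.cast_nonneg n
  have h1 : (k * l + l * c + k * c : ℝ) ≤ A * (B : ℝ) ^ (ω - 1) * (3 * (B + n)) := by
    calc (k * l + l * c + k * c : ℝ) ≤ B * B + B * (n + B) + B * (n + B) := by gcongr
      _ ≤ B * (3 * (B + n)) := by nlinarith
      _ ≤ A * (B : ℝ) ^ (ω - 1) * (3 * (B + n)) := by gcongr
  have h2 : ((c / N : ℕ) + 1 : ℝ) * W N ≤ A * (B : ℝ) ^ (ω - 1) * (2 * (B + n)) := by
    calc ((c / N : ℕ) + 1 : ℝ) * W N ≤ (c / N + 1 : ℝ) * (A * ((N : ℝ) ^ (ω - 1) * N)) := by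
          rw [← hpow hN1]
          gcongr
          · exact Nat.cast_div_le
          · exact hW N hN1
      _ = A * (N : ℝ) ^ (ω - 1) * (c + N) := by
          field_simp
      _ ≤ A * (B : ℝ) ^ (ω - 1) * (n + B + B) := by
          have : 0 ≤ ω - 1 := by linarith
          gcongr
      _ ≤ A * (B : ℝ) ^ (ω - 1) * (2 * (B + n)) := by
          gcongr
          linarith
  push_cast
  linarith

theorem one_le_log_two_add {f : ℝ} (hf : 1 ≤ f) : 1 ≤ Real.log (2 + f) := by
  rw [Real.le_log_iff_exp_le (by linarith)]
  have := Real.exp_one_lt_d9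
  linarith

theorem clog_add_le_log {x : ℕ} {f : ℝ} (hx : 1 ≤ x) (hf : (x : ℝ) ≤ f) :
    (Nat.clog 2 x + 5 : ℝ) ≤ 8 * Real.log (2 + f) := by
  have hx1 : (1 : ℝ) ≤ x := by exact_mod_cast hx
  have h1 := one_le_log_two_add (hx1.trans hf)
  have hlog : Real.log x ≤ Real.log (2 + f) := Real.log_le_log (by linarith) (by linarith)
  have h2 : (Nat.clog 2 x : ℝ) * Real.log 2 ≤ Real.log x + Real.log 2 := by
    rcases hx.eq_or_lt with rfl | hx'
    · simpa using Real.log_nonneg (by norm_num : (1 : ℝ) ≤ 2)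
    · have hpos := Nat.clog_pos (b := 2) (by norm_num) hx'
      have h3 := Nat.pow_pred_clog_lt_self (b := 2) (by norm_num) hx'
      have h4 : (2 : ℝ) ^ (Nat.clog 2 x).pred ≤ x := by exact_mod_cast h3.le
      have h5 := Real.log_le_log (by positivity) h4
      rw [Real.log_pow, Nat.pred_eq_sub_one, Nat.cast_sub hpos, Nat.cast_one] at h5
      linarith
  have h6 := Real.log_two_gt_d9
  have h7 := Real.log_two_lt_d9
  nlinarith

/-- `PadeSpec.cost` at the root with `B ≤ 2ρ`. Of the 49 logarithms, 48 come from the convolutions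
and one from the depth of the recursion; 291700 is 5 · 2917 · 10 · 2, and 44 comes from the base
cases. -/
theorem exists_cost_le_softO {A ω : ℝ} {W : ℕ → ℕ}
    (hW : ∀ N : ℕ, 1 ≤ N → (W N : ℝ) ≤ A * (N : ℝ) ^ ω)
    (hA : ∀ N : ℕ, 1 ≤ N → (N : ℝ) ^ 2 ≤ A * (N : ℝ) ^ ω) {R : MulRoutine K} (hR : R.IsCorrect)
    (hsize : ∀ k l c a b : ℕ, (R k l c a b).size ≤
      2917 * (a * b) * (Nat.clog 2 (a * b) + 3) ^ 48 * (k * l + l * c + k * c +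
        (c / max (max k l) 1 + 1) * W (max (max k l) 1))) :
    ∃ (C : ℝ) (c : ℕ), 0 ≤ C ∧ ∀ m n d e : ℕ, 1 ≤ m → 1 ≤ n → 1 ≤ d → 1 ≤ e →
      ∀ (ord : ModMonOrder m) (F : Matrix (Fin m) (Fin n) (BiRing K)),
        ((runPade R ord d e F).cost : ℝ) ≤ softO C c (padeBound ω m n d e) := by
  have hω := two_le_of_sq_le_rpow hA
  have hA1 : 1 ≤ A := by simpa using hA 1 le_rfl
  refine ⟨(44 + 291700 * A * 2 ^ (ω - 1)) * 8 ^ 49, 49, by positivity, ?_⟩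
  intro m n d e hm hn hd he ord F
  set B := m * (min d e + 1) with hB
  set L := Nat.clog 2 (d * e) with hL
  have hmin : 1 ≤ min d e := le_min hd he
  have hB1 : 1 ≤ B := Nat.mul_pos hm (Nat.succ_pos _)
  set Y : ℝ := 5 * A * (B : ℝ) ^ (ω - 1) * (B + n) with hY
  set τ := 2917 * (L + 5) ^ 48 * ⌊Y⌋₊ with hτ
  have hde : 1 ≤ d * e := Nat.mul_pos hd he
  have hcost := (runPade_spec hR ord hd he F).cost d e B τ (by omega) (by omega) le_top le_rfl
    (by
      intro k l c a b hk hl hc ha hb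
      refine (hsize k l c a b).trans ?_
      -- Transformations have degree bounds up to `d + 1` and `e + 1`, so `a b ≤ 4 d e` and the
      -- logarithm grows by at most 2.
      have hab : Nat.clog 2 (a * b) + 3 ≤ L + 5 := by
        have : Nat.clog 2 (a * b) ≤ L + 2 := by
          refine Nat.clog_le_of_le_pow ?_
          calc a * b ≤ (2 * d) * (2 * e) := Nat.mul_le_mul (by omega) (by omega)
            _ = d * e * 2 ^ 2 := by ring
            _ ≤ 2 ^ L * 2 ^ 2 := Nat.mul_le_mul_right _ (Nat.le_pow_clog (by norm_num) _)
            _ = 2 ^ (L + 2) := (pow_add _ _ _).symm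
        omega
      have hX := Nat.le_floor (rectangular_cost_le hW hA hk hl
        (show c ≤ n + B by omega) hB1)
      calc _ ≤ 2917 * (a * b) * (L + 5) ^ 48 * ⌊Y⌋₊ :=
            Nat.mul_le_mul (Nat.mul_le_mul_left _ (Nat.pow_le_pow_left hab 48)) hX
        _ = τ * (a * b) := by rw [hτ]; ring)
  set ρ : ℝ := (m : ℝ) * (min d e : ℕ) with hρ
  have hρ1 : 1 ≤ ρ := by
    rw [hρ]
    exact_mod_cast Nat.mul_pos hm hmin
  have hn1 : (1 : ℝ) ≤ n := by exact_mod_cast hn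
  have hd1 : (1 : ℝ) ≤ d := by exact_mod_cast hd
  have he1 : (1 : ℝ) ≤ e := by exact_mod_cast he
  have hBρ : (B : ℝ) ≤ 2 * ρ := by
    have : B ≤ 2 * (m * min d e) := by
      rw [hB]
      nlinarith
    rw [hρ]
    exact_mod_cast this
  have hB1' : (1 : ℝ) ≤ B := by exact_mod_cast hB1
  have hρω : 1 ≤ ρ ^ (ω - 1) := Real.one_le_rpow hρ1 (by linarith)
  have hYle : Y ≤ 10 * A * (2 ^ (ω - 1) * ρ ^ (ω - 1)) * (ρ + n) := by
    rw [← Real.mul_rpow (by norm_num) (by linarith)]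
    calc Y ≤ 5 * A * (2 * ρ) ^ (ω - 1) * (2 * ρ + 2 * n) := by
          have : 0 ≤ ω - 1 := by linarith
          rw [hY]
          gcongr
          linarith
      _ = _ := by ring
  have hτle : (τ : ℝ) ≤ 2917 * ((L : ℝ) + 5) ^ 48 *
      (10 * A * (2 ^ (ω - 1) * ρ ^ (ω - 1)) * (ρ + n)) := by
    rw [hτ]
    push_cast
    have hY0 : 0 ≤ Y := by positivity
    gcongr
    exact (Nat.floor_le hY0).trans hYle
  have hclog : (Nat.clog 2 d + Nat.clog 2 e : ℝ) ≤ 2 * ((L : ℝ) + 5) := by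
    have h1 : Nat.clog 2 d ≤ L := Nat.clog_mono_right 2 (Nat.le_mul_of_pos_right d he)
    have h2 : Nat.clog 2 e ≤ L := Nat.clog_mono_right 2 (Nat.le_mul_of_pos_left e hd)
    have : Nat.clog 2 d + Nat.clog 2 e ≤ 2 * (L + 5) := by omega
    exact_mod_cast this
  have hlin : (n * (3 * B + 8 * B * B + 2 * B * n) : ℝ) ≤ 44 * (ρ * n * (ρ + n)) := by
    calc (n * (3 * B + 8 * B * B + 2 * B * n) : ℝ) ≤ n * (11 * (B * (B + n))) := by
          gcongr
          nlinarith
      _ ≤ n * (11 * ((2 * ρ) * (2 * ρ + 2 * n))) := by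
          gcongr
          linarith
      _ = 44 * (ρ * n * (ρ + n)) := by ring
  set f := padeBound ω m n d e with hf
  have hf' : f = (ρ ^ (ω - 1) + ρ * n) * (ρ + n) * d * e := rfl
  have hfde : ((d * e : ℕ) : ℝ) ≤ f := by
    rw [hf', mul_assoc, Nat.cast_mul]
    refine le_mul_of_one_le_left (by positivity) ?_
    refine one_le_mul_of_one_le_of_one_le ?_ (by linarith)
    have : 0 ≤ ρ * n := by positivity
    linarith
  have hlog := clog_add_le_log hde hfde
  have hL5 : (1 : ℝ) ≤ ((L : ℝ) + 5) ^ 49 := one_le_pow₀ (by linarith [Nat.cast_nonneg (α := ℝ) L])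
  have hlog49 : ((L : ℝ) + 5) ^ 49 ≤ 8 ^ 49 * Real.log (2 + f) ^ 49 := by
    rw [← mul_pow]
    exact pow_le_pow_left₀ (by positivity) hlog 49
  generalize hy : ((L : ℝ) + 5) ^ 49 = y at hL5 hlog49
  have h2ω : (0 : ℝ) ≤ 2 ^ (ω - 1) := by positivity
  have hτ2 : 5 * (τ : ℝ) * (Nat.clog 2 d + Nat.clog 2 e) ≤
      291700 * A * 2 ^ (ω - 1) * y * (ρ ^ (ω - 1) * (ρ + n)) := by
    calc 5 * (τ : ℝ) * (Nat.clog 2 d + Nat.clog 2 e) ≤ 5 * (2917 * ((L : ℝ) + 5) ^ 48 *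
          (10 * A * (2 ^ (ω - 1) * ρ ^ (ω - 1)) * (ρ + n))) * (2 * ((L : ℝ) + 5)) := by gcongr
      _ = 291700 * A * 2 ^ (ω - 1) * ((L : ℝ) + 5) ^ 49 * (ρ ^ (ω - 1) * (ρ + n)) := by ring
      _ = _ := by rw [hy]
  have hde0 : (0 : ℝ) ≤ d * e := by positivity
  calc ((runPade R ord d e F).cost : ℝ) ≤ d * e * (n * (3 * B + 8 * B * B + 2 * B * n) +
        5 * τ * (Nat.clog 2 d + Nat.clog 2 e)) := by exact_mod_cast hcost
    _ ≤ d * e * (44 * y * (ρ * n * (ρ + n)) +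
        291700 * A * 2 ^ (ω - 1) * y * (ρ ^ (ω - 1) * (ρ + n))) := by
        refine mul_le_mul_of_nonneg_left (add_le_add (hlin.trans ?_) hτ2) hde0
        exact mul_le_mul_of_nonneg_right (by linarith) (by positivity)
    _ ≤ d * e * ((44 + 291700 * A * 2 ^ (ω - 1)) * y *
        ((ρ ^ (ω - 1) + ρ * n) * (ρ + n))) := by
        refine mul_le_mul_of_nonneg_left ?_ hde0
        have h1 : 0 ≤ y * (ρ ^ (ω - 1) * (ρ + n)) := by positivity
        have h2 : 0 ≤ A * 2 ^ (ω - 1) * y * (ρ * n * (ρ + n)) := by positivity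
        linarith
    _ = (44 + 291700 * A * 2 ^ (ω - 1)) * y * f := by rw [hf']; ring
    _ ≤ (44 + 291700 * A * 2 ^ (ω - 1)) * (8 ^ 49 * Real.log (2 + f) ^ 49) * f := by
        have hf0 : 0 ≤ f := (Nat.cast_nonneg _).trans hfde
        gcongr
    _ = softO _ 49 f := by rw [softO]; ring

theorem softO_le_of_le_four_mul {C f g : ℝ} (hC : 0 ≤ C) (c : ℕ) (hf : 0 ≤ f) (hg : 1 ≤ g)
    (hfg : f ≤ 4 * g) : softO C c f ≤ softO (C * 4 * 3 ^ c) c g := by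
  have h1 := one_le_log_two_add hg
  have h2 : Real.log (2 + f) ≤ 3 * Real.log (2 + g) := by
    have h3 : Real.log (2 + f) ≤ Real.log (2 ^ 2 * (2 + g)) :=
      Real.log_le_log (by linarith) (by linarith)
    rw [Real.log_mul (by norm_num) (by linarith), Real.log_pow] at h3
    have := Real.log_two_lt_d9
    push_cast at h3
    linarith
  have h0 : 0 ≤ Real.log (2 + f) := Real.log_nonneg (by linarith)
  calc softO C c f ≤ C * (4 * g) * (3 * Real.log (2 + g)) ^ c := by
        unfold softO
        gcongr
    _ = softO (C * 4 * 3 ^ c) c g := by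
        rw [softO, mul_pow]
        ring

/-- Here ρ = md, and both sums are at most twice their dominant term: md ≤ (md)^(ω-1) and 1 ≤ md.
This gives 4 (md)^ω d². -/
theorem padeBound_one_le {ω : ℝ} (hω : 2 ≤ ω) {m d : ℕ} (hm : 1 ≤ m) (hd : 1 ≤ d) :
    0 ≤ padeBound ω m 1 d d ∧ 1 ≤ (m : ℝ) ^ ω * (d : ℝ) ^ (ω + 2) ∧
      padeBound ω m 1 d d ≤ 4 * ((m : ℝ) ^ ω * (d : ℝ) ^ (ω + 2)) := by
  have hm1 : (1 : ℝ) ≤ m := by exact_mod_cast hm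
  have hd1 : (1 : ℝ) ≤ d := by exact_mod_cast hd
  have hρ : padeBound ω m 1 d d =
      (((m : ℝ) * d) ^ (ω - 1) + m * d) * (m * d + 1) * d * d := by
    simp [padeBound]
  refine ⟨by rw [hρ]; positivity, one_le_mul_of_one_le_of_one_le
    (Real.one_le_rpow hm1 (by linarith)) (Real.one_le_rpow hd1 (by linarith)), ?_⟩
  have hmd : 1 ≤ (m : ℝ) * d := one_le_mul_of_one_le_of_one_le hm1 hd1
  have h1 : (m : ℝ) * d ≤ ((m : ℝ) * d) ^ (ω - 1) := by
    simpa using Real.rpow_le_rpow_of_exponent_le hmd (show 1 ≤ ω - 1 by linarith)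
  have h2 : (m : ℝ) ^ ω * (d : ℝ) ^ (ω + 2) = ((m : ℝ) * d) ^ (ω - 1) * (m * d) * d * d := by
    rw [← Real.rpow_add_one (by positivity), sub_add_cancel,
      Real.mul_rpow (by positivity) (by positivity), Real.rpow_add (by positivity), Real.rpow_two]
    ring
  rw [hρ, h2]
  calc (((m : ℝ) * d) ^ (ω - 1) + m * d) * (m * d + 1) * d * d
      ≤ (((m : ℝ) * d) ^ (ω - 1) + ((m : ℝ) * d) ^ (ω - 1)) * (m * d + m * d) * d * d := by gcongr
    _ = _ := by ring

theorem hermitePade_eq_syzModule {m : ℕ} (f : Fin m → BiRing K) (d : ℕ) :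
    hermitePade f d = syzModule (padeModule K 1 d d) (Matrix.of fun i (_ : Fin 1) => f i) := by
  ext p
  rw [mem_syzModule, hermitePade, Submodule.mem_comap, Fintype.linearCombination_apply]
  constructor
  · intro h _
    exact h
  · intro h
    exact h 0

end Complexity

/-! ### Correctness, complexity and Hermite–Padé approximants together -/

theorem mainTheorem1 {K : Type*} [Field K] (ω : ℝ) (hω : IsMatMulExponent K ω) :
    -- correctness, whichever routine multiplies the polynomial matrices
    (∀ M : MulRoutine K, M.IsCorrect →
      ∀ m n d e : ℕ, 1 ≤ m → 1 ≤ n → 1 ≤ d → 1 ≤ e →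
      ∀ (ord : ModMonOrder m) (F : Matrix (Fin m) (Fin n) (BiRing K)),
        (∀ i j, (F i j).degreeOf 0 < d) → (∀ i j, (F i j).degreeOf 1 < e) →
        IsMinimalGroebnerBasis ord (syzModule (padeModule K n d e) F)
          (runPade M ord d e F).val.toMatrix) ∧
    -- number of operations, with a suitable routine
    (∃ M : MulRoutine K, M.IsCorrect ∧
      (∃ (C : ℝ) (c : ℕ), ∀ m n d e : ℕ, 1 ≤ m → 1 ≤ n → 1 ≤ d → 1 ≤ e →
        ∀ (ord : ModMonOrder m) (F : Matrix (Fin m) (Fin n) (BiRing K)),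
          (∀ i j, (F i j).degreeOf 0 < d) → (∀ i j, (F i j).degreeOf 1 < e) →
          ((runPade M ord d e F).cost : ℝ) ≤ softO C c (padeBound ω m n d e)) ∧
      -- Hermite-Padé approximants: the case of one column and of equal orders
      (∃ (C : ℝ) (c : ℕ), ∀ m d : ℕ, 1 ≤ m → 1 ≤ d →
        ∀ (ord : ModMonOrder m) (f : Fin m → BiRing K),
          IsMinimalGroebnerBasis ord (hermitePade f d)
            (runPade M ord d d (Matrix.of fun i (_ : Fin 1) => f i)).val.toMatrix ∧
          ((runPade M ord d d (Matrix.of fun i (_ : Fin 1) => f i)).cost : ℝ) ≤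
            softO C c ((m : ℝ) ^ ω * (d : ℝ) ^ (ω + 2)))) := by
  refine ⟨fun R hR m n d e hm hn hd he ord F _ _ =>
    runPade_isMinimalGroebnerBasis hR ord hd he F, ?_⟩
  obtain ⟨A, hA⟩ := hω
  choose c hc hsize using hA
  -- The lower bound on the size of the given programs forces `ω ≥ 2` and `A ≥ 1`.
  have hsq : ∀ N : ℕ, 1 ≤ N → (N : ℝ) ^ 2 ≤ A * (N : ℝ) ^ ω := fun N hN => by
    refine le_trans ?_ (hsize N hN)
    rw [sq]
    exact_mod_cast (hc N hN).sq_le_size hN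
  let W (N : ℕ) : ℕ := if hN : 1 ≤ N then (c N hN).size else 0
  have hW : ∀ N, 1 ≤ N → Computes (mulEntries K N N N) (W N) := by
    intro N hN
    have h : (fun x : _ → K => (c N hN).eval x) = mulEntries K N N N := by
      funext x p
      exact (hc N hN).eval_eq x p
    rw [← h, show W N = (c N hN).size from dif_pos hN]
    exact (c N hN).computes
  have hWA : ∀ N : ℕ, 1 ≤ N → (W N : ℝ) ≤ A * (N : ℝ) ^ ω := by
    intro N hN
    rw [show W N = (c N hN).size from dif_pos hN]
    exact hsize N hN
  obtain ⟨R, hR, hRsize⟩ := exists_mulRoutine hW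
  obtain ⟨C, γ, hC, hcost⟩ := exists_cost_le_softO hWA hsq hR hRsize
  refine ⟨R, hR, ⟨C, γ, fun m n d e hm hn hd he ord F _ _ => hcost m n d e hm hn hd he ord F⟩,
    C * 4 * 3 ^ γ, γ, fun m d hm hd ord f => ⟨?_, ?_⟩⟩
  · rw [hermitePade_eq_syzModule]
    exact runPade_isMinimalGroebnerBasis hR ord hd hd _
  · obtain ⟨h0, h1, h2⟩ := padeBound_one_le (two_le_of_sq_le_rpow hsq) hm hd
    exact (hcost m 1 d d hm le_rfl hd hd ord _).trans (softO_le_of_le_four_mul hC γ h0 h1 h2)
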